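/- **Setting.** Let $d\in\{2,3\}$, let $\Omega\subset\mathbb R^d$ be a bounded domain (open and connected), $T>0$ and $r\ge 1$ an integer. $\|\cdot\|$ is the norm and $\langle\cdot,\cdot\rangle$ the inner product of $L^2(\Omega)$ (also for vector- and matrix-valued functions), $\|\cdot\|_m$ the norm of $H^m(\Omega)$. Put $V=H^1_0(\Omega)^d$, $Q=L^2_0(\Omega)$ (mean value zero), $a(u,v)=\langle\nabla u,\nabla v\rangle$, $b(v,q)=-\langle\nabla\cdot v,q\rangle$. Assume that the stationary Stokes problem is $H^2$-regular: there is a constant $C$ such that for every $g\in L^2(\Omega)^d$ the weak solution $(v,q)\in V\times Q$ of $-\Delta v+\nabla q=g$, $\nabla\cdot v=0$ exists and lies in $H^2\times H^1$ with $\|v\|_2+\|q\|_1\le C\|g\|$. Let $(u,p)$ solve $\partial_t u-\Delta u+\nabla p=f$, $\nabla\cdot u=0$ in $\Omega\times[0,T]$, $u(0)=u_0$, $u=0$ on $\partial\Omega$, $\int_\Omega p(t)\,dx=0$, and be regular up to $t=0$, namely $u\in C^4([0,T];L^2)\cap C^3([0,T];H^{r+1})$, $p\in C^3([0,T];H^r)$,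 $p(0)\in H^{r+2}(\Omega)$. **Discrete spaces.** Fix $\beta,c,h_0>0$. For $0<h\le h_0$ let $V_h\subset V$, $Q_h\subset Q$ be finite dimensional subspaces with the inf-sup condition $\sup_{v_h\in V_h\setminus\{0\}} b(v_h,q_h)/\|v_h\|_1\ge\beta\|q_h\|$ for all $q_h\in Q_h$ and the approximation property of order $r$: for all $v\in V\cap H^{r+1}(\Omega)^d$, $q\in Q\cap H^r(\Omega)$ there are $i_hv\in V_h$, $j_hq\in Q_h$ with $$\|v-i_hv\|+h\|\nabla(v-i_hv)\|\le c\,h^{r+1}\|v\|_{r+1},\qquad \|q-j_hq\|\le c\,h^r\|q\|_r .$$ Let $V_h^{\rm div}=\{v_h\in V_h: b(v_h,q_h)=0\ \forall q_h\in Q_h\}$. The Stokes projection $R_h(w,s)=(R_h^u(w,s),R_h^p(w,s))\in V_h^{\rm div}\times Q_h$ is defined by $a(R_h^u(w,s),v_h)+b(v_h,R_h^p(w,s))=a(w,v_h)+b(v_h,s)$ for all $v_h\in V_h$. **Discrete initial velocity.** $(a_{0,h},s_h)\in V_h^{\rm div}\times Q_h$ solves $a(a_{0,h},v_h)+b(v_h,s_h)=\langle\nabla(f(0)+\Delta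 u_0),\nabla v_h\rangle$ for all $v_h\in V_h$, and $(u_{0,h},p_{0,h})\in V_h^{\rm div}\times Q_h$ solves $a(u_{0,h},v_h)+b(v_h,p_{0,h})=\langle f(0)-a_{0,h},v_h\rangle$ for all $v_h\in V_h$. **Scheme.** Let $0=t_0<\dots<t_N=T$, $I_n=(t_{n-1},t_n]$, $\tau_n=t_n-t_{n-1}$, $\tau=\max_n\tau_n$. Let $u_{\tau,h}(0)=u_{0,h}$ and, for $n=1,\dots,N$, let $u_{\tau,h}|_{I_n}$, $p_{\tau,h}|_{I_n}$ be polynomials in $t$ of degree at most 1 with values in $V_h$ and $Q_h$ such that $u_{\tau,h}(t)\to u_{\tau,h}(t_{n-1})$ as $t\downarrow t_{n-1}$ and, for all $v_h\in V_h$, $q_h\in Q_h$, $$\int_{t_{n-1}}^{t_n}\!\big(\langle\partial_tu_{\tau,h},v_h\rangle+a(u_{\tau,h},v_h)+b(v_h,p_{\tau,h})\big)dt=\tfrac{\tau_n}{2}\langle f(t_{n-1})+f(t_n),v_h\rangle,\qquad \int_{t_{n-1}}^{t_n}\! b(u_{\tau,h},q_h)\,dt=0$$ ($p_{\tau,h}$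 is any of the possible pressure solutions). **Post-processing by collocation.** On $I_n$ put $\tilde u_{\tau,h}=u_{\tau,h}+c_n\vartheta_n$, $\tilde p_{\tau,h}=p_{\tau,h}+d_n\vartheta_n'$ with $\vartheta_n(t)=\alpha_n(t-t_{n-1})(t-t_n)$, $\vartheta_n'(t_{n-1})=1$, where $c_n\in V_h^{\rm div}$, $d_n\in Q_h$ are such that, with right-sided limits at $t_{n-1}$, $\langle\partial_t\tilde u_{\tau,h}(t_{n-1}),v_h\rangle+a(\tilde u_{\tau,h}(t_{n-1}),v_h)+b(v_h,\tilde p_{\tau,h}(t_{n-1}))=\langle f(t_{n-1}),v_h\rangle$ and $b(\tilde u_{\tau,h}(t_{n-1}),q_h)=0$ for all $v_h\in V_h$, $q_h\in Q_h$. **Claim.** There is a constant $C>0$, independent of $h$, of $V_h,Q_h$ (for fixed $\beta,c,h_0$) and of the time mesh, such that $p-\tilde p_{\tau,h}\in L^2(0,T;L^2(\Omega))$ and $$\Big(\int_0^T\|p(t)-\tilde p_{\tau,h}(t)\|^2\,dt\Big)^{1/2}\le C\,(\tau^2+h^r).$$ Moreover, the initial errors satisfy $$\big\|\nabla\big(R_h^u(\partial_tu(0),\partial_tp(0))-\partial_t\tilde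 u_{\tau,h}(0)\big)\big\|\le C\,h^r,$$ with $\partial_t\tilde u_{\tau,h}(0)$ the right-sided limit at $0$, and $$\big\|\nabla\big(R_h^u(u(0),p(0))-u_{\tau,h}(0)\big)\big\|\le C\,h^{r+1},$$ the latter provided that $V_h,Q_h$ also have the approximation property of order $1$ with the constant $c$, i.e. the one above with $r$ replaced by $1$ (this is no additional condition if $r=1$). -/

import Mathlib

open MeasureTheory Set Filter Topology
open scoped ContDiff

noncomputable section

namespace StokesFEM

/-! ### Lebesgue and Sobolev spaces on a subset of Euclidean space -/

/-- The space `L²(Ω)`. -/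
abbrev L2 {d : ℕ} (Ω : Set (EuclideanSpace ℝ (Fin d))) : Type :=
  Lp ℝ 2 (volume.restrict Ω)

/-- The space `L²(Ω)^d`, with `⟨u, v⟩ = ∑ i, ⟨u i, v i⟩`. -/
abbrev VL2 {d : ℕ} (Ω : Set (EuclideanSpace ℝ (Fin d))) : Type :=
  PiLp 2 (fun _ : Fin d => L2 Ω)

/-- Test functions: `φ ∈ C_c^∞(Ω)`. -/
structure IsTest {d : ℕ} (Ω : Set (EuclideanSpace ℝ (Fin d)))
    (φ : EuclideanSpace ℝ (Fin d) → ℝ) : Prop where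
  smooth : ContDiff ℝ ∞ φ
  compact : HasCompactSupport φ
  supp : tsupport φ ⊆ Ω

/-- The classical iterated partial derivative `∂_{i₁} ⋯ ∂_{i_k} φ` for `I = [i₁, …, i_k]`. -/
def pd {d : ℕ} (I : List (Fin d)) (φ : EuclideanSpace ℝ (Fin d) → ℝ) :
    EuclideanSpace ℝ (Fin d) → ℝ :=
  I.foldr (fun i ψ x => fderiv ℝ ψ x (EuclideanSpace.single i 1)) φ

/-- `g` is the weak derivative `∂_{i₁} ⋯ ∂_{i_k} u` in `Ω`, for `I = [i₁, …, i_k]`. -/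
def IsWeakDeriv {d : ℕ} (Ω : Set (EuclideanSpace ℝ (Fin d))) (I : List (Fin d))
    (u g : L2 Ω) : Prop :=
  ∀ φ : EuclideanSpace ℝ (Fin d) → ℝ, IsTest Ω φ →
    ∫ x in Ω, u x * pd I φ x = (-1) ^ I.length * ∫ x in Ω, g x * φ x

open Classical in
/-- The weak derivative `∂_{i₁} ⋯ ∂_{i_k} u ∈ L²(Ω)` (zero if there is none). -/
def wD {d : ℕ} (Ω : Set (EuclideanSpace ℝ (Fin d))) (I : List (Fin d)) (u : L2 Ω) : L2 Ω :=
  if h : ∃ g, IsWeakDeriv Ω I u g then h.choose else 0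

/-- `H^m(Ω)`: all weak derivatives of order at most `m` exist in `L²(Ω)`. -/
def Hm {d : ℕ} (Ω : Set (EuclideanSpace ℝ (Fin d))) (m : ℕ) : Set (L2 Ω) :=
  {u | ∀ I : List (Fin d), I.length ≤ m → ∃ g, IsWeakDeriv Ω I u g}

/-- The norm of `H^m(Ω)`: `‖u‖_m² = ∑_{k ≤ m} ‖∇^k u‖²`. -/
def sobNorm {d : ℕ} (Ω : Set (EuclideanSpace ℝ (Fin d))) (m : ℕ) (u : L2 Ω) : ℝ :=
  Real.sqrt (∑ k ∈ Finset.range (m + 1), ∑ I : Fin k → Fin d, ‖wD Ω (List.ofFn I) u‖ ^ 2)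

/-- `H^1_0(Ω)`: the closure of `C_c^∞(Ω)` in `H^1(Ω)`. -/
def H10 {d : ℕ} (Ω : Set (EuclideanSpace ℝ (Fin d))) : Set (L2 Ω) :=
  {u | u ∈ Hm Ω 1 ∧ ∀ ε > 0, ∃ φ : EuclideanSpace ℝ (Fin d) → ℝ, IsTest Ω φ ∧
    ∃ w : L2 Ω, w =ᵐ[volume.restrict Ω] φ ∧ sobNorm Ω 1 (u - w) < ε}

/-- `L²_0(Ω)`, the pressure space `Q`. -/
def L20 {d : ℕ} (Ω : Set (EuclideanSpace ℝ (Fin d))) : Set (L2 Ω) :=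
  {q | ∫ x in Ω, q x = 0}

/-- The velocity space `V = H^1_0(Ω)^d`. -/
def VSp {d : ℕ} (Ω : Set (EuclideanSpace ℝ (Fin d))) : Set (VL2 Ω) :=
  {v | ∀ i, v i ∈ H10 Ω}

/-- The space `H^m(Ω)^d`. -/
def VHm {d : ℕ} (Ω : Set (EuclideanSpace ℝ (Fin d))) (m : ℕ) : Set (VL2 Ω) :=
  {v | ∀ i, v i ∈ Hm Ω m}

/-- The norm of `H^m(Ω)^d`. -/
def vsobNorm {d : ℕ} (Ω : Set (EuclideanSpace ℝ (Fin d))) (m : ℕ) (v : VL2 Ω) : ℝ :=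
  Real.sqrt (∑ i, sobNorm Ω m (v i) ^ 2)

/-- `w ∈ C^k([0,T]; H^m(Ω))`: all spatial derivatives of order at most `m` exist and are
`k` times continuously differentiable in time, up to the endpoints, with values in `L²(Ω)`. -/
def TimeReg {d : ℕ} (Ω : Set (EuclideanSpace ℝ (Fin d))) (T : ℝ) (k m : ℕ)
    (w : ℝ → L2 Ω) : Prop :=
  (∀ t ∈ Icc 0 T, w t ∈ Hm Ω m) ∧
  ∀ I : List (Fin d), I.length ≤ m → ContDiffOn ℝ k (fun t => wD Ω I (w t)) (Icc 0 T)

/-! ### Differential operators and bilinear forms -/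

/-- The gradient of a scalar function. -/
def grad {d : ℕ} (Ω : Set (EuclideanSpace ℝ (Fin d))) (q : L2 Ω) : VL2 Ω :=
  WithLp.toLp 2 (fun i => wD Ω [i] q)

/-- The divergence of a vector field. -/
def dvg {d : ℕ} (Ω : Set (EuclideanSpace ℝ (Fin d))) (v : VL2 Ω) : L2 Ω :=
  ∑ i, wD Ω [i] (v i)

/-- The (componentwise) Laplacian of a vector field. -/
def lapl {d : ℕ} (Ω : Set (EuclideanSpace ℝ (Fin d))) (v : VL2 Ω) : VL2 Ω :=
  WithLp.toLp 2 (fun i => ∑ j, wD Ω [j, j] (v i))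

/-- `a(u, v) = ⟨∇u, ∇v⟩`. -/
def aForm {d : ℕ} (Ω : Set (EuclideanSpace ℝ (Fin d))) (u v : VL2 Ω) : ℝ :=
  ∑ i, ∑ j, inner ℝ (wD Ω [j] (u i)) (wD Ω [j] (v i))

/-- `b(v, q) = -⟨∇ · v, q⟩`. -/
def bForm {d : ℕ} (Ω : Set (EuclideanSpace ℝ (Fin d))) (v : VL2 Ω) (q : L2 Ω) : ℝ :=
  -inner ℝ (dvg Ω v) q

/-- `‖∇v‖`. -/
def gradNorm {d : ℕ} (Ω : Set (EuclideanSpace ℝ (Fin d))) (v : VL2 Ω) : ℝ :=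
  Real.sqrt (aForm Ω v v)

/-- `H²`-regularity of the stationary Stokes problem: for every right-hand side `g ∈ L²(Ω)^d`
the (weak) solution `(v, q) ∈ V × Q` of `-Δv + ∇q = g`, `∇ · v = 0` lies in `H² × H¹`, with
`‖v‖_2 + ‖q‖_1 ≤ C ‖g‖`. -/
def StokesH2Regular {d : ℕ} (Ω : Set (EuclideanSpace ℝ (Fin d))) : Prop :=
  ∃ C : ℝ, ∀ g : VL2 Ω, ∃ v ∈ VSp Ω, ∃ q ∈ L20 Ω,
    (∀ w ∈ VSp Ω, aForm Ω v w + bForm Ω w q = inner ℝ g w) ∧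
    (∀ s ∈ L20 Ω, bForm Ω v s = 0) ∧
    v ∈ VHm Ω 2 ∧ q ∈ Hm Ω 1 ∧ vsobNorm Ω 2 v + sobNorm Ω 1 q ≤ C * ‖g‖

/-- `(u, p)` is a solution of the nonstationary Stokes system on `[0,T]` with force `f` and
initial velocity `u₀`:  `∂_t u - Δu + ∇p = f`, `∇ · u = 0`, `u(0) = u₀`, `u = 0` on `∂Ω`, where
`p(t)` has mean value zero. It is regular up to `t = 0`:
`u ∈ C⁴([0,T]; L²) ∩ C³([0,T]; H^{r+1})`, `p ∈ C³([0,T]; H^r)` and `p(0) ∈ H^{r+2}`. -/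
structure IsRegularStokesSolution {d : ℕ} (Ω : Set (EuclideanSpace ℝ (Fin d))) (T : ℝ) (r : ℕ)
    (f : ℝ → VL2 Ω) (u₀ : VL2 Ω) (u : ℝ → VL2 Ω) (p : ℝ → L2 Ω) : Prop where
  momentum : ∀ t ∈ Icc 0 T,
    derivWithin u (Icc 0 T) t - lapl Ω (u t) + grad Ω (p t) = f t
  divFree : ∀ t ∈ Icc 0 T, dvg Ω (u t) = 0
  initial : u 0 = u₀
  boundary : ∀ t ∈ Icc 0 T, u t ∈ VSp Ω
  meanZero : ∀ t ∈ Icc 0 T, p t ∈ L20 Ω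
  reg_u : ContDiffOn ℝ 4 u (Icc 0 T)
  reg_ux : ∀ i, TimeReg Ω T 3 (r + 1) (fun t => u t i)
  reg_p : TimeReg Ω T 3 r p
  reg_p0 : p 0 ∈ Hm Ω (r + 2)

/-! ### Discretization in space -/

/-- Approximation property of order `s` of the discrete spaces, with constant `c`. -/
structure HasApproxOrder {d : ℕ} (Ω : Set (EuclideanSpace ℝ (Fin d))) (s : ℕ) (c h : ℝ)
    (Vh : Submodule ℝ (VL2 Ω)) (Qh : Submodule ℝ (L2 Ω)) : Prop where
  velocity : ∀ v ∈ VSp Ω ∩ VHm Ω (s + 1), ∃ w ∈ Vh,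
    ‖v - w‖ + h * gradNorm Ω (v - w) ≤ c * h ^ (s + 1) * vsobNorm Ω (s + 1) v
  pressure : ∀ q ∈ L20 Ω ∩ Hm Ω s, ∃ w ∈ Qh, ‖q - w‖ ≤ c * h ^ s * sobNorm Ω s q

/-- Conforming, finite dimensional spaces `V_h ⊂ V`, `Q_h ⊂ Q` that satisfy the inf-sup condition
with constant `β` and the approximation property of order `r` with constant `c`. -/
structure IsStablePair {d : ℕ} (Ω : Set (EuclideanSpace ℝ (Fin d))) (r : ℕ) (β c h : ℝ)
    (Vh : Submodule ℝ (VL2 Ω)) (Qh : Submodule ℝ (L2 Ω)) : Prop where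
  finV : FiniteDimensional ℝ Vh
  finQ : FiniteDimensional ℝ Qh
  subV : ∀ v ∈ Vh, v ∈ VSp Ω
  subQ : ∀ q ∈ Qh, q ∈ L20 Ω
  infsup : ∀ q ∈ Qh, q ≠ 0 → ∃ v ∈ Vh, v ≠ 0 ∧ β * (vsobNorm Ω 1 v * ‖q‖) ≤ bForm Ω v q
  approx : HasApproxOrder Ω r c h Vh Qh

/-- `v ∈ V_h^div`: discretely divergence-free functions. -/
def IsDiscDivFree {d : ℕ} (Ω : Set (EuclideanSpace ℝ (Fin d))) (Vh : Submodule ℝ (VL2 Ω))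
    (Qh : Submodule ℝ (L2 Ω)) (v : VL2 Ω) : Prop :=
  v ∈ Vh ∧ ∀ q ∈ Qh, bForm Ω v q = 0

/-- `(û_h, p̂_h) ∈ V_h × Q_h` is the Stokes projection of `(u, p)`. -/
structure IsStokesProj {d : ℕ} (Ω : Set (EuclideanSpace ℝ (Fin d))) (Vh : Submodule ℝ (VL2 Ω))
    (Qh : Submodule ℝ (L2 Ω)) (u : VL2 Ω) (p : L2 Ω) (uh : VL2 Ω) (ph : L2 Ω) : Prop where
  div : IsDiscDivFree Ω Vh Qh uh
  pres : ph ∈ Qh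
  eq : ∀ v ∈ Vh, aForm Ω uh v + bForm Ω v ph = aForm Ω u v + bForm Ω v p

/-- The discrete initial velocity `u0h`, obtained from the two auxiliary Stokes problems
`⟨A_h a0h + B_h' s_h, v⟩ = ⟨∇(f₀ + Δu₀), ∇v⟩` and `⟨A_h u0h + B_h' p0h, v⟩ = ⟨f₀ - a0h, v⟩`
for discretely divergence-free `a0h`, `u0h`. -/
def IsDiscInitVal {d : ℕ} (Ω : Set (EuclideanSpace ℝ (Fin d))) (Vh : Submodule ℝ (VL2 Ω))
    (Qh : Submodule ℝ (L2 Ω)) (f₀ u₀ u0h : VL2 Ω) : Prop :=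
  ∃ (a0h : VL2 Ω) (sh p0h : L2 Ω),
    (IsDiscDivFree Ω Vh Qh a0h ∧ sh ∈ Qh ∧
      ∀ v ∈ Vh, aForm Ω a0h v + bForm Ω v sh = aForm Ω (f₀ + lapl Ω u₀) v) ∧
    (IsDiscDivFree Ω Vh Qh u0h ∧ p0h ∈ Qh ∧
      ∀ v ∈ Vh, aForm Ω u0h v + bForm Ω v p0h = inner ℝ (f₀ - a0h) v)

/-! ### Discretization in time -/

/-- A time mesh `0 = t 0 < t 1 < ⋯ < t N = T`. -/
structure IsTimeMesh (T : ℝ) (N : ℕ) (t : ℕ → ℝ) : Prop where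
  first : t 0 = 0
  last : t N = T
  lt : ∀ n < N, t n < t (n + 1)

/-- The mesh size `τ = max_n τ_n`. -/
def meshSize (N : ℕ) (t : ℕ → ℝ) : ℝ := ⨆ n : Fin N, (t (n + 1) - t n)

/-- `w` is on `J` a polynomial of degree at most `k` with coefficients in the subspace `W`. -/
def IsPolyOn {X : Type*} [AddCommGroup X] [Module ℝ X] (k : ℕ) (J : Set ℝ) (W : Submodule ℝ X)
    (w : ℝ → X) : Prop :=
  ∃ c : ℕ → X, (∀ j, c j ∈ W) ∧ ∀ s ∈ J, w s = ∑ j ∈ Finset.range (k + 1), s ^ j • c j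

/-- `(uh, ph)` is a global solution of the space-time problems on the intervals
`(t n, t (n+1)]`, `n < N`, started from `u0h`. -/
structure IsDiscreteSolution {d : ℕ} (Ω : Set (EuclideanSpace ℝ (Fin d)))
    (Vh : Submodule ℝ (VL2 Ω)) (Qh : Submodule ℝ (L2 Ω)) (N : ℕ) (t : ℕ → ℝ)
    (f : ℝ → VL2 Ω) (u0h : VL2 Ω) (uh : ℝ → VL2 Ω) (ph : ℝ → L2 Ω) : Prop where
  initial : uh 0 = u0h
  poly_u : ∀ n < N, IsPolyOn 1 (Ioc (t n) (t (n + 1))) Vh uh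
  poly_p : ∀ n < N, IsPolyOn 1 (Ioc (t n) (t (n + 1))) Qh ph
  cont : ∀ n < N, Tendsto uh (𝓝[>] (t n)) (𝓝 (uh (t n)))
  momentum : ∀ n < N, ∀ v ∈ Vh,
    ∫ s in (t n)..(t (n + 1)), (inner ℝ (deriv uh s) v + aForm Ω (uh s) v + bForm Ω v (ph s))
      = (t (n + 1) - t n) / 2 * (inner ℝ (f (t n)) v + inner ℝ (f (t (n + 1))) v)
  mass : ∀ n < N, ∀ q ∈ Qh, ∫ s in (t n)..(t (n + 1)), bForm Ω (uh s) q = 0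

/-- The quadratic polynomial `ϑ` that vanishes at `a` and `b`, with `ϑ'(a) = 1`. -/
def bubble (a b s : ℝ) : ℝ := -(1 / (b - a)) * ((s - a) * (s - b))

theorem hasDerivAt_bubble (a b s : ℝ) :
    HasDerivAt (bubble a b) (-(1 / (b - a)) * (2 * s - a - b)) s := by
  have h1 : HasDerivAt (fun x : ℝ => (x - a) * (x - b)) (1 * (s - b) + (s - a) * 1) s :=
    ((hasDerivAt_id s).sub_const a).mul ((hasDerivAt_id s).sub_const b)
  have h2 := h1.const_mul (-(1 / (b - a)))
  have e : -(1 / (b - a)) * (2 * s - a - b)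
      = -(1 / (b - a)) * (1 * (s - b) + (s - a) * 1) := by ring
  rw [e]
  exact h2

theorem deriv_bubble_left {a b : ℝ} (h : a < b) : deriv (bubble a b) a = 1 := by
  rw [(hasDerivAt_bubble a b a).deriv]
  have : b - a ≠ 0 := by linarith
  field_simp
  ring

/-- `(ut, pt)` is the post-processed solution obtained from `(uh, ph)` by collocation:
on each interval `ut = uh + ϑ c`, `pt = ph + ϑ' e` with `c ∈ V_h^div`, `e ∈ Q_h` such that the
collocation conditions hold at the left endpoint, where the values of `∂_t ut`, `ut`, `pt` are the
right-sided limits. -/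
def IsPostProcessed {d : ℕ} (Ω : Set (EuclideanSpace ℝ (Fin d)))
    (Vh : Submodule ℝ (VL2 Ω)) (Qh : Submodule ℝ (L2 Ω)) (N : ℕ) (t : ℕ → ℝ)
    (f : ℝ → VL2 Ω) (uh : ℝ → VL2 Ω) (ph : ℝ → L2 Ω) (ut : ℝ → VL2 Ω) (pt : ℝ → L2 Ω) : Prop :=
  ∀ n < N, ∃ (c : VL2 Ω) (e : L2 Ω), IsDiscDivFree Ω Vh Qh c ∧ e ∈ Qh ∧
    (∀ s ∈ Ioc (t n) (t (n + 1)), ut s = uh s + bubble (t n) (t (n + 1)) s • c) ∧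
    (∀ s ∈ Ioc (t n) (t (n + 1)), pt s = ph s + deriv (bubble (t n) (t (n + 1))) s • e) ∧
    ∃ (a w : VL2 Ω) (q : L2 Ω),
      Tendsto (deriv ut) (𝓝[>] (t n)) (𝓝 a) ∧
      Tendsto ut (𝓝[>] (t n)) (𝓝 w) ∧
      Tendsto pt (𝓝[>] (t n)) (𝓝 q) ∧
      (∀ v ∈ Vh, inner ℝ a v + aForm Ω w v + bForm Ω v q = inner ℝ (f (t n)) v) ∧
      (∀ s ∈ Qh, bForm Ω w s = 0)

end StokesFEM

end

open StokesFEM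

open StokesFEM

noncomputable section

namespace StokesFEM

/-! ### Weak derivatives, Sobolev spaces and Poincaré's inequality. -/

section Sobolev

variable {d : ℕ} {Ω : Set (EuclideanSpace ℝ (Fin d))} {φ ψ : EuclideanSpace ℝ (Fin d) → ℝ}

/-! ### Test functions -/

/-! The post-processed scheme is the trapezoidal rule in disguise. On one interval let `c₁` be the
slope of the discrete velocity. Since `ϑ'` equals `1` at the left and `-1` at the right endpoint,
the post-processed velocity has the one-sided derivatives `c₁ + c` and `c₁ - c` there. The momentum
equation is the average of the collocation equations at the two endpoints, so collocation on the
left forces collocation on the right (`collocation_right`). For a given velocity these equations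
determine the derivative and the pressure (`StableForms.collocation_unique`), so the values from
neighbouring intervals agree at the common node. Whichever pressure solution was taken, the
post-processed pressure is therefore the piecewise linear interpolant of nodal values `q n`, and the
velocities satisfy `x (n+1) - x n = τ/2 • (g n + g (n+1))`, where `g n` is the discrete time
derivative (`exists_collocation`).

The nodal errors are compared with Stokes projections. Put `E = x - R(u,p)` and `F = g -
R(∂ₜu,∂ₜp)`. The difference of the error equations at two adjacent nodes, tested with `F n + F
(n+1)`, yields the increment of `‖F‖²` and, as `E (n+1) - E n` is `τ/2 • (F n + F (n+1))` up to the
projected quadrature error, the dissipation `τ/2 ‖∇(F n + F (n+1))‖²`. This dissipation absorbs all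
consistency terms, and also the growth of `‖∇E‖`, without any Gronwall argument (`energy_estimate`,
`velocity_error`). The inf-sup condition converts the bounds for `g - ∂ₜu` and `∇(x - u)` into one
for the nodal pressure (`pressure_error`). The error of linear interpolation in time is of order
`τ²`, so the estimate holds pointwise in time, hence in `L²`.

The start of the iteration rests on `f(0) + Δu₀ = ∂ₜu(0) + ∇p(0)`. Integrating by parts twice,
`⟨∇∇p(0), ∇v⟩ = ⟨Δp(0), ∇·v⟩`, so the gradient acts like a change of pressure and `a_{0,h}` is the
Stokes projection of `∂ₜu(0)` with the pressure `-Δp(0)`, normalized to mean zero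
(`exists_initial_pressure`). The second auxiliary problem makes `g 0` equal to `a_{0,h}`. The
initial error of the derivative is then a pressure approximation error of order `r`, and that of the
velocity is controlled by the `L²` error of a Stokes projection, of order `r + 1` by duality and
`H²`-regularity (`StableForms.initial_error`, `norm_isProj_error_le`). -/

theorem IsTest.pd (hφ : IsTest Ω φ) (I : List (Fin d)) : IsTest Ω (pd I φ) := by
  induction I with
  | nil => exact hφ
  | cons i I ih =>
    refine ⟨(ih.smooth.fderiv_right (m := ∞) (by simp)).clm_apply contDiff_const,
      ih.compact.fderiv_apply ℝ _, ?_⟩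
    exact (tsupport_fderiv_apply_subset ℝ _).trans ih.supp

theorem IsTest.add (hφ : IsTest Ω φ) (hψ : IsTest Ω ψ) : IsTest Ω (φ + ψ) :=
  ⟨hφ.smooth.add hψ.smooth, hφ.compact.add hψ.compact,
    (tsupport_add φ ψ).trans (union_subset hφ.supp hψ.supp)⟩

theorem IsTest.const_smul (hφ : IsTest Ω φ) (a : ℝ) : IsTest Ω (a • φ) :=
  ⟨hφ.smooth.const_smul a, hφ.compact.mono (Function.support_const_smul_subset a φ),
    (closure_mono (Function.support_const_smul_subset a φ)).trans hφ.supp⟩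

theorem isTest_zero : IsTest Ω (0 : EuclideanSpace ℝ (Fin d) → ℝ) :=
  ⟨contDiff_const, HasCompactSupport.zero, by simp [tsupport]⟩

theorem IsTest.eq_zero (hφ : IsTest Ω φ) {x : EuclideanSpace ℝ (Fin d)} (hx : x ∉ Ω) : φ x = 0 :=
  image_eq_zero_of_notMem_tsupport fun h => hx (hφ.supp h)

theorem pd_append (I J : List (Fin d)) : pd (I ++ J) φ = pd I (pd J φ) := by
  simp [pd, List.foldr_append]

theorem IsTest.pd_comm (hφ : IsTest Ω φ) (i j : Fin d) :
    StokesFEM.pd [i, j] φ = StokesFEM.pd [j, i] φ := by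
  have key : ∀ i j x, StokesFEM.pd [i, j] φ x =
      fderiv ℝ (fderiv ℝ φ) x (EuclideanSpace.single i 1) (EuclideanSpace.single j 1) := by
    intro i j x
    have h : DifferentiableAt ℝ (fderiv ℝ φ) x :=
      ((hφ.smooth.fderiv_right (m := ∞) (by simp)).differentiable (by simp)) x
    simp only [StokesFEM.pd, List.foldr_cons, List.foldr_nil]
    rw [fderiv_clm_apply h (differentiableAt_const _)]
    simp
  funext x
  rw [key, key]
  exact (hφ.smooth.contDiffAt.isSymmSndFDerivAt
    (by simpa using (WithTop.coe_le_coe.2 le_top : ((2 : ℕ∞) : WithTop ℕ∞) ≤ ∞))).eq _ _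

theorem IsTest.integral_mul_pd (hφ : IsTest Ω φ) {g : EuclideanSpace ℝ (Fin d) → ℝ}
    (hg : ContDiff ℝ ∞ g) (i : Fin d) :
    ∫ x in Ω, g x * StokesFEM.pd [i] φ x
      = -∫ x in Ω, fderiv ℝ g x (EuclideanSpace.single i 1) * φ x := by
  have h1 := (hφ.pd [i])
  rw [setIntegral_eq_integral_of_forall_compl_eq_zero fun x hx => by rw [h1.eq_zero hx, mul_zero],
    setIntegral_eq_integral_of_forall_compl_eq_zero fun x hx => by rw [hφ.eq_zero hx, mul_zero]]
  have hg' : Continuous fun x => fderiv ℝ g x (EuclideanSpace.single i 1) :=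
    ((hg.fderiv_right (m := ∞) (by simp)).clm_apply contDiff_const).continuous
  refine integral_mul_fderiv_eq_neg_fderiv_mul_of_integrable ?_ ?_ ?_
    (fun x _ => hg.differentiable (by simp) x) (fun x _ => hφ.smooth.differentiable (by simp) x)
  · exact (hg'.mul hφ.smooth.continuous).integrable_of_hasCompactSupport hφ.compact.mul_left
  · exact (hg.continuous.mul h1.smooth.continuous).integrable_of_hasCompactSupport
      h1.compact.mul_left
  · exact (hg.continuous.mul hφ.smooth.continuous).integrable_of_hasCompactSupport
      hφ.compact.mul_left

theorem IsTest.memLp (hφ : IsTest Ω φ) : MemLp φ 2 (volume.restrict Ω) :=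
  (hφ.smooth.continuous.memLp_of_hasCompactSupport hφ.compact).restrict Ω

/-- The class in `L²(Ω)` of a test function. -/
def testLp (hφ : IsTest Ω φ) : L2 Ω := hφ.memLp.toLp φ

theorem testLp_congr (hφ : IsTest Ω φ) (hψ : IsTest Ω ψ) (h : φ = ψ) : testLp hφ = testLp hψ := by
  subst h
  rfl

theorem coeFn_testLp (hφ : IsTest Ω φ) : testLp hφ =ᵐ[volume.restrict Ω] φ :=
  hφ.memLp.coeFn_toLp

theorem inner_eq_integral (u v : L2 Ω) : inner ℝ u v = ∫ x in Ω, u x * v x := by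
  rw [L2.inner_def]
  refine integral_congr_ae (.of_forall fun x => ?_)
  simp [mul_comm]

theorem inner_testLp (u : L2 Ω) (hφ : IsTest Ω φ) :
    inner ℝ u (testLp hφ) = ∫ x in Ω, u x * φ x := by
  rw [inner_eq_integral]
  refine integral_congr_ae ?_
  filter_upwards [coeFn_testLp hφ] with x hx
  rw [hx]

/-! ### Weak derivatives -/

theorem isWeakDeriv_iff {I : List (Fin d)} {u g : L2 Ω} :
    IsWeakDeriv Ω I u g ↔ ∀ φ (hφ : IsTest Ω φ),
      inner ℝ u (testLp (hφ.pd I)) = (-1) ^ I.length * inner ℝ g (testLp hφ) := by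
  constructor <;> intro h φ hφ
  · rw [inner_testLp, inner_testLp]; exact h φ hφ
  · rw [← inner_testLp u (hφ.pd I), ← inner_testLp g hφ]; exact h φ hφ

/-- The fundamental lemma of the calculus of variations. It applies because an `L²` function is
integrable on compact subsets of `Ω`, which have finite measure. -/
theorem eq_zero_of_inner_testLp (hΩ : IsOpen Ω) {g : L2 Ω}
    (h : ∀ φ (hφ : IsTest Ω φ), inner ℝ g (testLp hφ) = 0) : g = 0 := by
  rw [Lp.eq_zero_iff_ae_eq_zero]
  have hloc : LocallyIntegrableOn g Ω volume := by
    rw [locallyIntegrableOn_iff (by exact hΩ.isLocallyClosed)]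
    intro K hK hKc
    have : MemLp g 2 (volume.restrict K) :=
      (Lp.memLp g).mono_measure (Measure.restrict_mono hK le_rfl)
    have hfin : IsFiniteMeasure (volume.restrict K) := ⟨by simpa using hKc.measure_lt_top⟩
    exact this.integrable (by norm_num)
  have := hΩ.ae_eq_zero_of_integral_contDiff_smul_eq_zero hloc (fun φ h1 h2 h3 => by
    have ht : IsTest Ω φ := ⟨h1, h2, h3⟩
    have h4 := h φ ht
    rw [inner_testLp] at h4
    rw [← h4, ← setIntegral_eq_integral_of_forall_compl_eq_zero (s := Ω)]
    · exact integral_congr_ae (.of_forall fun x => by simp [mul_comm])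
    · intro x hx; simp [ht.eq_zero hx])
  exact (ae_restrict_iff' hΩ.measurableSet).2 this

theorem IsWeakDeriv.unique (hΩ : IsOpen Ω) {I : List (Fin d)} {u g g' : L2 Ω}
    (h : IsWeakDeriv Ω I u g) (h' : IsWeakDeriv Ω I u g') : g = g' := by
  rw [isWeakDeriv_iff] at h h'
  rw [← sub_eq_zero]
  refine eq_zero_of_inner_testLp hΩ fun φ hφ => ?_
  have := (h φ hφ).symm.trans (h' φ hφ)
  rw [inner_sub_left, sub_eq_zero]
  exact mul_left_cancel₀ (pow_ne_zero _ (by norm_num)) this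

theorem wD_eq (hΩ : IsOpen Ω) {I : List (Fin d)} {u g : L2 Ω} (h : IsWeakDeriv Ω I u g) :
    wD Ω I u = g := by
  have hex : ∃ g, IsWeakDeriv Ω I u g := ⟨g, h⟩
  rw [wD, dif_pos hex]
  exact hex.choose_spec.unique hΩ h

theorem isWeakDeriv_wD {I : List (Fin d)} {m : ℕ} {u : L2 Ω} (hu : u ∈ Hm Ω m)
    (hI : I.length ≤ m) : IsWeakDeriv Ω I u (wD Ω I u) := by
  have hex := hu I hI
  rw [wD, dif_pos hex]
  exact hex.choose_spec

theorem isWeakDeriv_nil (u : L2 Ω) : IsWeakDeriv Ω [] u u := by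
  intro φ _
  simp [pd]

theorem wD_nil (hΩ : IsOpen Ω) (u : L2 Ω) : wD Ω [] u = u := wD_eq hΩ (isWeakDeriv_nil u)

theorem IsWeakDeriv.add {I : List (Fin d)} {u v g k : L2 Ω} (hu : IsWeakDeriv Ω I u g)
    (hv : IsWeakDeriv Ω I v k) : IsWeakDeriv Ω I (u + v) (g + k) := by
  rw [isWeakDeriv_iff] at *
  intro φ hφ
  rw [inner_add_left, inner_add_left, hu φ hφ, hv φ hφ, mul_add]

theorem IsWeakDeriv.const_smul {I : List (Fin d)} {u g : L2 Ω} (hu : IsWeakDeriv Ω I u g) (a : ℝ) :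
    IsWeakDeriv Ω I (a • u) (a • g) := by
  rw [isWeakDeriv_iff] at *
  intro φ hφ
  rw [real_inner_smul_left, real_inner_smul_left, hu φ hφ]
  ring

/-- A derivative of a test function is again a test function, so `∂_J` can be moved onto `u` with
`∂_I φ` in the role of the test function. This justifies all manipulations of iterated weak
derivatives. -/
theorem IsWeakDeriv.append_iff {I J : List (Fin d)} {u g k : L2 Ω} (hu : IsWeakDeriv Ω J u g) :
    IsWeakDeriv Ω (J ++ I) u k ↔ IsWeakDeriv Ω I g k := by
  rw [isWeakDeriv_iff] at *
  rw [isWeakDeriv_iff]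
  have e : ∀ φ (hφ : IsTest Ω φ), inner ℝ u (testLp (hφ.pd (J ++ I)))
      = (-1) ^ J.length * inner ℝ g (testLp (hφ.pd I)) := by
    intro φ hφ
    rw [← hu _ (hφ.pd I)]
    rw [testLp_congr (hφ.pd (J ++ I)) ((hφ.pd I).pd J) (pd_append J I)]
  have hs : ((-1 : ℝ) ^ J.length) ≠ 0 := pow_ne_zero _ (by norm_num)
  refine forall₂_congr fun φ hφ => ?_
  rw [e φ hφ, List.length_append, pow_add, mul_assoc]
  exact ⟨fun h => mul_left_cancel₀ hs h, fun h => by rw [h]⟩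

/-- `H^m(Ω)` as a subspace of `L²(Ω)`. -/
def HmSub (Ω : Set (EuclideanSpace ℝ (Fin d))) (m : ℕ) : Submodule ℝ (L2 Ω) where
  carrier := Hm Ω m
  zero_mem' := fun I _ => ⟨0, isWeakDeriv_iff.2 fun φ hφ => by simp⟩
  add_mem' := fun hu hv I hI => by
    obtain ⟨g, hg⟩ := hu I hI
    obtain ⟨k, hk⟩ := hv I hI
    exact ⟨g + k, hg.add hk⟩
  smul_mem' := fun a u hu I hI => by
    obtain ⟨g, hg⟩ := hu I hI
    exact ⟨a • g, hg.const_smul a⟩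

theorem Hm_mono {m n : ℕ} (h : m ≤ n) {u : L2 Ω} (hu : u ∈ Hm Ω n) : u ∈ Hm Ω m :=
  fun I hI => hu I (hI.trans h)

theorem wD_add (hΩ : IsOpen Ω) {I : List (Fin d)} {m : ℕ} {u v : L2 Ω} (hu : u ∈ Hm Ω m)
    (hv : v ∈ Hm Ω m) (hI : I.length ≤ m) : wD Ω I (u + v) = wD Ω I u + wD Ω I v :=
  wD_eq hΩ ((isWeakDeriv_wD hu hI).add (isWeakDeriv_wD hv hI))

theorem wD_smul (hΩ : IsOpen Ω) {I : List (Fin d)} {m : ℕ} {u : L2 Ω} (hu : u ∈ Hm Ω m)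
    (hI : I.length ≤ m) (a : ℝ) : wD Ω I (a • u) = a • wD Ω I u :=
  wD_eq hΩ ((isWeakDeriv_wD hu hI).const_smul a)

theorem wD_sub (hΩ : IsOpen Ω) {I : List (Fin d)} {m : ℕ} {u v : L2 Ω} (hu : u ∈ Hm Ω m)
    (hv : v ∈ Hm Ω m) (hI : I.length ≤ m) : wD Ω I (u - v) = wD Ω I u - wD Ω I v := by
  have h := (isWeakDeriv_wD hu hI).add ((isWeakDeriv_wD hv hI).const_smul (-1))
  rw [sub_eq_add_neg, sub_eq_add_neg, ← neg_one_smul ℝ v, ← neg_one_smul ℝ (wD Ω I v)]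
  exact wD_eq hΩ h

theorem wD_wD (hΩ : IsOpen Ω) {I J : List (Fin d)} {m : ℕ} {u : L2 Ω} (hu : u ∈ Hm Ω m)
    (hIJ : J.length + I.length ≤ m) : wD Ω I (wD Ω J u) = wD Ω (J ++ I) u :=
  wD_eq hΩ (((isWeakDeriv_wD hu (by omega)).append_iff).1
    (isWeakDeriv_wD hu (by simpa using hIJ)))

theorem wD_mem_Hm {J : List (Fin d)} {m n : ℕ} {u : L2 Ω} (hu : u ∈ Hm Ω n)
    (h : J.length + m ≤ n) : wD Ω J u ∈ Hm Ω m := fun I hI =>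
  ⟨wD Ω (J ++ I) u, ((isWeakDeriv_wD hu (by omega)).append_iff).1
    (isWeakDeriv_wD hu (by simp; omega))⟩

theorem isWeakDeriv_testLp (hφ : IsTest Ω φ) (i : Fin d) :
    IsWeakDeriv Ω [i] (testLp hφ) (testLp (hφ.pd [i])) := by
  intro ψ hψ
  have h1 : ∫ x in Ω, testLp hφ x * pd [i] ψ x = ∫ x in Ω, φ x * pd [i] ψ x := by
    refine integral_congr_ae ?_
    filter_upwards [coeFn_testLp hφ] with x hx
    rw [hx]
  have h2 : ∫ x in Ω, testLp (hφ.pd [i]) x * ψ x = ∫ x in Ω, pd [i] φ x * ψ x := by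
    refine integral_congr_ae ?_
    filter_upwards [coeFn_testLp (hφ.pd [i])] with x hx
    rw [hx]
  rw [h1, h2, hψ.integral_mul_pd hφ.smooth i]
  simp [pd]

theorem mem_Hm_one_iff {u : L2 Ω} : u ∈ Hm Ω 1 ↔ ∀ i, ∃ g, IsWeakDeriv Ω [i] u g := by
  refine ⟨fun h i => h [i] (by simp), fun h I hI => ?_⟩
  match I, hI with
  | [], _ => exact ⟨u, isWeakDeriv_nil u⟩
  | [i], _ => exact h i
  | _ :: _ :: _, hI => simp at hI

theorem testLp_mem_Hm (hφ : IsTest Ω φ) : testLp hφ ∈ Hm Ω 1 :=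
  mem_Hm_one_iff.2 fun i => ⟨_, isWeakDeriv_testLp hφ i⟩

theorem wD_testLp (hΩ : IsOpen Ω) (hφ : IsTest Ω φ) (i : Fin d) :
    wD Ω [i] (testLp hφ) = testLp (hφ.pd [i]) := wD_eq hΩ (isWeakDeriv_testLp hφ i)

/-! ### Sobolev norms -/

theorem norm_wD_le_sobNorm {m : ℕ} {I : List (Fin d)} (hI : I.length ≤ m) (u : L2 Ω) :
    ‖wD Ω I u‖ ≤ sobNorm Ω m u := by
  refine Real.le_sqrt_of_sq_le ?_
  have h1 : ‖wD Ω I u‖ ^ 2 ≤ ∑ J : Fin I.length → Fin d, ‖wD Ω (List.ofFn J) u‖ ^ 2 := by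
    have := Finset.single_le_sum (f := fun J : Fin I.length → Fin d => ‖wD Ω (List.ofFn J) u‖ ^ 2)
      (fun J _ => by positivity) (Finset.mem_univ I.get)
    simpa using this
  exact h1.trans (Finset.single_le_sum
    (f := fun k => ∑ J : Fin k → Fin d, ‖wD Ω (List.ofFn J) u‖ ^ 2)
    (fun k _ => by positivity) (Finset.mem_range.2 (by omega)))

/-- The number of multi-indices of length at most `m`. -/
def sobCard (d m : ℕ) : ℝ := ∑ k ∈ Finset.range (m + 1), ∑ _I : Fin k → Fin d, 1

theorem sobCard_nonneg (d m : ℕ) : 0 ≤ sobCard d m := by unfold sobCard; positivity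

theorem sobNorm_le {m : ℕ} {u : L2 Ω} {A : ℝ}
    (h : ∀ I : List (Fin d), I.length ≤ m → ‖wD Ω I u‖ ≤ A) :
    sobNorm Ω m u ≤ Real.sqrt (sobCard d m) * A := by
  have hA : 0 ≤ A := (norm_nonneg _).trans (h [] (by simp))
  rw [sobNorm, ← Real.sqrt_sq hA, ← Real.sqrt_mul (sobCard_nonneg d m)]
  refine Real.sqrt_le_sqrt ?_
  rw [sobCard, Finset.sum_mul]
  refine Finset.sum_le_sum fun k hk => ?_
  rw [Finset.sum_mul]
  refine Finset.sum_le_sum fun I _ => ?_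
  rw [one_mul]
  have : (List.ofFn I).length ≤ m := by
    simp only [List.length_ofFn]; have := Finset.mem_range.1 hk; omega
  exact pow_le_pow_left₀ (norm_nonneg _) (h _ this) 2

theorem sobNorm_nonneg (m : ℕ) (u : L2 Ω) : 0 ≤ sobNorm Ω m u := Real.sqrt_nonneg _

theorem vsobNorm_nonneg (m : ℕ) (u : VL2 Ω) : 0 ≤ vsobNorm Ω m u := Real.sqrt_nonneg _

theorem vsobNorm_le {m : ℕ} {v : VL2 Ω} {A : ℝ} (h : ∀ i, sobNorm Ω m (v i) ≤ A) (hA : 0 ≤ A) :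
    vsobNorm Ω m v ≤ Real.sqrt d * A := by
  rw [vsobNorm, ← Real.sqrt_sq hA, ← Real.sqrt_mul (by positivity)]
  refine Real.sqrt_le_sqrt ?_
  calc ∑ i, sobNorm Ω m (v i) ^ 2 ≤ ∑ _i : Fin d, A ^ 2 :=
        Finset.sum_le_sum fun i _ => pow_le_pow_left₀ (sobNorm_nonneg _ _) (h i) 2
    _ = d * A ^ 2 := by simp

/-! ### The space `H^1_0` -/

/-- Replaces the Sobolev norm by separate smallness of the function and of its first derivatives,
the form in which density arguments are carried out. -/
theorem mem_H10_iff (hΩ : IsOpen Ω) {u : L2 Ω} : u ∈ H10 Ω ↔ u ∈ Hm Ω 1 ∧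
    ∀ ε > 0, ∃ φ, ∃ hφ : IsTest Ω φ, ‖u - testLp hφ‖ < ε ∧
      ∀ i, ‖wD Ω [i] u - testLp (hφ.pd [i])‖ < ε := by
  refine and_congr_right fun hu => ?_
  constructor
  · intro h ε hε
    obtain ⟨φ, hφ, w, hw, hlt⟩ := h ε hε
    have hwe : w = testLp hφ := Lp.ext (hw.trans (coeFn_testLp hφ).symm)
    subst hwe
    refine ⟨φ, hφ, ?_, fun i => ?_⟩
    · have := norm_wD_le_sobNorm (m := 1) (I := []) (by simp) (u - testLp hφ)
      rw [wD_nil hΩ] at this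
      exact this.trans_lt hlt
    · have := norm_wD_le_sobNorm (m := 1) (I := [i]) (by simp) (u - testLp hφ)
      rw [wD_sub hΩ hu (testLp_mem_Hm hφ) (by simp), wD_testLp hΩ] at this
      exact this.trans_lt hlt
  · intro h ε hε
    have hpos : 0 < Real.sqrt (sobCard d 1) + 1 := by positivity
    obtain ⟨φ, hφ, h1, h2⟩ := h (ε / (Real.sqrt (sobCard d 1) + 1)) (by positivity)
    refine ⟨φ, hφ, testLp hφ, coeFn_testLp hφ, ?_⟩
    have : sobNorm Ω 1 (u - testLp hφ)
        ≤ Real.sqrt (sobCard d 1) * (ε / (Real.sqrt (sobCard d 1) + 1)) := by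
      refine sobNorm_le fun I hI => ?_
      rw [wD_sub hΩ hu (testLp_mem_Hm hφ) hI]
      match I, hI with
      | [], _ => rw [wD_nil hΩ, wD_nil hΩ]; exact h1.le
      | [i], _ => rw [wD_testLp hΩ]; exact (h2 i).le
      | _ :: _ :: _, hI => simp at hI
    refine this.trans_lt ?_
    rw [mul_div_assoc', div_lt_iff₀ hpos]
    nlinarith

theorem testLp_add (hφ : IsTest Ω φ) (hψ : IsTest Ω ψ) :
    testLp (hφ.add hψ) = testLp hφ + testLp hψ := MemLp.toLp_add _ _

theorem testLp_smul (hφ : IsTest Ω φ) (a : ℝ) :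
    testLp (hφ.const_smul a) = a • testLp hφ := MemLp.toLp_const_smul _ _

theorem testLp_mem_H10 (hΩ : IsOpen Ω) (hφ : IsTest Ω φ) : testLp hφ ∈ H10 Ω :=
  (mem_H10_iff hΩ).2 ⟨testLp_mem_Hm hφ, fun ε hε => ⟨φ, hφ, by simpa using hε, fun i => by
    rw [wD_testLp hΩ]; simpa using hε⟩⟩

theorem mem_H10_of_approx (hΩ : IsOpen Ω) {u : L2 Ω} (hu : u ∈ Hm Ω 1)
    (h : ∀ ε > 0, ∃ v ∈ H10 Ω, ‖u - v‖ < ε ∧ ∀ i, ‖wD Ω [i] u - wD Ω [i] v‖ < ε) :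
    u ∈ H10 Ω := by
  refine (mem_H10_iff hΩ).2 ⟨hu, fun ε hε => ?_⟩
  obtain ⟨v, hv, h1, h2⟩ := h (ε / 2) (by positivity)
  obtain ⟨φ, hφ, h3, h4⟩ := ((mem_H10_iff hΩ).1 hv).2 (ε / 2) (by positivity)
  refine ⟨φ, hφ, ?_, fun i => ?_⟩
  · have := norm_sub_le_norm_sub_add_norm_sub u v (testLp hφ); linarith
  · have := norm_sub_le_norm_sub_add_norm_sub (wD Ω [i] u) (wD Ω [i] v) (testLp (hφ.pd [i]))
    linarith [h2 i, h4 i]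

/-- `H^1_0(Ω)` as a subspace of `L²(Ω)`. -/
def H10Sub (hΩ : IsOpen Ω) : Submodule ℝ (L2 Ω) where
  carrier := H10 Ω
  zero_mem' := by
    have := testLp_mem_H10 hΩ (isTest_zero (Ω := Ω))
    have e : testLp (isTest_zero (Ω := Ω)) = 0 := MemLp.toLp_zero _
    rwa [e] at this
  add_mem' := fun {u v} hu hv => by
    have hu1 := hu.1
    have hv1 := hv.1
    refine (mem_H10_iff hΩ).2 ⟨(HmSub Ω 1).add_mem hu1 hv1, fun ε hε => ?_⟩
    obtain ⟨φ, hφ, h1, h2⟩ := ((mem_H10_iff hΩ).1 hu).2 (ε / 2) (by positivity)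
    obtain ⟨ψ, hψ, h3, h4⟩ := ((mem_H10_iff hΩ).1 hv).2 (ε / 2) (by positivity)
    refine ⟨φ + ψ, hφ.add hψ, ?_, fun i => ?_⟩
    · rw [testLp_add hφ hψ, add_sub_add_comm]
      exact (norm_add_le _ _).trans_lt (by linarith)
    · rw [← wD_testLp hΩ (hφ.add hψ), testLp_add hφ hψ, wD_add hΩ hu1 hv1 (by simp),
        wD_add hΩ (testLp_mem_Hm hφ) (testLp_mem_Hm hψ) (by simp), wD_testLp hΩ hφ, wD_testLp hΩ hψ,
        add_sub_add_comm]
      exact (norm_add_le _ _).trans_lt (by linarith [h2 i, h4 i])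
  smul_mem' := fun a u hu => by
    have hu1 := hu.1
    refine (mem_H10_iff hΩ).2 ⟨(HmSub Ω 1).smul_mem a hu1, fun ε hε => ?_⟩
    obtain ⟨φ, hφ, h1, h2⟩ := ((mem_H10_iff hΩ).1 hu).2 (ε / (|a| + 1)) (by positivity)
    have key : ∀ x : L2 Ω, ‖x‖ < ε / (|a| + 1) → ‖a • x‖ < ε := by
      intro x hx
      rw [lt_div_iff₀ (by positivity)] at hx
      rw [norm_smul, Real.norm_eq_abs]
      nlinarith [norm_nonneg x]
    refine ⟨a • φ, hφ.const_smul a, ?_, fun i => ?_⟩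
    · rw [testLp_smul hφ, ← smul_sub]
      exact key _ h1
    · rw [← wD_testLp hΩ (hφ.const_smul a), testLp_smul hφ, wD_smul hΩ hu1 (by simp),
        wD_smul hΩ (testLp_mem_Hm hφ) (by simp), wD_testLp hΩ, ← smul_sub]
      exact key _ (h2 i)

/-- A first-order linear identity that holds for test functions holds in `H^1_0(Ω)`. -/
theorem H10_identity (hΩ : IsOpen Ω) (A : L2 Ω) (B : Fin d → L2 Ω)
    (h : ∀ φ (hφ : IsTest Ω φ),
      inner ℝ A (testLp hφ) + ∑ j, inner ℝ (B j) (testLp (hφ.pd [j])) = 0)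
    {v : L2 Ω} (hv : v ∈ H10 Ω) : inner ℝ A v + ∑ j, inner ℝ (B j) (wD Ω [j] v) = 0 := by
  have hK : 0 < ‖A‖ + ∑ j, ‖B j‖ + 1 := by positivity
  rw [← abs_nonpos_iff]
  refine le_of_forall_pos_le_add fun ε hε => ?_
  obtain ⟨φ, hφ, h1, h2⟩ := ((mem_H10_iff hΩ).1 hv).2 (ε / (‖A‖ + ∑ j, ‖B j‖ + 1)) (by positivity)
  set δ := ε / (‖A‖ + ∑ j, ‖B j‖ + 1) with hδ
  -- The identity for the approximating test function is subtracted, so that only approximation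
  -- errors remain.
  have e : inner ℝ A v + ∑ j, inner ℝ (B j) (wD Ω [j] v) = inner ℝ A (v - testLp hφ)
      + ∑ j, inner ℝ (B j) (wD Ω [j] v - testLp (hφ.pd [j])) := by
    simp only [inner_sub_right, Finset.sum_sub_distrib]
    linarith [h φ hφ]
  rw [e, zero_add]
  have h3 : |inner ℝ A (v - testLp hφ)| ≤ ‖A‖ * δ :=
    (abs_real_inner_le_norm _ _).trans (mul_le_mul_of_nonneg_left h1.le (norm_nonneg _))
  have h4 : |∑ j, inner ℝ (B j) (wD Ω [j] v - testLp (hφ.pd [j]))| ≤ (∑ j, ‖B j‖) * δ := by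
    rw [Finset.sum_mul]
    refine (Finset.abs_sum_le_sum_abs _ _).trans (Finset.sum_le_sum fun j _ => ?_)
    exact (abs_real_inner_le_norm _ _).trans
      (mul_le_mul_of_nonneg_left (h2 j).le (norm_nonneg _))
  have h5 : (‖A‖ + ∑ j, ‖B j‖ + 1) * δ = ε := by rw [hδ]; field_simp
  have h6 : 0 < δ := by rw [hδ]; positivity
  refine (abs_add_le _ _).trans ?_
  nlinarith

/-- The constant function `1` in `L²(Ω)`. -/
def oneLp (Ω : Set (EuclideanSpace ℝ (Fin d))) [IsFiniteMeasure (volume.restrict Ω)] : L2 Ω :=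
  (memLp_const (1 : ℝ)).toLp _

theorem inner_oneLp [IsFiniteMeasure (volume.restrict Ω)] (q : L2 Ω) :
    inner ℝ (oneLp Ω) q = ∫ x in Ω, q x := by
  rw [inner_eq_integral]
  refine integral_congr_ae ?_
  filter_upwards [(memLp_const (μ := volume.restrict Ω) (p := 2) (1 : ℝ)).coeFn_toLp] with x hx
  rw [oneLp, hx, one_mul]

theorem inner_oneLp_testLp [IsFiniteMeasure (volume.restrict Ω)] (hφ : IsTest Ω φ) (i : Fin d) :
    inner ℝ (oneLp Ω) (testLp (hφ.pd [i])) = 0 := by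
  have e : ∫ x in Ω, testLp (hφ.pd [i]) x = ∫ x in Ω, (1 : ℝ) * pd [i] φ x := by
    refine integral_congr_ae ?_
    filter_upwards [coeFn_testLp (hφ.pd [i])] with x hx
    rw [hx, one_mul]
  rw [inner_oneLp, e, hφ.integral_mul_pd contDiff_const i]
  simp

theorem isWeakDeriv_oneLp [IsFiniteMeasure (volume.restrict Ω)] (i : Fin d) (I : List (Fin d)) :
    IsWeakDeriv Ω (i :: I) (oneLp Ω) 0 := by
  rw [isWeakDeriv_iff]
  intro φ hφ
  rw [inner_zero_left, mul_zero]
  exact inner_oneLp_testLp (hφ.pd I) i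

theorem oneLp_mem_Hm [IsFiniteMeasure (volume.restrict Ω)] (m : ℕ) : oneLp Ω ∈ Hm Ω m := by
  intro I _
  cases I with
  | nil => exact ⟨_, isWeakDeriv_nil _⟩
  | cons i I => exact ⟨0, isWeakDeriv_oneLp i I⟩

/-- Poincaré's inequality. -/
theorem poincare_testLp {R : ℝ} (hR : ∀ x ∈ Ω, ‖x‖ ≤ R) (hR0 : 0 ≤ R) (hφ : IsTest Ω φ) (i : Fin d) :
    ‖testLp hφ‖ ≤ 2 * R * ‖testLp (hφ.pd [i])‖ := by
  have hlin : ContDiff ℝ ∞ fun x : EuclideanSpace ℝ (Fin d) => x i * φ x := by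
    refine ContDiff.mul ?_ hφ.smooth
    exact (EuclideanSpace.proj (𝕜 := ℝ) i).contDiff
  have hder : ∀ x, fderiv ℝ (fun x : EuclideanSpace ℝ (Fin d) => x i * φ x) x
      (EuclideanSpace.single i 1) = φ x + x i * pd [i] φ x := by
    intro x
    have h1 : HasFDerivAt (fun x : EuclideanSpace ℝ (Fin d) => x i)
      (EuclideanSpace.proj (𝕜 := ℝ) i) x := (EuclideanSpace.proj (𝕜 := ℝ) i).hasFDerivAt
    have h2 := (hφ.smooth.differentiable (by simp) x).hasFDerivAt
    rw [show fderiv ℝ (fun x : EuclideanSpace ℝ (Fin d) => x i * φ x) x = _ from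
      (h1.mul h2).fderiv]
    simp [pd]
    ring
  -- Integration by parts against `x_i φ` gives `∫ φ² = -2 ∫ x_i φ ∂_i φ`; then `|x_i| ≤ R` on `Ω`
  -- and the Cauchy-Schwarz inequality yield the constant `2R`.
  have key := hφ.integral_mul_pd hlin i
  simp only [hder] at key
  have hint : ∀ {g k : EuclideanSpace ℝ (Fin d) → ℝ}, Continuous g → IsTest Ω k →
      Integrable (fun x => g x * k x) (volume.restrict Ω) := fun hg hk =>
    ((hg.mul hk.smooth.continuous).integrable_of_hasCompactSupport
      hk.compact.mul_left).restrict
  have hprodc : Continuous fun x : EuclideanSpace ℝ (Fin d) => x i :=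
    (EuclideanSpace.proj (𝕜 := ℝ) i).continuous
  have e1 : ∫ x in Ω, (φ x + x i * pd [i] φ x) * φ x
      = (∫ x in Ω, φ x * φ x) + ∫ x in Ω, x i * φ x * pd [i] φ x := by
    have h2 : Continuous fun x => x i * φ x := hprodc.mul hφ.smooth.continuous
    rw [← integral_add (hint hφ.smooth.continuous hφ) (hint h2 (hφ.pd [i]))]
    congr 1 with x
    ring
  have e2 : ‖testLp hφ‖ ^ 2 = ∫ x in Ω, φ x * φ x := by
    rw [← real_inner_self_eq_norm_sq, inner_testLp]
    refine integral_congr_ae ?_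
    filter_upwards [coeFn_testLp hφ] with x hx
    rw [hx]
  have e3 : |∫ x in Ω, x i * φ x * pd [i] φ x| ≤ R * (‖testLp hφ‖ * ‖testLp (hφ.pd [i])‖) := by
    have hm : MemLp (fun x => x i * φ x) 2 (volume.restrict Ω) :=
      ((hprodc.mul hφ.smooth.continuous).memLp_of_hasCompactSupport
        hφ.compact.mul_left).restrict Ω
    have a1 : ∫ x in Ω, x i * φ x * pd [i] φ x = inner ℝ (hm.toLp _) (testLp (hφ.pd [i])) := by
      rw [inner_testLp]
      refine integral_congr_ae ?_
      filter_upwards [hm.coeFn_toLp] with x hx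
      rw [hx]
    have a2 : ‖hm.toLp _‖ ≤ R * ‖testLp hφ‖ := by
      refine Lp.norm_le_mul_norm_of_ae_le_mul ?_
      have hae : ∀ᵐ x ∂(volume.restrict Ω), ‖x‖ ≤ R := by
        have hcl : IsClosed {x : EuclideanSpace ℝ (Fin d) | ‖x‖ ≤ R} :=
          isClosed_le continuous_norm continuous_const
        refine ae_mono (Measure.restrict_mono (s' := {x | ‖x‖ ≤ R}) hR le_rfl) ?_
        exact ae_restrict_mem hcl.measurableSet
      filter_upwards [hm.coeFn_toLp, coeFn_testLp hφ, hae] with x h1 h2 h3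
      rw [h1, h2, norm_mul]
      have := PiLp.norm_apply_le x i
      exact mul_le_mul_of_nonneg_right (this.trans h3) (norm_nonneg _)
    rw [a1]
    calc _ ≤ ‖hm.toLp _‖ * ‖testLp (hφ.pd [i])‖ := abs_real_inner_le_norm _ _
      _ ≤ _ := by rw [← mul_assoc]; exact mul_le_mul_of_nonneg_right a2 (norm_nonneg _)
  rw [e1] at key
  have e4 : ‖testLp hφ‖ ^ 2 ≤ 2 * (R * (‖testLp hφ‖ * ‖testLp (hφ.pd [i])‖)) := by
    rw [e2]
    have := neg_abs_le (∫ x in Ω, x i * φ x * pd [i] φ x)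
    linarith
  by_cases h0 : ‖testLp hφ‖ = 0
  · rw [h0]; positivity
  · have hp : 0 < ‖testLp hφ‖ := lt_of_le_of_ne (norm_nonneg _) (Ne.symm h0)
    refine le_of_mul_le_mul_left ?_ hp
    nlinarith

theorem poincare_H10 (hΩ : IsOpen Ω) {R : ℝ} (hR : ∀ x ∈ Ω, ‖x‖ ≤ R) (hR0 : 0 ≤ R) {v : L2 Ω}
    (hv : v ∈ H10 Ω) (i : Fin d) : ‖v‖ ≤ 2 * R * ‖wD Ω [i] v‖ := by
  refine le_of_forall_pos_le_add fun ε hε => ?_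
  obtain ⟨φ, hφ, h1, h2⟩ := ((mem_H10_iff hΩ).1 hv).2 (ε / (1 + 2 * R)) (by positivity)
  set δ := ε / (1 + 2 * R) with hδ
  have h3 := poincare_testLp hR hR0 hφ i
  have h4 : ‖v‖ ≤ ‖testLp hφ‖ + ‖v - testLp hφ‖ := norm_le_norm_add_norm_sub' _ _
  have h5 : ‖testLp (hφ.pd [i])‖ ≤ ‖wD Ω [i] v‖ + ‖wD Ω [i] v - testLp (hφ.pd [i])‖ :=
    norm_le_norm_add_norm_sub _ _
  have h6 : (1 + 2 * R) * δ = ε := by rw [hδ]; field_simp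
  have h7 := mul_le_mul_of_nonneg_left (h5.trans (add_le_add_right (h2 i).le _))
    (by positivity : 0 ≤ 2 * R)
  nlinarith

end Sobolev

/-! ### Discrete Stokes problems and the trapezoidal rule in abstract form. -/

section Abstract

variable {V H K L : Type*} [AddCommGroup V] [Module ℝ V]
  [NormedAddCommGroup H] [InnerProductSpace ℝ H] [NormedAddCommGroup K] [InnerProductSpace ℝ K]
  [NormedAddCommGroup L] [InnerProductSpace ℝ L]

/-! ### Abstract discrete Stokes problems -/

/-- Discrete spaces `V_h ⊂ V`, `Q_h ⊂ L` for the Stokes problem with the embedding `ι : V → H`, the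
gradient `G` and the divergence `B`: a Poincaré inequality, the continuity of the divergence and
the inf-sup condition. -/
structure StableForms (ι : V →ₗ[ℝ] H) (G : V →ₗ[ℝ] K) (B : V →ₗ[ℝ] L) (Vh : Submodule ℝ V)
    (Qh : Submodule ℝ L) (P M β : ℝ) : Prop where
  finV : FiniteDimensional ℝ Vh
  finQ : FiniteDimensional ℝ Qh
  P_nonneg : 0 ≤ P
  M_nonneg : 0 ≤ M
  β_pos : 0 < β
  poincare : ∀ v, ‖ι v‖ ≤ P * ‖G v‖
  div_le : ∀ v, ‖B v‖ ≤ M * ‖G v‖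
  inj : ∀ v, ι v = 0 → v = 0
  infsup : ∀ q ∈ Qh, q ≠ 0 → ∃ v ∈ Vh, G v ≠ 0 ∧ β * (‖G v‖ * ‖q‖) ≤ -inner ℝ (B v) q

/-- The discretely divergence-free functions. -/
def discDiv (B : V →ₗ[ℝ] L) (Vh : Submodule ℝ V) (Qh : Submodule ℝ L) : Submodule ℝ V where
  carrier := {v | v ∈ Vh ∧ ∀ q ∈ Qh, inner ℝ (B v) q = 0}
  zero_mem' := ⟨Vh.zero_mem, fun q _ => by simp⟩
  add_mem' := fun hu hv => ⟨Vh.add_mem hu.1 hv.1, fun q hq => by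
    rw [map_add, inner_add_left, hu.2 q hq, hv.2 q hq, add_zero]⟩
  smul_mem' := fun a u hu => ⟨Vh.smul_mem a hu.1, fun q hq => by
    rw [map_smul, real_inner_smul_left, hu.2 q hq, mul_zero]⟩

/-- `x` is the velocity component of the Stokes projection of `(w, s)`. -/
def IsProj (G : V →ₗ[ℝ] K) (B : V →ₗ[ℝ] L) (X : Submodule ℝ V) (w : V) (s : L) (x : V) : Prop :=
  x ∈ X ∧ ∀ v ∈ X, inner ℝ (G x) (G v) = inner ℝ (G w) (G v) - inner ℝ (B v) s

/-- The form `⟨G ·, G ·⟩` is definite, so it embeds the finite dimensional space `X` into its dual;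
equality of dimensions makes the embedding surjective. -/
theorem exists_riesz (G : V →ₗ[ℝ] K) (hG : ∀ v, G v = 0 → v = 0) (X : Submodule ℝ V)
    [FiniteDimensional ℝ X] (l : V →ₗ[ℝ] ℝ) :
    ∃ x ∈ X, ∀ v ∈ X, inner ℝ (G x) (G v) = l v := by
  let T : X →ₗ[ℝ] Module.Dual ℝ X :=
    ((innerₗ K).compl₁₂ (G.domRestrict X) (G.domRestrict X))
  have hT : ∀ x v : X, T x v = inner ℝ (G x) (G v) := fun x v => rfl
  have hinj : Function.Injective T := by
    rw [injective_iff_map_eq_zero]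
    intro x hx
    have := hT x x
    rw [hx, LinearMap.zero_apply, real_inner_self_eq_norm_sq] at this
    exact Subtype.ext (hG _ (by simpa using this.symm))
  have hsurj := (LinearMap.injective_iff_surjective_of_finrank_eq_finrank
    (Subspace.dual_finrank_eq (K := ℝ) (V := X)).symm).1 hinj
  obtain ⟨x, hx⟩ := hsurj (l.domRestrict X)
  refine ⟨x, x.2, fun v hv => ?_⟩
  rw [← hT x ⟨v, hv⟩, hx]
  rfl

theorem IsProj.sub {G : V →ₗ[ℝ] K} {B : V →ₗ[ℝ] L} {X : Submodule ℝ V} {w w' : V} {s s' : L}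
    {x x' : V} (h : IsProj G B X w s x) (h' : IsProj G B X w' s' x') :
    IsProj G B X (w - w') (s - s') (x - x') := by
  refine ⟨X.sub_mem h.1 h'.1, fun v hv => ?_⟩
  simp only [map_sub, inner_sub_left, inner_sub_right, h.2 v hv, h'.2 v hv]
  ring

theorem IsProj.add {G : V →ₗ[ℝ] K} {B : V →ₗ[ℝ] L} {X : Submodule ℝ V} {w w' : V} {s s' : L}
    {x x' : V} (h : IsProj G B X w s x) (h' : IsProj G B X w' s' x') :
    IsProj G B X (w + w') (s + s') (x + x') := by
  refine ⟨X.add_mem h.1 h'.1, fun v hv => ?_⟩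
  simp only [map_add, inner_add_left, inner_add_right, h.2 v hv, h'.2 v hv]
  ring

theorem IsProj.smul {G : V →ₗ[ℝ] K} {B : V →ₗ[ℝ] L} {X : Submodule ℝ V} {w : V} {s : L}
    {x : V} (h : IsProj G B X w s x) (a : ℝ) : IsProj G B X (a • w) (a • s) (a • x) := by
  refine ⟨X.smul_mem a h.1, fun v hv => ?_⟩
  simp only [map_smul, real_inner_smul_left, real_inner_smul_right, h.2 v hv]
  ring

namespace StableForms

variable {ι : V →ₗ[ℝ] H} {G : V →ₗ[ℝ] K} {B : V →ₗ[ℝ] L} {Vh : Submodule ℝ V}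
  {Qh : Submodule ℝ L} {P M β : ℝ}

theorem eq_zero (S : StableForms ι G B Vh Qh P M β) {v : V} (hv : G v = 0) : v = 0 :=
  S.inj v (norm_le_zero_iff.1 ((S.poincare v).trans (by simp [hv])))

theorem finX (S : StableForms ι G B Vh Qh P M β) :
    FiniteDimensional ℝ (discDiv B Vh Qh) :=
  have := S.finV
  Submodule.finiteDimensional_of_le (S₂ := Vh) fun _ h => h.1

/-- The form in which the inf-sup condition is always applied: a bound for the functional `v ↦ -⟨B
v, q⟩` on `V_h` is a bound for `q`. -/
theorem norm_le_of_infsup (S : StableForms ι G B Vh Qh P M β) {q : L} (hq : q ∈ Qh) {A : ℝ}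
    (hA : 0 ≤ A) (h : ∀ v ∈ Vh, -inner ℝ (B v) q ≤ A * ‖G v‖) : β * ‖q‖ ≤ A := by
  by_cases h0 : q = 0
  · simpa [h0] using hA
  · obtain ⟨v, hv, hG, hle⟩ := S.infsup q hq h0
    refine le_of_mul_le_mul_right ?_ (norm_pos_iff.2 hG)
    linarith [h v hv]

theorem exists_isProj (S : StableForms ι G B Vh Qh P M β) (w : V) (s : L) :
    ∃ x, IsProj G B (discDiv B Vh Qh) w s x := by
  have := S.finX
  obtain ⟨x, hx, h⟩ := exists_riesz G (fun v => S.eq_zero) (discDiv B Vh Qh)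
    ((innerₗ K (G w)) ∘ₗ G - (innerₗ L s) ∘ₗ B)
  refine ⟨x, hx, fun v hv => ?_⟩
  rw [h v hv]
  simp [real_inner_comm]

theorem inner_div_le (S : StableForms ι G B Vh Qh P M β) (v : V) (s : L) :
    |inner ℝ (B v) s| ≤ M * ‖G v‖ * ‖s‖ :=
  (abs_real_inner_le_norm _ _).trans (mul_le_mul_of_nonneg_right (S.div_le v) (norm_nonneg _))

/-- Bounded right inverse of the discrete divergence. -/
theorem exists_div_eq (S : StableForms ι G B Vh Qh P M β) (w : V) :
    ∃ z ∈ Vh, (∀ q ∈ Qh, inner ℝ (B z) q = inner ℝ (B w) q) ∧ ‖G z‖ ≤ M / β * ‖G w‖ := by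
  have := S.finV
  have := S.finQ
  let b : Vh →ₗ[ℝ] Qh →ₗ[ℝ] ℝ := (innerₗ L).compl₁₂ (B.domRestrict Vh) Qh.subtype
  let a : Vh →ₗ[ℝ] Vh →ₗ[ℝ] ℝ := (innerₗ K).compl₁₂ (G.domRestrict Vh) (G.domRestrict Vh)
  have hb : ∀ (v : Vh) (q : Qh), b v q = inner ℝ (B v) (q : L) := fun v q => rfl
  have ha : ∀ u v : Vh, a u v = inner ℝ (G u) (G v) := fun u v => rfl
  -- The solution of smallest gradient norm is found with a Lagrange multiplier `q` from a square
  -- saddle point system. Its kernel is trivial: testing with the velocity gives `G z = 0`, and then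
  -- the inf-sup condition gives `q = 0`.
  let T : (Vh × Qh) →ₗ[ℝ] (Module.Dual ℝ Vh × Module.Dual ℝ Qh) :=
    (a ∘ₗ LinearMap.fst ℝ Vh Qh - b.flip ∘ₗ LinearMap.snd ℝ Vh Qh).prod
      (b ∘ₗ LinearMap.fst ℝ Vh Qh)
  have hT1 : ∀ x v, (T x).1 v = inner ℝ (G x.1) (G v) - inner ℝ (B v) (x.2 : L) := fun x v => rfl
  have hT2 : ∀ x q, (T x).2 q = inner ℝ (B x.1) (q : L) := fun x q => rfl
  have hinj : Function.Injective T := by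
    rw [injective_iff_map_eq_zero]
    intro x hx
    have h1 := hT1 x
    have h2 := hT2 x
    rw [hx] at h1 h2
    simp only [Prod.fst_zero, Prod.snd_zero, LinearMap.zero_apply] at h1 h2
    have h3 : G x.1 = 0 := by
      have := h1 x.1
      rw [← h2 x.2, sub_zero, real_inner_self_eq_norm_sq] at this
      simpa using this.symm
    have h4 : β * ‖(x.2 : L)‖ ≤ 0 := S.norm_le_of_infsup x.2.2 le_rfl fun v hv => by
      have := h1 ⟨v, hv⟩
      rw [h3, inner_zero_left] at this
      simp only at this
      linarith
    have h5 : (x.2 : L) = 0 := by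
      have := S.β_pos
      exact norm_le_zero_iff.1 (by nlinarith)
    exact Prod.ext (Subtype.ext (S.eq_zero h3)) (Subtype.ext h5)
  have hdim : Module.finrank ℝ (Vh × Qh)
      = Module.finrank ℝ (Module.Dual ℝ Vh × Module.Dual ℝ Qh) := by
    rw [Module.finrank_prod, Module.finrank_prod, Subspace.dual_finrank_eq,
      Subspace.dual_finrank_eq]
  obtain ⟨⟨z, q⟩, hx⟩ := (LinearMap.injective_iff_surjective_of_finrank_eq_finrank hdim).1 hinj
    (0, (innerₗ L (B w)) ∘ₗ Qh.subtype)
  have h1 := hT1 (z, q)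
  have h2 := hT2 (z, q)
  rw [hx] at h1 h2
  simp only [LinearMap.zero_apply] at h1 h2
  refine ⟨z, z.2, fun q' hq' => (h2 ⟨q', hq'⟩).symm, ?_⟩
  have h3 : β * ‖(q : L)‖ ≤ ‖G z‖ := S.norm_le_of_infsup q.2 (norm_nonneg _) fun v hv => by
    have h4 := h1 ⟨v, hv⟩
    simp only at h4
    have := real_inner_le_norm (-G z) (G v)
    rw [inner_neg_left, norm_neg] at this
    linarith
  -- Testing with `z` itself gives `‖G z‖² = ⟨B w, q⟩`; combined with `h3`, one factor `‖G z‖`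
  -- cancels.
  have h4 : ‖G z‖ ^ 2 ≤ M * ‖G w‖ * ‖(q : L)‖ := by
    have h5 := h1 z
    rw [real_inner_self_eq_norm_sq] at h5
    have h6 : inner ℝ (B w) (q : L) = inner ℝ (B z) (q : L) := h2 q
    have h7 := (le_abs_self _).trans (S.inner_div_le w (q : L))
    linarith
  have hβ := S.β_pos
  have hM := S.M_nonneg
  rw [div_mul_eq_mul_div, le_div_iff₀ hβ]
  by_cases h0 : ‖G z‖ = 0
  · rw [h0, zero_mul]; positivity
  · have hp : 0 < ‖G z‖ := lt_of_le_of_ne (norm_nonneg _) (Ne.symm h0)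
    refine le_of_mul_le_mul_left ?_ hp
    have := mul_le_mul_of_nonneg_left h3 (by positivity : 0 ≤ M * ‖G w‖)
    nlinarith

/-- Approximation by discretely divergence-free functions. -/
theorem exists_discDiv_approx (S : StableForms ι G B Vh Qh P M β) {w v : V}
    (hw : ∀ q ∈ Qh, inner ℝ (B w) q = 0) (hv : v ∈ Vh) :
    ∃ x ∈ discDiv B Vh Qh, ‖G (w - x)‖ ≤ (1 + M / β) * ‖G (w - v)‖ := by
  -- The discrete divergence of `v` is repaired by a correction no larger than `M / β` times the
  -- error of `v`.
  obtain ⟨z, hz, h1, h2⟩ := S.exists_div_eq (w - v)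
  refine ⟨v + z, ⟨Vh.add_mem hv hz, fun q hq => ?_⟩, ?_⟩
  · rw [map_add, inner_add_left, h1 q hq, map_sub, inner_sub_left, hw q hq]
    ring
  · rw [show w - (v + z) = (w - v) - z by abel, map_sub G (w - v) z]
    refine (norm_sub_le _ _).trans ?_
    linarith

/-- Testing with `x` itself. No constraint on the divergence of `w` is needed, so the bound also
applies to projected time discretization errors. -/
theorem isProj_norm_le (S : StableForms ι G B Vh Qh P M β) {w x : V} {s : L}
    (h : IsProj G B (discDiv B Vh Qh) w s x) : ‖G x‖ ≤ ‖G w‖ + M * ‖s‖ := by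
  have h1 := h.2 x h.1
  rw [real_inner_self_eq_norm_sq] at h1
  have h2 := real_inner_le_norm (G w) (G x)
  have h3 := (neg_le_abs _).trans (S.inner_div_le x s)
  have hM := S.M_nonneg
  by_cases h0 : ‖G x‖ = 0
  · rw [h0]; positivity
  · have hp : 0 < ‖G x‖ := lt_of_le_of_ne (norm_nonneg _) (Ne.symm h0)
    exact le_of_mul_le_mul_left (by nlinarith) hp

/-- A discretely divergence-free `y` is its own projection with any discrete pressure `q`, because
`q` is invisible to test functions in `discDiv`. Stability therefore upgrades to quasi-optimality.
-/
theorem _root_.StokesFEM.IsProj.sub_left {w x y : V} {s q : L} (hq : q ∈ Qh)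
    (h : IsProj G B (discDiv B Vh Qh) w s x) (hy : y ∈ discDiv B Vh Qh) :
    IsProj G B (discDiv B Vh Qh) (w - y) (s - q) (x - y) := by
  refine h.sub ⟨hy, fun v hv => ?_⟩
  rw [hv.2 q hq, sub_zero]

/-- Quasi-optimality of the Stokes projection. -/
theorem isProj_error (S : StableForms ι G B Vh Qh P M β) {w x v : V} {s q : L}
    (h : IsProj G B (discDiv B Vh Qh) w s x) (hw : ∀ q ∈ Qh, inner ℝ (B w) q = 0)
    (hv : v ∈ Vh) (hq : q ∈ Qh) :
    ‖G (w - x)‖ ≤ 2 * (1 + M / β) * ‖G (w - v)‖ + M * ‖s - q‖ := by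
  obtain ⟨y, hy, hle⟩ := S.exists_discDiv_approx hw hv
  have h1 := S.isProj_norm_le (h.sub_left hq hy)
  have h2 : G (w - x) = G (w - y) - G (x - y) := by rw [← map_sub]; congr 1; abel
  rw [h2]
  refine (norm_sub_le _ _).trans ?_
  linarith

/-- Duality estimate for the Stokes projection. -/
theorem isProj_duality (S : StableForms ι G B Vh Qh P M β) {w x v v' : V} {s q s' q' : L}
    (h : IsProj G B (discDiv B Vh Qh) w s x) (hw : ∀ q ∈ Qh, inner ℝ (B w) q = 0)
    (hdual : ∀ y, inner ℝ (G v) (G y) - inner ℝ (B y) q = inner ℝ (ι (w - x)) (ι y))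
    (hv : ∀ q ∈ Qh, inner ℝ (B v) q = 0) (hvs : inner ℝ (B v) s = 0)
    (hv' : v' ∈ Vh) (hq' : q' ∈ Qh) (hs' : s' ∈ Qh) :
    ‖ι (w - x)‖ ^ 2 ≤ (1 + M / β) * ‖G (v - v')‖ * (‖G (w - x)‖ + M * ‖s - s'‖)
      + M * ‖q - q'‖ * ‖G (w - x)‖ := by
  obtain ⟨y, hy, hle⟩ := S.exists_discDiv_approx hv hv'
  have hM := S.M_nonneg
  -- Aubin-Nitsche argument: the dual problem tested with the error represents its squared `L²`
  -- norm.
  have e1 := hdual (w - x)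
  rw [real_inner_self_eq_norm_sq] at e1
  have e2 : inner ℝ (B (w - x)) q' = 0 := by
    rw [map_sub, inner_sub_left, hw q' hq', h.1.2 q' hq', sub_zero]
  have e3 : inner ℝ (G (w - x)) (G y) = inner ℝ (B y) s := by
    rw [map_sub, inner_sub_left, h.2 y hy]; ring
  -- The error is orthogonal to `y` only up to the pressure `s`. This remainder is also a product of
  -- two approximation errors, since `B v` annihilates both `s` and `s'` and `B y` annihilates `s'`.
  have e4 : inner ℝ (B y) s = -inner ℝ (B (v - y)) (s - s') := by
    rw [inner_sub_right, map_sub, inner_sub_left, inner_sub_left, hvs, hv s' hs', hy.2 s' hs']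
    ring
  have e5 : inner ℝ (G v) (G (w - x)) = inner ℝ (G (v - y)) (G (w - x))
      + inner ℝ (G (w - x)) (G y) := by
    rw [map_sub G v y, inner_sub_left, real_inner_comm (G y)]; ring
  have e6 : inner ℝ (B (w - x)) q = inner ℝ (B (w - x)) (q - q') := by
    rw [inner_sub_right, e2, sub_zero]
  have b1 := real_inner_le_norm (G (v - y)) (G (w - x))
  have b2 := (neg_le_abs _).trans (S.inner_div_le (v - y) (s - s'))
  have b3 := (neg_le_abs _).trans (S.inner_div_le (w - x) (q - q'))
  have b4 := mul_le_mul_of_nonneg_right hle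
    (by positivity : 0 ≤ ‖G (w - x)‖ + M * ‖s - s'‖)
  nlinarith

end StableForms

/-! ### Energy estimate for the time stepping scheme -/

/-- The step equation controls `F`, while `E` enters only through its increments. Adding the linear
quantity `D * ‖G (E n)‖` to `‖ι (F n)‖ ^ 2` lets the dissipation from `G (F n + F (n + 1))` absorb
the growth of both. Each step then adds at most `3 τ D²`, and summation suffices. -/
theorem energy_estimate {ι : V →ₗ[ℝ] H} {G : V →ₗ[ℝ] K} {P : ℝ} (hP : ∀ v, ‖ι v‖ ≤ P * ‖G v‖)
    {N : ℕ} {t : ℕ → ℝ} (ht : ∀ n < N, t n < t (n + 1))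
    {E F ρ : ℕ → V} {κ : ℕ → H} {k m D : ℝ} (hk : 0 ≤ k) (hD : k * P + m ≤ D) (hm : m ≤ D)
    (hstep : ∀ n < N, inner ℝ (ι (F (n + 1) - F n)) (ι (F n + F (n + 1)))
      + inner ℝ (G (E (n + 1) - E n)) (G (F n + F (n + 1)))
        = inner ℝ (κ n) (ι (F n + F (n + 1))))
    (hE : ∀ n < N, E (n + 1) - E n = ((t (n + 1) - t n) / 2) • (F n + F (n + 1)) + ρ n)
    (hκ : ∀ n < N, ‖κ n‖ ≤ (t (n + 1) - t n) * k)
    (hρ : ∀ n < N, ‖G (ρ n)‖ ≤ (t (n + 1) - t n) * m)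
    (hD0 : 0 ≤ D) {n : ℕ} (hn : n ≤ N) :
    ‖ι (F n)‖ ^ 2 + D * ‖G (E n)‖
      ≤ ‖ι (F 0)‖ ^ 2 + D * ‖G (E 0)‖ + 3 * (t n - t 0) * D ^ 2 := by
  induction n with
  | zero => simp
  | succ n ih =>
    have hlt : n < N := by omega
    refine (?_ : _ ≤ ‖ι (F n)‖ ^ 2 + D * ‖G (E n)‖ + 3 * (t (n + 1) - t n) * D ^ 2).trans
      (by linarith [ih hlt.le])
    set τ := t (n + 1) - t n with hτ
    have hτ0 : 0 < τ := sub_pos.2 (ht n hlt)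
    set s := F n + F (n + 1) with hs
    have e1 : inner ℝ (ι (F (n + 1) - F n)) (ι s) = ‖ι (F (n + 1))‖ ^ 2 - ‖ι (F n)‖ ^ 2 := by
      rw [hs, map_sub, map_add, inner_sub_left, inner_add_right, inner_add_right,
        real_inner_self_eq_norm_sq, real_inner_self_eq_norm_sq, real_inner_comm (ι (F n))]
      ring
    have h1 := hstep n hlt
    rw [e1, hE n hlt, map_add, map_smul, inner_add_left, real_inner_smul_left,
      real_inner_self_eq_norm_sq] at h1
    have y0 := norm_nonneg (G s)
    have h2 : inner ℝ (κ n) (ι s) ≤ τ * k * (P * ‖G s‖) :=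
      (real_inner_le_norm _ _).trans
        (mul_le_mul (hκ n hlt) (hP s) (norm_nonneg _) (by positivity))
    have h3 : -inner ℝ (G (ρ n)) (G s) ≤ τ * m * ‖G s‖ :=
      (neg_le_abs _).trans ((abs_real_inner_le_norm _ _).trans
        (mul_le_mul_of_nonneg_right (hρ n hlt) y0))
    have h4 : ‖G (E (n + 1))‖ ≤ ‖G (E n)‖ + (τ / 2 * ‖G s‖ + τ * m) := by
      have e : G (E (n + 1)) = G (E n) + ((τ / 2) • G s + G (ρ n)) := by
        rw [← map_smul, ← map_add, ← map_add, ← hE n hlt]; congr 1; abel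
      rw [e]
      refine (norm_add_le _ _).trans (add_le_add_right ((norm_add_le _ _).trans ?_) _)
      rw [norm_smul, Real.norm_of_nonneg (by positivity)]
      linarith [hρ n hlt]
    have h5 := mul_le_mul_of_nonneg_left h4 hD0
    have h6 : τ * (k * P + m) * ‖G s‖ ≤ τ * D * ‖G s‖ := by gcongr
    have h7 : D * (τ * m) ≤ D * (τ * D) := by gcongr
    -- With `y = ‖G s‖` the increment is at most `-τ y²/2 + 3τDy/2 + τD²`; completing the square
    -- bounds it by `17τD²/8`.
    have h8 : 0 ≤ τ * (‖G s‖ - 3 / 2 * D) ^ 2 := by positivity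
    have h9 : 0 ≤ τ * D ^ 2 := by positivity
    nlinarith

/-- The constant in the energy estimate. -/
def energyConst (P M β K₀ : ℝ) : ℝ :=
  (2 * (1 + M / β) + M) * P ^ 2 + 1 + M + K₀ * (1 + P)

/-- The constant in the velocity error estimate. -/
def velConst (P M β T K₀ : ℝ) : ℝ :=
  (2 + 3 * T) * energyConst P M β K₀ + (2 * (1 + M / β) + M) * (1 + P)

/-- The constant in the pressure error estimate. -/
def presConst (P M β T K₀ : ℝ) : ℝ := 1 + (velConst P M β T K₀ * (P + 1) + M) / β

namespace StableForms

variable {ι : V →ₗ[ℝ] H} {G : V →ₗ[ℝ] K} {B : V →ₗ[ℝ] L} {Vh : Submodule ℝ V}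
  {Qh : Submodule ℝ L} {P M β : ℝ}

theorem isProj_error' (S : StableForms ι G B Vh Qh P M β) {w x : V} {s : L} {ε : ℝ}
    (h : IsProj G B (discDiv B Vh Qh) w s x) (hw : ∀ q ∈ Qh, inner ℝ (B w) q = 0)
    (hA : ∃ v ∈ Vh, ∃ q ∈ Qh, ‖G (w - v)‖ ≤ ε ∧ ‖s - q‖ ≤ ε) :
    ‖G (w - x)‖ ≤ (2 * (1 + M / β) + M) * ε := by
  obtain ⟨v, hv, q, hq, h1, h2⟩ := hA
  have hβ := S.β_pos
  have hM := S.M_nonneg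
  refine (S.isProj_error h hw hv hq).trans ?_
  rw [add_mul]
  gcongr

/-- The velocity errors at the nodes. -/
theorem velocity_error (S : StableForms ι G B Vh Qh P M β)
    {N : ℕ} {t : ℕ → ℝ} (ht : ∀ n < N, t n < t (n + 1)) {T K₀ ε δ : ℝ} (hT : 0 ≤ T)
    (htT : ∀ n ≤ N, t n - t 0 ≤ T) (hK : 0 ≤ K₀) (hε : 0 < ε) (hδ : 0 ≤ δ)
    {x g U U' : ℕ → V} {p p' : ℕ → L} {f : ℕ → H}
    (hg : ∀ n ≤ N, g n ∈ discDiv B Vh Qh)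
    (hdisc : ∀ n ≤ N, ∀ v ∈ discDiv B Vh Qh,
      inner ℝ (ι (g n)) (ι v) + inner ℝ (G (x n)) (G v) = inner ℝ (f n) (ι v))
    (hexact : ∀ n ≤ N, ∀ v,
      inner ℝ (ι (U' n)) (ι v) + inner ℝ (G (U n)) (G v) - inner ℝ (B v) (p n)
        = inner ℝ (f n) (ι v))
    (hstep : ∀ n < N, x (n + 1) - x n = ((t (n + 1) - t n) / 2) • (g n + g (n + 1)))
    (hU : ∀ n ≤ N, ∀ q ∈ Qh, inner ℝ (B (U n)) q = 0)
    (hU' : ∀ n ≤ N, ∀ q ∈ Qh, inner ℝ (B (U' n)) q = 0)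
    (hA : ∀ n ≤ N, ∃ v ∈ Vh, ∃ q ∈ Qh, ‖G (U n - v)‖ ≤ ε ∧ ‖p n - q‖ ≤ ε)
    (hA' : ∀ n ≤ N, ∃ v ∈ Vh, ∃ q ∈ Qh, ‖G (U' n - v)‖ ≤ ε ∧ ‖p' n - q‖ ≤ ε)
    (hA'' : ∀ n < N, ∃ v ∈ Vh, ∃ q ∈ Qh, ‖G (U' (n + 1) - U' n - v)‖ ≤ (t (n + 1) - t n) * ε ∧
      ‖p' (n + 1) - p' n - q‖ ≤ (t (n + 1) - t n) * ε)
    (htrap : ∀ n < N, ‖G (U (n + 1) - U n - ((t (n + 1) - t n) / 2) • (U' n + U' (n + 1)))‖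
      ≤ (t (n + 1) - t n) * δ)
    (htrap' : ∀ n < N, ‖p (n + 1) - p n - ((t (n + 1) - t n) / 2) • (p' n + p' (n + 1))‖
      ≤ (t (n + 1) - t n) * δ)
    (hinit : ∀ y, IsProj G B (discDiv B Vh Qh) (U 0) (p 0) y → ‖G (x 0 - y)‖ ≤ K₀ * ε)
    (hinit' : ∀ y, IsProj G B (discDiv B Vh Qh) (U' 0) (p' 0) y → ‖G (g 0 - y)‖ ≤ K₀ * ε)
    {n : ℕ} (hn : n ≤ N) :
    ‖ι (g n - U' n)‖ ≤ velConst P M β T K₀ * (ε + δ) ∧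
      ‖G (x n - U n)‖ ≤ velConst P M β T K₀ * (ε + δ) := by
  have hβ := S.β_pos
  have hM := S.M_nonneg
  have hP := S.P_nonneg
  choose R hR using fun n => S.exists_isProj (U n) (p n)
  choose R' hR' using fun n => S.exists_isProj (U' n) (p' n)
  set a := 2 * (1 + M / β) + M with ha
  have ha0 : 0 ≤ a := by rw [ha]; positivity
  set A := energyConst P M β K₀ with hAdef
  have hAe : A = a * P ^ 2 + 1 + M + K₀ * (1 + P) := rfl
  have hA0 : 1 ≤ A := by rw [hAe]; have : 0 ≤ a * P ^ 2 + M + K₀ * (1 + P) := by positivity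
                         linarith
  -- `energyConst` is chosen so that `D` dominates the consistency terms `k * P + m` and both
  -- initial errors, `K₀ * ε` for `E` and `P * (K₀ * ε)` for `F`.
  set D := A * (ε + δ) with hD
  have hDpos : 0 < D := by positivity
  have hDe : D = a * P ^ 2 * ε + (1 + M) * ε + K₀ * ε + K₀ * P * ε
    + (a * P ^ 2 * δ + (1 + M) * δ + K₀ * δ + K₀ * P * δ) := by rw [hD, hAe]; ring
  have q1 : 0 ≤ a * P ^ 2 * ε := by positivity
  have q2 : 0 ≤ (1 + M) * ε := by positivity
  have q3 : 0 ≤ K₀ * ε := by positivity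
  have q4 : 0 ≤ K₀ * P * ε := by positivity
  have q5 : 0 ≤ a * P ^ 2 * δ := by positivity
  have q6 : 0 ≤ (1 + M) * δ := by positivity
  have q7 : 0 ≤ K₀ * δ := by positivity
  have q8 : 0 ≤ K₀ * P * δ := by positivity
  have herr' : ∀ n ≤ N, ‖G (U' n - R' n)‖ ≤ a * ε := fun n hn =>
    S.isProj_error' (hR' n) (hU' n hn) (hA' n hn)
  have herr : ∀ n ≤ N, ‖G (U n - R n)‖ ≤ a * ε := fun n hn =>
    S.isProj_error' (hR n) (hU n hn) (hA n hn)
  -- Error equation: the Stokes projection removes the pressure and the gradient part of the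
  -- residual, leaving only the projection error of the time derivative.
  have hmain : ∀ n ≤ N, ∀ v ∈ discDiv B Vh Qh,
      inner ℝ (ι (g n - R' n)) (ι v) + inner ℝ (G (x n - R n)) (G v)
        = inner ℝ (ι (U' n - R' n)) (ι v) := by
    intro n hn v hv
    have e1 := hdisc n hn v hv
    have e2 := hexact n hn v
    have e3 := (hR n).2 v hv
    simp only [map_sub, inner_sub_left]
    linarith
  have hen := energy_estimate (ι := ι) (G := G) S.poincare (N := N) (t := t) ht
    (E := fun n => x n - R n) (F := fun n => g n - R' n)
    (ρ := fun n => -(R (n + 1) - R n - ((t (n + 1) - t n) / 2) • (R' n + R' (n + 1))))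
    (κ := fun n => ι ((U' (n + 1) - U' n) - (R' (n + 1) - R' n)))
    (k := P * (a * ε)) (m := (1 + M) * δ) (D := D) (by positivity)
    (by have e : P * (a * ε) * P = a * P ^ 2 * ε := by ring
        linarith)
    (by linarith) ?_ ?_ ?_ ?_ hDpos.le hn
  rotate_left
  · intro n hn
    have hv : g n - R' n + (g (n + 1) - R' (n + 1)) ∈ discDiv B Vh Qh :=
      Submodule.add_mem _ (Submodule.sub_mem _ (hg n hn.le) (hR' n).1)
        (Submodule.sub_mem _ (hg (n + 1) hn) (hR' (n + 1)).1)
    have e1 := hmain n hn.le _ hv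
    have e2 := hmain (n + 1) hn _ hv
    generalize g n - R' n + (g (n + 1) - R' (n + 1)) = v at *
    simp only [map_sub, inner_sub_left] at e1 e2 ⊢
    linarith
  · intro n hn
    have e : x (n + 1) - R (n + 1) - (x n - R n) = (x (n + 1) - x n) - (R (n + 1) - R n) := by abel
    rw [e, hstep n hn]
    module
  -- The projection error of the increment of `U'` is estimated as a whole, which produces the
  -- factor `τ_n`; the errors at the two nodes separately would not.
  · intro n hn
    have h1 := S.isProj_error' ((hR' (n + 1)).sub (hR' n)) (fun q hq => by
      rw [map_sub, inner_sub_left, hU' _ hn q hq, hU' _ hn.le q hq, sub_zero]) (hA'' n hn)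
    refine (S.poincare _).trans ?_
    have := mul_le_mul_of_nonneg_left h1 hP
    linarith
  -- By linearity `ρ n` is minus the projection of the quadrature errors of velocity and pressure.
  -- These are already small, so stability of the projection suffices.
  · intro n hn
    have h1 := S.isProj_norm_le (((hR (n + 1)).sub (hR n)).sub
      (((hR' n).add (hR' (n + 1))).smul ((t (n + 1) - t n) / 2)))
    rw [map_neg, norm_neg]
    have h2 := mul_le_mul_of_nonneg_left (htrap' n hn) hM
    linarith [htrap n hn]
  have i1 : ‖ι (g 0 - R' 0)‖ ≤ D := by
    refine (S.poincare _).trans ((mul_le_mul_of_nonneg_left (hinit' _ (hR' 0)) hP).trans ?_)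
    have e : P * (K₀ * ε) = K₀ * P * ε := by ring
    linarith
  have i2 : ‖G (x 0 - R 0)‖ ≤ D := (hinit _ (hR 0)).trans (by linarith)
  have i3 : ‖ι (g 0 - R' 0)‖ ^ 2 ≤ D ^ 2 := pow_le_pow_left₀ (norm_nonneg _) i1 2
  have i4 := mul_le_mul_of_nonneg_left i2 hDpos.le
  have i5 := mul_le_mul_of_nonneg_right (htT n hn) (sq_nonneg D)
  have hen' : ‖ι (g n - R' n)‖ ^ 2 + D * ‖G (x n - R n)‖ ≤ (2 + 3 * T) * D ^ 2 := by
    have e : D * D = D ^ 2 := by ring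
    linarith
  have j1 : ‖ι (g n - R' n)‖ ≤ (2 + 3 * T) * D := by
    refine abs_le_of_sq_le_sq' ?_ (by positivity) |>.2
    have : 0 ≤ D * ‖G (x n - R n)‖ := by positivity
    -- Since `2 + 3 * T ≥ 1`, squaring the factor avoids a square root in the constant.
    have h1 : (2 + 3 * T) * D ^ 2 ≤ (2 + 3 * T) ^ 2 * D ^ 2 :=
      mul_le_mul_of_nonneg_right (by nlinarith) (sq_nonneg D)
    rw [mul_pow]
    linarith
  have j2 : ‖G (x n - R n)‖ ≤ (2 + 3 * T) * D := by
    refine le_of_mul_le_mul_left ?_ hDpos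
    have : 0 ≤ ‖ι (g n - R' n)‖ ^ 2 := by positivity
    have e : D * ((2 + 3 * T) * D) = (2 + 3 * T) * D ^ 2 := by ring
    linarith
  have hv : velConst P M β T K₀ * (ε + δ)
      = (2 + 3 * T) * D + (a * ε + P * (a * ε) + (a * (1 + P)) * δ) := by
    rw [velConst, ← hAdef, ← ha, hD]; ring
  have k1 : 0 ≤ a * ε := by positivity
  have k2 : 0 ≤ P * (a * ε) := by positivity
  have k3 : 0 ≤ (a * (1 + P)) * δ := by positivity
  rw [hv]
  constructor
  · have e : ι (g n - U' n) = ι (g n - R' n) - ι (U' n - R' n) := by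
      rw [← map_sub]; congr 1; abel
    rw [e]
    refine (norm_sub_le _ _).trans ?_
    have := (S.poincare _).trans (mul_le_mul_of_nonneg_left (herr' n hn) hP)
    linarith
  · have e : G (x n - U n) = G (x n - R n) - G (U n - R n) := by
      rw [← map_sub]; congr 1; abel
    rw [e]
    refine (norm_sub_le _ _).trans ?_
    linarith [herr n hn]

/-- The pressure error is controlled by the velocity error. -/
theorem pressure_error (S : StableForms ι G B Vh Qh P M β) {x g U U' : V} {p q : L} {f : H}
    {W ε : ℝ} (hq : q ∈ Qh)
    (hdisc : ∀ v ∈ Vh, inner ℝ (ι g) (ι v) + inner ℝ (G x) (G v) - inner ℝ (B v) q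
      = inner ℝ f (ι v))
    (hexact : ∀ v, inner ℝ (ι U') (ι v) + inner ℝ (G U) (G v) - inner ℝ (B v) p = inner ℝ f (ι v))
    (hA : ∃ q' ∈ Qh, ‖p - q'‖ ≤ ε)
    (h1 : ‖ι (g - U')‖ ≤ W) (h2 : ‖G (x - U)‖ ≤ W) :
    ‖p - q‖ ≤ ε + (W * (P + 1) + M * ε) / β := by
  obtain ⟨q', hq', hle⟩ := hA
  have hβ := S.β_pos
  have hM := S.M_nonneg
  have hP := S.P_nonneg
  have hW : 0 ≤ W := (norm_nonneg _).trans h1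
  have hε : 0 ≤ ε := (norm_nonneg _).trans hle
  have h3 : β * ‖q - q'‖ ≤ W * (P + 1) + M * ε := by
    refine S.norm_le_of_infsup (Qh.sub_mem hq hq') (by positivity) fun v hv => ?_
    -- Difference of the discrete and the exact momentum equation: velocity errors and a pressure
    -- approximation error are the only sources.
    have e : -inner ℝ (B v) (q - q') = -inner ℝ (ι (g - U')) (ι v) - inner ℝ (G (x - U)) (G v)
        - inner ℝ (B v) (p - q') := by
      have e1 := hdisc v hv
      have e2 := hexact v
      simp only [map_sub, inner_sub_left, inner_sub_right]
      linarith
    have b1 : -inner ℝ (ι (g - U')) (ι v) ≤ W * (P * ‖G v‖) :=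
      (neg_le_abs _).trans ((abs_real_inner_le_norm _ _).trans
        (mul_le_mul h1 (S.poincare v) (norm_nonneg _) hW))
    have b2 : -inner ℝ (G (x - U)) (G v) ≤ W * ‖G v‖ :=
      (neg_le_abs _).trans ((abs_real_inner_le_norm _ _).trans
        (mul_le_mul_of_nonneg_right h2 (norm_nonneg _)))
    have b3 : -inner ℝ (B v) (p - q') ≤ M * ‖G v‖ * ε :=
      (neg_le_abs _).trans ((S.inner_div_le v _).trans
        (mul_le_mul_of_nonneg_left hle (by positivity)))
    linarith
  have h4 : ‖q - q'‖ ≤ (W * (P + 1) + M * ε) / β := by rw [le_div_iff₀ hβ]; linarith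
  have h5 : p - q = (p - q') - (q - q') := by abel
  rw [h5]
  exact (norm_sub_le _ _).trans (add_le_add hle h4)

end StableForms

end Abstract

/-! ### Calculus in time -/

section Time

variable {E : Type*} [NormedAddCommGroup E] [NormedSpace ℝ E] {T : ℝ}

theorem norm_sub_le_of_derivWithin {F F' : ℝ → E} {a b C : ℝ}
    (hF : ∀ x ∈ Icc a b, HasDerivWithinAt F (F' x) (Icc a b) x)
    (hC : ∀ x ∈ Icc a b, ‖F' x‖ ≤ C) {x y : ℝ} (hx : x ∈ Icc a b) (hy : y ∈ Icc a b) :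
    ‖F y - F x‖ ≤ C * |y - x| :=
  (convex_Icc a b).norm_image_sub_le_of_norm_hasDerivWithin_le hF hC hx hy

/-- The bounds for a function of time, its derivative `F'`, the increments of the derivative, the
error of the trapezoidal rule and of linear interpolation. -/
structure TimeBounds (T : ℝ) (F F' : ℝ → E) (c : ℝ) : Prop where
  val : ∀ t ∈ Icc 0 T, ‖F t‖ ≤ c
  der : ∀ t ∈ Icc 0 T, ‖F' t‖ ≤ c
  incr : ∀ s ∈ Icc 0 T, ∀ t ∈ Icc 0 T, s ≤ t → ‖F' t - F' s‖ ≤ c * (t - s)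
  trap : ∀ s ∈ Icc 0 T, ∀ t ∈ Icc 0 T, s ≤ t →
    ‖F t - F s - ((t - s) / 2) • (F' s + F' t)‖ ≤ c * (t - s) ^ 3
  interp : ∀ s ∈ Icc 0 T, ∀ t ∈ Icc 0 T, s < t → ∀ x ∈ Icc s t,
    ‖F x - F s - ((x - s) / (t - s)) • (F t - F s)‖ ≤ c * (t - s) ^ 2

theorem TimeBounds.mono {F F' : ℝ → E} {c c' : ℝ} (h : TimeBounds T F F' c) (hc : c ≤ c') :
    TimeBounds T F F' c' where
  val t ht := (h.val t ht).trans hc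
  der t ht := (h.der t ht).trans hc
  incr s hs t ht hst := (h.incr s hs t ht hst).trans
    (mul_le_mul_of_nonneg_right hc (sub_nonneg.2 hst))
  trap s hs t ht hst := (h.trap s hs t ht hst).trans
    (mul_le_mul_of_nonneg_right hc (pow_nonneg (sub_nonneg.2 hst) 3))
  interp s hs t ht hst x hx := (h.interp s hs t ht hst x hx).trans
    (mul_le_mul_of_nonneg_right hc (sq_nonneg _))

theorem hasDerivWithinAt_of_contDiffOn {F : ℝ → E} {k : ℕ} (hk : k ≠ 0)
    (hF : ContDiffOn ℝ k F (Icc 0 T)) {t : ℝ} (ht : t ∈ Icc 0 T) :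
    HasDerivWithinAt F (derivWithin F (Icc 0 T) t) (Icc 0 T) t :=
  (hF.differentiableOn (by exact_mod_cast hk) t ht).hasDerivWithinAt

/-- Derivatives up to order three are bounded on the compact interval; iterating the mean value
inequality replaces Taylor's formula with integral remainder for vector-valued functions. -/
theorem exists_timeBounds (hT : 0 < T) {F : ℝ → E} (hF : ContDiffOn ℝ 3 F (Icc 0 T)) :
    ∃ c, TimeBounds T F (derivWithin F (Icc 0 T)) c := by
  have hu := uniqueDiffOn_Icc hT
  set F1 := derivWithin F (Icc 0 T) with hF1
  have h1 : ContDiffOn ℝ 2 F1 (Icc 0 T) := hF.derivWithin hu (by norm_num)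
  set F2 := derivWithin F1 (Icc 0 T) with hF2
  have h2 : ContDiffOn ℝ 1 F2 (Icc 0 T) := h1.derivWithin hu (by norm_num)
  set F3 := derivWithin F2 (Icc 0 T) with hF3
  have h3 : ContDiffOn ℝ 0 F3 (Icc 0 T) := h2.derivWithin hu (by norm_num)
  obtain ⟨c0, hc0⟩ := isCompact_Icc.exists_bound_of_continuousOn hF.continuousOn
  obtain ⟨c1, hc1⟩ := isCompact_Icc.exists_bound_of_continuousOn h1.continuousOn
  obtain ⟨c2, hc2⟩ := isCompact_Icc.exists_bound_of_continuousOn h2.continuousOn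
  obtain ⟨c3, hc3⟩ := isCompact_Icc.exists_bound_of_continuousOn h3.continuousOn
  have d0 : ∀ t ∈ Icc 0 T, HasDerivWithinAt F (F1 t) (Icc 0 T) t := fun t ht =>
    hasDerivWithinAt_of_contDiffOn (k := 3) (by norm_num) hF ht
  have d1 : ∀ t ∈ Icc 0 T, HasDerivWithinAt F1 (F2 t) (Icc 0 T) t := fun t ht =>
    hasDerivWithinAt_of_contDiffOn (k := 2) (by norm_num) h1 ht
  have d2 : ∀ t ∈ Icc 0 T, HasDerivWithinAt F2 (F3 t) (Icc 0 T) t := fun t ht =>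
    hasDerivWithinAt_of_contDiffOn (k := 1) (by norm_num) h2 ht
  have z : (0 : ℝ) ∈ Icc 0 T := ⟨le_rfl, hT.le⟩
  have p0 := (norm_nonneg _).trans (hc0 0 z)
  have p1 := (norm_nonneg _).trans (hc1 0 z)
  have p2 := (norm_nonneg _).trans (hc2 0 z)
  have p3 := (norm_nonneg _).trans (hc3 0 z)
  refine ⟨c0 + c1 + 2 * c2 + c3, fun t ht => (hc0 t ht).trans (by linarith),
    fun t ht => (hc1 t ht).trans (by linarith), fun s hs t ht hst => ?_, fun s hs t ht hst => ?_,
    fun s hs t ht hst x hx => ?_⟩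
  · have := norm_sub_le_of_derivWithin d1 hc2 hs ht
    rw [abs_of_nonneg (sub_nonneg.2 hst)] at this
    nlinarith
  · have hsub : Icc s t ⊆ Icc 0 T := Icc_subset_Icc hs.1 ht.2
    have hr : 0 ≤ t - s := sub_nonneg.2 hst
    -- `ψ` is the derivative of the trapezoidal error `χ` as a function of the right endpoint. Both
    -- vanish at `s`, and in `ψ'` only the third derivative of `F` survives, so two mean value
    -- estimates give the third power of `t - s`.
    set ψ : ℝ → E := fun x => (2⁻¹ : ℝ) • (F1 x - F1 s) - ((x - s) / 2) • F2 x with hψ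
    have e1 : ∀ x ∈ Icc s t, HasDerivWithinAt ψ (-((x - s) / 2) • F3 x) (Icc s t) x := by
      intro x hx
      have a1 := ((d1 x (hsub hx)).mono hsub).sub_const (F1 s) |>.const_smul (2⁻¹ : ℝ)
      have a2 : HasDerivWithinAt (fun x : ℝ => (x - s) / 2) (1 / 2) (Icc s t) x :=
        ((hasDerivAt_id x).sub_const s).div_const 2 |>.hasDerivWithinAt
      have a3 := a1.sub (a2.smul ((d2 x (hsub hx)).mono hsub))
      refine a3.congr_deriv ?_
      module
    have b1 : ∀ x ∈ Icc s t, ‖ψ x‖ ≤ c3 * (t - s) ^ 2 := by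
      intro x hx
      have hb := norm_sub_le_of_derivWithin (C := c3 * (t - s)) e1 (fun y hy => by
        rw [norm_smul, norm_neg, Real.norm_of_nonneg (by linarith [hy.1])]
        have := hc3 y (hsub hy)
        have h6 : (y - s) / 2 ≤ t - s := by linarith [hy.1, hy.2]
        have := mul_le_mul h6 this (norm_nonneg _) hr
        linarith) (left_mem_Icc.2 hst) hx
      have hz : ψ s = 0 := by simp [hψ]
      rw [hz, sub_zero, abs_of_nonneg (sub_nonneg.2 hx.1)] at hb
      refine hb.trans ?_
      have : x - s ≤ t - s := by linarith [hx.2]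
      have := mul_le_mul_of_nonneg_left this (by positivity : 0 ≤ c3 * (t - s))
      linarith
    set χ : ℝ → E := fun x => F x - F s - ((x - s) / 2) • (F1 s + F1 x) with hχ
    have e2 : ∀ x ∈ Icc s t, HasDerivWithinAt χ (ψ x) (Icc s t) x := by
      intro x hx
      have a1 := ((d0 x (hsub hx)).mono hsub).sub_const (F s)
      have a2 : HasDerivWithinAt (fun x : ℝ => (x - s) / 2) (1 / 2) (Icc s t) x :=
        ((hasDerivAt_id x).sub_const s).div_const 2 |>.hasDerivWithinAt
      have a3 := a1.sub (a2.smul (((d1 x (hsub hx)).mono hsub).const_add (F1 s)))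
      refine a3.congr_deriv ?_
      simp only [hψ]
      module
    have hb := norm_sub_le_of_derivWithin e2 b1 (left_mem_Icc.2 hst) (right_mem_Icc.2 hst)
    have hz : χ s = 0 := by simp [hχ]
    rw [hz, sub_zero, abs_of_nonneg hr] at hb
    refine hb.trans ?_
    have : 0 ≤ (t - s) ^ 3 := by positivity
    nlinarith
  · have hsub : Icc s t ⊆ Icc 0 T := Icc_subset_Icc hs.1 ht.2
    have hr : 0 < t - s := sub_pos.2 hst
    have key : ∀ y ∈ Icc s t, ‖F y - F s - (y - s) • F1 s‖ ≤ c2 * (t - s) ^ 2 := by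
      intro y hy
      have e1 : ∀ x ∈ Icc s t, HasDerivWithinAt (fun x => F x - (x - s) • F1 s) (F1 x - F1 s)
          (Icc s t) x := by
        intro x hx
        have a2 : HasDerivWithinAt (fun x : ℝ => x - s) 1 (Icc s t) x :=
          ((hasDerivAt_id x).sub_const s).hasDerivWithinAt
        have a3 := ((d0 x (hsub hx)).mono hsub).sub (a2.smul_const (F1 s))
        refine a3.congr_deriv ?_
        module
      have hb := norm_sub_le_of_derivWithin (C := c2 * (t - s)) e1 (fun x hx => by
        have := norm_sub_le_of_derivWithin d1 hc2 hs (hsub hx)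
        rw [abs_of_nonneg (sub_nonneg.2 hx.1)] at this
        exact this.trans (mul_le_mul_of_nonneg_left (by linarith [hx.2]) p2))
        (left_mem_Icc.2 hst.le) hy
      rw [abs_of_nonneg (sub_nonneg.2 hy.1)] at hb
      have e : F y - F s - (y - s) • F1 s = F y - (y - s) • F1 s - (F s - (s - s) • F1 s) := by
        module
      rw [e]
      refine hb.trans ?_
      have := mul_le_mul_of_nonneg_left (by linarith [hy.2] : y - s ≤ t - s)
        (by positivity : 0 ≤ c2 * (t - s))
      linarith
    -- Linear interpolation reproduces the tangent at `s`, so its error is a combination of two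
    -- tangent errors with weights at most one.
    have e : F x - F s - ((x - s) / (t - s)) • (F t - F s) = (F x - F s - (x - s) • F1 s)
        - ((x - s) / (t - s)) • (F t - F s - (t - s) • F1 s) := by
      rw [smul_sub _ _ ((t - s) • F1 s), smul_smul, div_mul_cancel₀ _ hr.ne']
      abel
    rw [e]
    refine (norm_sub_le _ _).trans ?_
    have q0 : 0 ≤ (x - s) / (t - s) := div_nonneg (by linarith [hx.1]) hr.le
    have q1 : (x - s) / (t - s) ≤ 1 := (div_le_one hr).2 (by linarith [hx.2])
    rw [norm_smul, Real.norm_of_nonneg q0]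
    have k1 := key x hx
    have k2 := mul_le_mul q1 (key t (right_mem_Icc.2 hst.le)) (norm_nonneg _) zero_le_one
    have : 0 ≤ (c0 + c1 + c3) * (t - s) ^ 2 := by positivity
    nlinarith

end Time

/-! ### Regularity in time and weak derivatives -/

section TimeReg

variable {d : ℕ} {Ω : Set (EuclideanSpace ℝ (Fin d))} {T : ℝ} {m : ℕ} {w : ℝ → L2 Ω}

theorem TimeReg.contDiffOn (hΩ : IsOpen Ω) {k : ℕ} (hw : TimeReg Ω T k m w) :
    ContDiffOn ℝ k w (Icc 0 T) := by
  have := hw.2 [] (by simp)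
  simpa only [wD_nil hΩ] using this

/-- The defining identity, for a fixed test function, is differentiated in time. This transfers the
spatial regularity of `w` to its time derivative. -/
theorem TimeReg.isWeakDeriv_derivWithin (hΩ : IsOpen Ω) (hT : 0 < T) (hw : TimeReg Ω T 3 m w)
    {I : List (Fin d)} (hI : I.length ≤ m) {t : ℝ} (ht : t ∈ Icc 0 T) :
    IsWeakDeriv Ω I (derivWithin w (Icc 0 T) t)
      (derivWithin (fun s => wD Ω I (w s)) (Icc 0 T) t) := by
  rw [isWeakDeriv_iff]
  intro φ hφ
  have h1 := (hasDerivWithinAt_of_contDiffOn (k := 3) (by norm_num)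
    (hw.contDiffOn hΩ) ht).inner ℝ (hasDerivWithinAt_const t (Icc 0 T) (testLp (hφ.pd I)))
  have h2 := ((hasDerivWithinAt_of_contDiffOn (k := 3) (by norm_num)
    (hw.2 I hI) ht).inner ℝ (hasDerivWithinAt_const t (Icc 0 T) (testLp hφ))).const_mul
      ((-1 : ℝ) ^ I.length)
  have h3 := h1.congr (f₁ := fun s => (-1 : ℝ) ^ I.length * inner ℝ (wD Ω I (w s)) (testLp hφ))
    (fun s hs => (isWeakDeriv_iff.1 (isWeakDeriv_wD (hw.1 s hs) hI) φ hφ).symm)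
    (isWeakDeriv_iff.1 (isWeakDeriv_wD (hw.1 t ht) hI) φ hφ).symm
  have := (uniqueDiffOn_Icc hT t ht).eq_deriv _ h3 h2
  simpa using this

theorem TimeReg.derivWithin_mem_Hm (hΩ : IsOpen Ω) (hT : 0 < T) (hw : TimeReg Ω T 3 m w)
    {t : ℝ} (ht : t ∈ Icc 0 T) : derivWithin w (Icc 0 T) t ∈ Hm Ω m :=
  fun _ hI => ⟨_, hw.isWeakDeriv_derivWithin hΩ hT hI ht⟩

theorem TimeReg.wD_derivWithin (hΩ : IsOpen Ω) (hT : 0 < T) (hw : TimeReg Ω T 3 m w)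
    {I : List (Fin d)} (hI : I.length ≤ m) {t : ℝ} (ht : t ∈ Icc 0 T) :
    wD Ω I (derivWithin w (Icc 0 T) t) = derivWithin (fun s => wD Ω I (w s)) (Icc 0 T) t :=
  wD_eq hΩ (hw.isWeakDeriv_derivWithin hΩ hT hI ht)

/-- Uniform bounds for all spatial derivatives. -/
theorem TimeReg.exists_bounds (hΩ : IsOpen Ω) (hT : 0 < T) (hw : TimeReg Ω T 3 m w) :
    ∃ c, 0 ≤ c ∧ ∀ I : List (Fin d), I.length ≤ m → TimeBounds T (fun t => wD Ω I (w t))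
      (fun t => wD Ω I (derivWithin w (Icc 0 T) t)) c := by
  have h : ∀ I : List (Fin d), ∃ c, I.length ≤ m → TimeBounds T (fun t => wD Ω I (w t))
      (derivWithin (fun s => wD Ω I (w s)) (Icc 0 T)) c := by
    intro I
    by_cases hI : I.length ≤ m
    · obtain ⟨c, hc⟩ := exists_timeBounds hT (hw.2 I hI)
      exact ⟨c, fun _ => hc⟩
    · exact ⟨0, fun h => absurd h hI⟩
  choose c hc using h
  -- There are finitely many multi-indices of length at most `m`, hence one constant for all of
  -- them.
  obtain ⟨A, hA⟩ := ((List.finite_length_le (Fin d) m).image c).bddAbove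
  refine ⟨max A 0, le_max_right _ _, fun I hI => ?_⟩
  have h1 := (hc I hI).mono ((hA (mem_image_of_mem c hI)).trans (le_max_left A 0))
  have e : ∀ t ∈ Icc 0 T, wD Ω I (derivWithin w (Icc 0 T) t)
      = derivWithin (fun s => wD Ω I (w s)) (Icc 0 T) t := fun t ht =>
    hw.wD_derivWithin hΩ hT hI ht
  refine ⟨h1.val, fun t ht => ?_, fun s hs t ht hst => ?_, fun s hs t ht hst => ?_, h1.interp⟩
  · rw [e t ht]; exact h1.der t ht
  · rw [e t ht, e s hs]; exact h1.incr s hs t ht hst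
  · rw [e t ht, e s hs]; exact h1.trap s hs t ht hst

/-- Difference quotients lie in `H^1_0` and converge to the time derivative together with their
first spatial derivatives; `H^1_0` is closed in `H^1`. -/
theorem TimeReg.derivWithin_mem_H10 (hΩ : IsOpen Ω) (hT : 0 < T) (hm : 1 ≤ m)
    (hw : TimeReg Ω T 3 m w) (h0 : ∀ t ∈ Icc 0 T, w t ∈ H10 Ω) {t : ℝ} (ht : t ∈ Icc 0 T) :
    derivWithin w (Icc 0 T) t ∈ H10 Ω := by
  refine mem_H10_of_approx hΩ (Hm_mono hm (hw.derivWithin_mem_Hm hΩ hT ht)) fun ε hε => ?_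
  have hne : (𝓝[Icc 0 T \ {t}] t).NeBot := by
    have := (uniqueDiffOn_Icc hT t ht).accPt
    rwa [accPt_principal_iff_nhdsWithin] at this
  have key : ∀ F : ℝ → L2 Ω, ContDiffOn ℝ 3 F (Icc 0 T) → ∀ᶠ s in 𝓝[Icc 0 T \ {t}] t,
      ‖derivWithin F (Icc 0 T) t - slope F t s‖ < ε := by
    intro F hF
    have := hasDerivWithinAt_iff_tendsto_slope.1
      (hasDerivWithinAt_of_contDiffOn (k := 3) (by norm_num) hF ht)
    have := (Metric.tendsto_nhds.1 this) ε hε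
    filter_upwards [this] with s hs
    rwa [dist_comm, dist_eq_norm] at hs
  have h1 := key w (hw.contDiffOn hΩ)
  have h2 : ∀ᶠ s in 𝓝[Icc 0 T \ {t}] t, ∀ i : Fin d,
      ‖derivWithin (fun s => wD Ω [i] (w s)) (Icc 0 T) t - slope (fun s => wD Ω [i] (w s)) t s‖ < ε :=
    eventually_all.2 fun i => key _ (hw.2 [i] (by simpa using hm))
  have h3 : ∀ᶠ s in 𝓝[Icc 0 T \ {t}] t, s ∈ Icc 0 T :=
    eventually_nhdsWithin_of_forall fun s hs => hs.1
  obtain ⟨s, h1, h2, hs⟩ := (h1.and (h2.and h3)).exists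
  refine ⟨slope w t s, ?_, h1, fun i => ?_⟩
  · exact (H10Sub hΩ).smul_mem _ ((H10Sub hΩ).sub_mem (h0 s hs) (h0 t ht))
  · have e : wD Ω [i] (slope w t s) = slope (fun s => wD Ω [i] (w s)) t s := by
      have hI : [i].length ≤ m := by simpa using hm
      rw [slope, slope, vsub_eq_sub, vsub_eq_sub,
        wD_smul hΩ ((HmSub Ω m).sub_mem (hw.1 s hs) (hw.1 t ht)) hI,
        wD_sub hΩ (hw.1 s hs) (hw.1 t ht) hI]
    rw [e, hw.wD_derivWithin hΩ hT (by simpa using hm) ht]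
    exact h2 i

end TimeReg

/-! ### The abstract forms realized on `Ω`, and integration by parts. -/

section Concrete

variable {d : ℕ} {Ω : Set (EuclideanSpace ℝ (Fin d))}

/-! ### The velocity space and the bilinear forms -/

/-- `V = H^1_0(Ω)^d` as a subspace of `L²(Ω)^d`. -/
def VSub (hΩ : IsOpen Ω) : Submodule ℝ (VL2 Ω) where
  carrier := VSp Ω
  zero_mem' := fun _ => (H10Sub hΩ).zero_mem
  add_mem' := fun hu hv i => (H10Sub hΩ).add_mem (hu i) (hv i)
  smul_mem' := fun a _ hu i => (H10Sub hΩ).smul_mem a (hu i)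

theorem VSp_Hm_one {v : VL2 Ω} (hv : v ∈ VSp Ω) (i : Fin d) : v i ∈ Hm Ω 1 := (hv i).1

/-- The gradient on `V`. -/
def gradL (hΩ : IsOpen Ω) : VSub hΩ →ₗ[ℝ] PiLp 2 (fun _ : Fin d × Fin d => L2 Ω) where
  toFun v := WithLp.toLp 2 fun ij => wD Ω [ij.2] ((v : VL2 Ω) ij.1)
  map_add' u v := by
    ext1 ij
    exact wD_add hΩ (VSp_Hm_one u.2 _) (VSp_Hm_one v.2 _) (by simp)
  map_smul' a u := by
    ext1 ij
    exact wD_smul hΩ (VSp_Hm_one u.2 _) (by simp) a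

/-- The divergence on `V`. -/
def divL (hΩ : IsOpen Ω) : VSub hΩ →ₗ[ℝ] L2 Ω where
  toFun v := dvg Ω v
  map_add' u v := by
    rw [dvg, dvg, dvg, ← Finset.sum_add_distrib]
    exact Finset.sum_congr rfl fun i _ =>
      wD_add hΩ (VSp_Hm_one u.2 _) (VSp_Hm_one v.2 _) (by simp)
  map_smul' a u := by
    rw [dvg, dvg, RingHom.id_apply, Finset.smul_sum]
    exact Finset.sum_congr rfl fun i _ => wD_smul hΩ (VSp_Hm_one u.2 _) (by simp) a

theorem inner_gradL (hΩ : IsOpen Ω) (u v : VSub hΩ) :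
    inner ℝ (gradL hΩ u) (gradL hΩ v) = aForm Ω u v := by
  rw [PiLp.inner_apply, Fintype.sum_prod_type]
  rfl

theorem norm_gradL (hΩ : IsOpen Ω) (v : VSub hΩ) : ‖gradL hΩ v‖ = gradNorm Ω v := by
  rw [gradNorm, ← inner_gradL, real_inner_self_eq_norm_sq, Real.sqrt_sq (norm_nonneg _)]

theorem bForm_eq (hΩ : IsOpen Ω) (v : VSub hΩ) (q : L2 Ω) :
    bForm Ω v q = -inner ℝ (divL hΩ v) q := rfl

theorem norm_divL_le (hΩ : IsOpen Ω) (v : VSub hΩ) : ‖divL hΩ v‖ ≤ d * ‖gradL hΩ v‖ := by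
  refine (norm_sum_le Finset.univ fun i => wD Ω [i] ((v : VL2 Ω) i)).trans ?_
  calc ∑ i, ‖wD Ω [i] ((v : VL2 Ω) i)‖ ≤ ∑ _i : Fin d, ‖gradL hΩ v‖ :=
        Finset.sum_le_sum fun i _ => PiLp.norm_apply_le (gradL hΩ v) (i, i)
    _ = d * ‖gradL hΩ v‖ := by simp

theorem norm_le_gradL (hΩ : IsOpen Ω) (hd : 0 < d) {R : ℝ} (hR : ∀ x ∈ Ω, ‖x‖ ≤ R) (hR0 : 0 ≤ R)
    (v : VSub hΩ) : ‖(v : VL2 Ω)‖ ≤ 2 * R * ‖gradL hΩ v‖ := by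
  refine abs_le_of_sq_le_sq' ?_ (by positivity) |>.2
  rw [mul_pow, PiLp.norm_sq_eq_of_L2, PiLp.norm_sq_eq_of_L2, Fintype.sum_prod_type, Finset.mul_sum]
  refine Finset.sum_le_sum fun i _ => ?_
  have h1 := poincare_H10 hΩ hR hR0 (v.2 i) ⟨0, hd⟩
  have h2 := pow_le_pow_left₀ (norm_nonneg _) h1 2
  rw [mul_pow] at h2
  refine h2.trans (mul_le_mul_of_nonneg_left ?_ (by positivity))
  exact Finset.single_le_sum (f := fun j => ‖(gradL hΩ v) (i, j)‖ ^ 2)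
    (fun _ _ => by positivity) (Finset.mem_univ _)

theorem vsobNorm_one_ge (hΩ : IsOpen Ω) (v : VSub hΩ) : ‖gradL hΩ v‖ ≤ vsobNorm Ω 1 v := by
  refine Real.le_sqrt_of_sq_le ?_
  rw [PiLp.norm_sq_eq_of_L2, Fintype.sum_prod_type]
  refine Finset.sum_le_sum fun i _ => ?_
  rw [sobNorm, Real.sq_sqrt (by positivity)]
  rw [Finset.sum_range_succ, Finset.sum_range_one]
  have : ∑ j : Fin d, ‖(gradL hΩ v) (i, j)‖ ^ 2
      = ∑ I : Fin 1 → Fin d, ‖wD Ω (List.ofFn I) ((v : VL2 Ω) i)‖ ^ 2 := by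
    rw [← (Equiv.funUnique (Fin 1) (Fin d)).symm.sum_comp]
    refine Finset.sum_congr rfl fun j _ => ?_
    simp [gradL]
  rw [this]
  have : 0 ≤ ∑ I : Fin 0 → Fin d, ‖wD Ω (List.ofFn I) ((v : VL2 Ω) i)‖ ^ 2 := by positivity
  linarith

/-- The discrete velocity space as a subspace of `V`. -/
def VhSub (hΩ : IsOpen Ω) (Vh : Submodule ℝ (VL2 Ω)) : Submodule ℝ (VSub hΩ) :=
  Vh.comap (VSub hΩ).subtype

/-- The Poincaré constant is `2R` for `Ω` in a ball of radius `R`. The divergence is a sum of `d`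
entries of the gradient, whence `M = d`. The inf-sup condition passes to the gradient seminorm with
the same `β`, as that seminorm is at most the `H^1` norm. -/
theorem stableForms (hΩ : IsOpen Ω) (hd : 0 < d) {R : ℝ} (hR : ∀ x ∈ Ω, ‖x‖ ≤ R) (hR0 : 0 ≤ R)
    {r : ℕ} {β c h : ℝ} (hβ : 0 < β) {Vh : Submodule ℝ (VL2 Ω)} {Qh : Submodule ℝ (L2 Ω)}
    (hs : IsStablePair Ω r β c h Vh Qh) :
    StableForms (VSub hΩ).subtype (gradL hΩ) (divL hΩ) (VhSub hΩ Vh) Qh (2 * R) d β where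
  finV := by
    have := hs.finV
    let F : VhSub hΩ Vh →ₗ[ℝ] Vh := (VSub hΩ).subtype.restrict fun x hx => hx
    refine FiniteDimensional.of_injective F fun x y hxy => ?_
    exact Subtype.ext (Subtype.ext (congrArg (fun z : Vh => (z : VL2 Ω)) hxy))
  finQ := hs.finQ
  P_nonneg := by positivity
  M_nonneg := by positivity
  β_pos := hβ
  poincare := norm_le_gradL hΩ hd hR hR0
  div_le := norm_divL_le hΩ
  inj := fun v hv => Subtype.ext hv
  infsup := fun q hq hq0 => by
    obtain ⟨v, hv, hv0, hle⟩ := hs.infsup q hq hq0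
    refine ⟨⟨v, hs.subV v hv⟩, hv, fun h0 => hv0 ?_, ?_⟩
    · have := norm_le_gradL hΩ hd hR hR0 ⟨v, hs.subV v hv⟩
      rw [h0, norm_zero, mul_zero] at this
      exact norm_le_zero_iff.1 this
    · have := vsobNorm_one_ge hΩ ⟨v, hs.subV v hv⟩
      refine le_trans ?_ hle
      gcongr

theorem isDiscDivFree_iff (hΩ : IsOpen Ω) {Vh : Submodule ℝ (VL2 Ω)} {Qh : Submodule ℝ (L2 Ω)}
    (v : VSub hΩ) :
    v ∈ discDiv (divL hΩ) (VhSub hΩ Vh) Qh ↔ IsDiscDivFree Ω Vh Qh v := by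
  refine and_congr Iff.rfl (forall₂_congr fun q _ => ?_)
  rw [bForm_eq, neg_eq_zero]

theorem IsStokesProj.isProj (hΩ : IsOpen Ω) {Vh : Submodule ℝ (VL2 Ω)} {Qh : Submodule ℝ (L2 Ω)}
    {w x : VSub hΩ} {s q : L2 Ω} (h : IsStokesProj Ω Vh Qh w s x q) :
    IsProj (gradL hΩ) (divL hΩ) (discDiv (divL hΩ) (VhSub hΩ Vh) Qh) w s x := by
  refine ⟨(isDiscDivFree_iff hΩ x).2 h.div, fun v hv => ?_⟩
  have h1 := h.eq v hv.1
  have h2 := hv.2 q h.pres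
  rw [bForm_eq, bForm_eq, h2, ← inner_gradL, ← inner_gradL] at h1
  linarith

/-- Keeps only the gradient part of the velocity approximation, with one power of `h` divided out,
so that velocity and pressure are approximated to the same order. -/
theorem HasApproxOrder.exists_approx (hΩ : IsOpen Ω) {s : ℕ} {c h A A' : ℝ}
    {Vh : Submodule ℝ (VL2 Ω)} {Qh : Submodule ℝ (L2 Ω)} (ha : HasApproxOrder Ω s c h Vh Qh)
    (hc : 0 < c) (hh : 0 < h) (hV : ∀ v ∈ Vh, v ∈ VSp Ω) {w : VSub hΩ} {q : L2 Ω}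
    (hw : (w : VL2 Ω) ∈ VHm Ω (s + 1)) (hq : q ∈ L20 Ω ∩ Hm Ω s)
    (hwA : vsobNorm Ω (s + 1) w ≤ A) (hqA : sobNorm Ω s q ≤ A') :
    ∃ v ∈ VhSub hΩ Vh, ∃ q' ∈ Qh, ‖gradL hΩ (w - v)‖ ≤ c * h ^ s * A ∧
      ‖q - q'‖ ≤ c * h ^ s * A' := by
  obtain ⟨v, hv, h1⟩ := ha.velocity w ⟨w.2, hw⟩
  obtain ⟨q', hq', h2⟩ := ha.pressure q hq
  refine ⟨⟨v, hV v hv⟩, hv, q', hq', ?_, h2.trans (by gcongr)⟩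
  rw [norm_gradL]
  refine le_of_mul_le_mul_left ?_ hh
  calc h * gradNorm Ω (w - v) ≤ c * h ^ (s + 1) * vsobNorm Ω (s + 1) w :=
        le_trans (le_add_of_nonneg_left (norm_nonneg _)) h1
    _ ≤ c * h ^ (s + 1) * A := by gcongr
    _ = h * (c * h ^ s * A) := by ring

/-! ### Integration by parts -/

theorem aForm_eq_neg_inner_lapl (hΩ : IsOpen Ω) {u v : VL2 Ω} (hu : u ∈ VHm Ω 2)
    (hv : v ∈ VSp Ω) : aForm Ω u v = -inner ℝ (lapl Ω u) v := by
  rw [aForm, PiLp.inner_apply, ← Finset.sum_neg_distrib]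
  refine Finset.sum_congr rfl fun i _ => ?_
  have := H10_identity hΩ (∑ j, wD Ω [j, j] (u i)) (fun j => wD Ω [j] (u i)) (fun φ hφ => by
    rw [sum_inner, ← Finset.sum_add_distrib]
    refine Finset.sum_eq_zero fun j _ => ?_
    have h1 : IsWeakDeriv Ω [j] (wD Ω [j] (u i)) (wD Ω [j, j] (u i)) :=
      ((isWeakDeriv_wD (hu i) (by simp)).append_iff).1 (isWeakDeriv_wD (hu i) (by simp))
    rw [isWeakDeriv_iff.1 h1 φ hφ]
    simp) (hv i)
  change _ = -inner ℝ (∑ j, wD Ω [j, j] (u i)) (v i)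
  linarith

theorem bForm_eq_inner_grad (hΩ : IsOpen Ω) {q : L2 Ω} {v : VL2 Ω} (hq : q ∈ Hm Ω 1)
    (hv : v ∈ VSp Ω) : bForm Ω v q = inner ℝ (grad Ω q) v := by
  rw [bForm, dvg, PiLp.inner_apply, sum_inner, ← Finset.sum_neg_distrib]
  refine Finset.sum_congr rfl fun i _ => ?_
  have := H10_identity hΩ (wD Ω [i] q) (fun j => if j = i then q else 0) (fun φ hφ => by
    have e : ∀ j, inner ℝ (if j = i then q else 0) (testLp (hφ.pd [j]))
        = if j = i then inner ℝ q (testLp (hφ.pd [j])) else 0 := fun j => by split_ifs <;> simp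
    simp only [e, Finset.sum_ite_eq', Finset.mem_univ, if_true]
    rw [isWeakDeriv_iff.1 (isWeakDeriv_wD hq (I := [i]) (by simp)) φ hφ]
    simp) (hv i)
  have e : ∀ j, inner ℝ (if j = i then q else 0) (wD Ω [j] (v i))
      = if j = i then inner ℝ q (wD Ω [j] (v i)) else 0 := fun j => by split_ifs <;> simp
  simp only [e, Finset.sum_ite_eq', Finset.mem_univ, if_true] at this
  rw [real_inner_comm]
  change _ = inner ℝ (wD Ω [i] q) (v i)
  linarith

/-- Constants have zero gradient, so after integration by parts no boundary term is left. Pressures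
may thus be shifted to mean value zero. -/
theorem inner_oneLp_dvg [IsFiniteMeasure (volume.restrict Ω)] (hΩ : IsOpen Ω) {v : VL2 Ω}
    (hv : v ∈ VSp Ω) : inner ℝ (dvg Ω v) (oneLp Ω) = 0 := by
  have hg : grad Ω (oneLp Ω) = 0 := by
    ext1 i
    exact wD_eq hΩ (isWeakDeriv_oneLp i [])
  have := bForm_eq_inner_grad hΩ (oneLp_mem_Hm 1) hv
  rw [hg, inner_zero_left, bForm, neg_eq_zero] at this
  exact this

/-- The scalar Laplacian. -/
def lap (Ω : Set (EuclideanSpace ℝ (Fin d))) (q : L2 Ω) : L2 Ω := ∑ j, wD Ω [j, j] q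

theorem lap_mem_Hm {q : L2 Ω} {m : ℕ} (hq : q ∈ Hm Ω (m + 2)) : lap Ω q ∈ Hm Ω m :=
  (HmSub Ω m).sum_mem fun j _ => wD_mem_Hm hq (by simp; omega)

/-- On test functions `⟨∂_i∂_j q, ∂_j φ⟩ = ⟨q, ∂_i∂_j∂_j φ⟩ = ⟨∂_j∂_j q, ∂_i φ⟩`. Third derivatives
fall on `φ` only, so `q ∈ H²` is enough. To the discrete problem the gradient field looks like the
pressure `-Δq`. -/
theorem aForm_grad (hΩ : IsOpen Ω) {q : L2 Ω} {v : VL2 Ω} (hq : q ∈ Hm Ω 2) (hv : v ∈ VSp Ω) :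
    aForm Ω (grad Ω q) v = -bForm Ω v (lap Ω q) := by
  rw [aForm, bForm, neg_neg, dvg, sum_inner]
  refine Finset.sum_congr rfl fun i _ => ?_
  have hwi : ∀ j, wD Ω [j] ((grad Ω q) i) = wD Ω [i, j] q := fun j =>
    wD_wD hΩ (J := [i]) (I := [j]) hq (by simp)
  simp only [hwi]
  have e : ∀ x : Fin d → L2 Ω, ∑ j, inner ℝ (wD Ω [i, j] q - if j = i then lap Ω q else 0) (x j)
      = ∑ j, inner ℝ (wD Ω [i, j] q) (x j) - inner ℝ (lap Ω q) (x i) := by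
    intro x
    have : ∀ j, inner ℝ (if j = i then lap Ω q else 0) (x j)
      = if j = i then inner ℝ (lap Ω q) (x j) else 0 := fun j => by split_ifs <;> simp
    simp only [inner_sub_left, Finset.sum_sub_distrib, this, Finset.sum_ite_eq', Finset.mem_univ,
      if_true]
  have := H10_identity hΩ 0 (fun j => wD Ω [i, j] q - if j = i then lap Ω q else 0)
    (fun φ hφ => by
      rw [e (fun j => testLp (hφ.pd [j])), inner_zero_left, zero_add, lap, sum_inner,
        ← Finset.sum_sub_distrib]
      refine Finset.sum_eq_zero fun j _ => ?_
      have h1 := isWeakDeriv_iff.1 (isWeakDeriv_wD hq (I := [i, j]) (by simp)) _ (hφ.pd [j])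
      have h2 := isWeakDeriv_iff.1 (isWeakDeriv_wD hq (I := [j, j]) (by simp)) _ (hφ.pd [i])
      have h3 : testLp ((hφ.pd [j]).pd [i, j]) = testLp ((hφ.pd [i]).pd [j, j]) := by
        refine testLp_congr _ _ ?_
        rw [(hφ.pd [j]).pd_comm i j]
        change pd [j] (pd [i, j] φ) = pd [j] (pd [j, i] φ)
        rw [hφ.pd_comm i j]
      rw [h3, h2] at h1
      simp only [List.length_cons, List.length_nil] at h1
      norm_num at h1
      linarith) (hv i)
  rw [e (fun j => wD Ω [j] (v i)), inner_zero_left, zero_add, sub_eq_zero] at this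
  rw [this, real_inner_comm]

theorem aForm_add_left (hΩ : IsOpen Ω) {u u' v : VL2 Ω} (hu : u ∈ VHm Ω 1) (hu' : u' ∈ VHm Ω 1) :
    aForm Ω (u + u') v = aForm Ω u v + aForm Ω u' v := by
  rw [aForm, aForm, aForm, ← Finset.sum_add_distrib]
  refine Finset.sum_congr rfl fun i _ => ?_
  rw [← Finset.sum_add_distrib]
  refine Finset.sum_congr rfl fun j _ => ?_
  rw [← inner_add_left, PiLp.add_apply, wD_add hΩ (hu i) (hu' i) (by simp)]

end Concrete

/-! ### Reduction of the post-processed scheme to nodal collocation equations. -/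

section Scheme

/-- Exactness of the midpoint rule. Only interior points are used, since the derivative of the
piecewise linear velocity need not exist at the nodes. -/
theorem intervalIntegral_affine {a b α β : ℝ} (hab : a ≤ b) {F : ℝ → ℝ}
    (hF : ∀ s ∈ Ioo a b, F s = α + s * β) :
    ∫ s in a..b, F s = (b - a) * (α + (a + b) / 2 * β) := by
  have h1 : ∫ s in a..b, F s = ∫ s in a..b, (α + s * β) := by
    rw [intervalIntegral.integral_of_le hab, intervalIntegral.integral_of_le hab,
      integral_Ioc_eq_integral_Ioo, integral_Ioc_eq_integral_Ioo]
    exact setIntegral_congr_fun measurableSet_Ioo hF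
  rw [h1, intervalIntegral.integral_add (by simp) (Continuous.intervalIntegrable (by fun_prop) _ _),
    intervalIntegral.integral_mul_const, integral_id]
  simp only [intervalIntegral.integral_const, smul_eq_mul]
  ring

/-- Solutions of the collocation equations are unique. -/
theorem StableForms.collocation_unique {V H K L : Type*} [AddCommGroup V] [Module ℝ V]
    [NormedAddCommGroup H] [InnerProductSpace ℝ H] [NormedAddCommGroup K] [InnerProductSpace ℝ K]
    [NormedAddCommGroup L] [InnerProductSpace ℝ L] {ι : V →ₗ[ℝ] H} {G : V →ₗ[ℝ] K}
    {B : V →ₗ[ℝ] L} {Vh : Submodule ℝ V} {Qh : Submodule ℝ L} {P M β : ℝ}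
    (S : StableForms ι G B Vh Qh P M β) {g g' : V} {q q' : L} {l : V → ℝ}
    (hg : g ∈ discDiv B Vh Qh) (hg' : g' ∈ discDiv B Vh Qh) (hq : q ∈ Qh) (hq' : q' ∈ Qh)
    (h : ∀ v ∈ Vh, inner ℝ (ι g) (ι v) - inner ℝ (B v) q = l v)
    (h' : ∀ v ∈ Vh, inner ℝ (ι g') (ι v) - inner ℝ (B v) q' = l v) : g = g' ∧ q = q' := by
  have hd : g - g' ∈ discDiv B Vh Qh := Submodule.sub_mem _ hg hg'
  have e1 : g = g' := by
    -- Testing with `g - g'`, which is discretely divergence-free, removes both pressures; the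
    -- inf-sup condition then settles `q = q'`.
    have h1 := h _ hd.1
    have h2 := h' _ hd.1
    rw [hd.2 q hq] at h1
    rw [hd.2 q' hq'] at h2
    rw [← sub_eq_zero]
    refine S.inj _ ?_
    rw [← norm_eq_zero, ← sq_eq_zero_iff, ← real_inner_self_eq_norm_sq]
    nth_rewrite 1 [map_sub]
    rw [inner_sub_left]
    linarith
  refine ⟨e1, ?_⟩
  have h3 : β * ‖q - q'‖ ≤ 0 := by
    refine S.norm_le_of_infsup (Qh.sub_mem hq hq') le_rfl fun v hv => ?_
    have h1 := h v hv
    have h2 := h' v hv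
    rw [e1] at h1
    rw [inner_sub_right]
    linarith
  have := S.β_pos
  exact sub_eq_zero.1 (norm_le_zero_iff.1 (by nlinarith))

/-- The collocation equations at the right endpoint follow from those at the left endpoint and the
midpoint equations. -/
theorem collocation_right {V H K L : Type*} [AddCommGroup V] [Module ℝ V]
    [NormedAddCommGroup H] [InnerProductSpace ℝ H] [NormedAddCommGroup K] [InnerProductSpace ℝ K]
    [NormedAddCommGroup L] [InnerProductSpace ℝ L] {ι : V →ₗ[ℝ] H} {G : V →ₗ[ℝ] K}
    {B : V →ₗ[ℝ] L} {v c c₀ c₁ : V} {p₀ p₁ e : L} {a b A A' : ℝ}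
    (hl : inner ℝ (ι (c₁ + c)) (ι v) + inner ℝ (G (c₀ + a • c₁)) (G v)
      - inner ℝ (B v) (p₀ + a • p₁ + e) = A)
    (hm : inner ℝ (ι c₁) (ι v) + inner ℝ (G c₀) (G v) - inner ℝ (B v) p₀
      + (a + b) / 2 * (inner ℝ (G c₁) (G v) - inner ℝ (B v) p₁) = (A + A') / 2) :
    inner ℝ (ι (c₁ - c)) (ι v) + inner ℝ (G (c₀ + b • c₁)) (G v)
      - inner ℝ (B v) (p₀ + b • p₁ - e) = A' := by
  simp only [map_add, map_sub, map_smul, inner_add_left, inner_sub_left, inner_add_right,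
    inner_sub_right, real_inner_smul_left, real_inner_smul_right] at hl ⊢
  linarith

theorem hasDerivAt_of_affine {X : Type*} [NormedAddCommGroup X] [NormedSpace ℝ X] {F : ℝ → X}
    {c₀ c₁ : X} {a b : ℝ} (h : ∀ s ∈ Ioc a b, F s = c₀ + s • c₁) {s : ℝ} (hs : s ∈ Ioo a b) :
    HasDerivAt F c₁ s := by
  have h1 : HasDerivAt (fun s : ℝ => c₀ + s • c₁) ((1 : ℝ) • c₁) s :=
    ((hasDerivAt_id s).smul_const c₁).const_add _
  rw [one_smul] at h1
  refine h1.congr_of_eventuallyEq ?_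
  filter_upwards [Ioo_mem_nhds hs.1 hs.2] with r hr
  exact h r ⟨hr.1, hr.2.le⟩

theorem tendsto_right_of_eqOn {X : Type*} [TopologicalSpace X] {F F' : ℝ → X} {a b : ℝ}
    (hab : a < b) (hF' : Continuous F') (h : ∀ s ∈ Ioo a b, F s = F' s) :
    Tendsto F (𝓝[>] a) (𝓝 (F' a)) := by
  refine ((hF'.tendsto a).mono_left nhdsWithin_le_nhds).congr' ?_
  filter_upwards [Ioo_mem_nhdsGT hab] with s hs
  exact (h s hs).symm

/-- `ϑ'` is affine with the values `1` and `-1` at the endpoints, so the corrected pressure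
interpolates `p(a) + e` and `p(b) - e` linearly. -/
theorem affine_add_deriv_bubble {X : Type*} [AddCommGroup X] [Module ℝ X] {p₀ p₁ e : X}
    {a b s : ℝ} (hab : a < b) :
    p₀ + s • p₁ + (-(1 / (b - a)) * (2 * s - a - b)) • e = p₀ + a • p₁ + e
      + ((s - a) / (b - a)) • (p₀ + b • p₁ - e - (p₀ + a • p₁ + e)) := by
  have hba : b - a ≠ 0 := (sub_pos.2 hab).ne'
  have e1 : -(1 / (b - a)) * (2 * s - a - b) = 1 - 2 * ((s - a) / (b - a)) := by
    field_simp; ring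
  have e2 : s • p₁ = a • p₁ + ((s - a) / (b - a)) • ((b - a) • p₁) := by
    rw [smul_smul, div_mul_cancel₀ _ hba]; module
  rw [e1, e2]
  module

variable {d : ℕ} {Ω : Set (EuclideanSpace ℝ (Fin d))} {Vh : Submodule ℝ (VL2 Ω)}
  {Qh : Submodule ℝ (L2 Ω)} {N : ℕ} {t : ℕ → ℝ} {f : ℝ → VL2 Ω} {u0h : VL2 Ω}
  {uh ut : ℝ → VL2 Ω} {ph pt : ℝ → L2 Ω}

theorem IsPolyOn.exists_affine {X : Type*} [AddCommGroup X] [Module ℝ X] {J : Set ℝ}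
    {W : Submodule ℝ X} {w : ℝ → X} (h : IsPolyOn 1 J W w) :
    ∃ c₀ ∈ W, ∃ c₁ ∈ W, ∀ s ∈ J, w s = c₀ + s • c₁ := by
  obtain ⟨c, hc, hw⟩ := h
  refine ⟨c 0, hc 0, c 1, hc 1, fun s hs => ?_⟩
  rw [hw s hs, Finset.sum_range_succ, Finset.sum_range_one]
  simp

/-- `g` and `q` satisfy the collocation equations for `x` and the load `F`. -/
def Collocates (hΩ : IsOpen Ω) (Vh : Submodule ℝ (VL2 Ω)) (F : VL2 Ω) (x g : VSub hΩ)
    (q : L2 Ω) : Prop :=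
  ∀ v ∈ VhSub hΩ Vh, inner ℝ ((VSub hΩ).subtype g) ((VSub hΩ).subtype v)
    + inner ℝ (gradL hΩ x) (gradL hΩ v) - inner ℝ (divL hΩ v) q = inner ℝ F ((VSub hΩ).subtype v)

/-- The discrete velocity on one time interval is affine, with a discretely divergence-free
slope. -/
theorem exists_affine_velocity (hΩ : IsOpen Ω) (hV : ∀ v ∈ Vh, v ∈ VSp Ω)
    (hsol : IsDiscreteSolution Ω Vh Qh N t f u0h uh ph) {n : ℕ} (hn : n < N)
    (hab : t n < t (n + 1)) {x : VSub hΩ} (hx : uh (t n) = x)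
    (hxX : x ∈ discDiv (divL hΩ) (VhSub hΩ Vh) Qh) :
    ∃ c₀ c₁ : VSub hΩ, x = c₀ + t n • c₁ ∧ c₁ ∈ discDiv (divL hΩ) (VhSub hΩ Vh) Qh ∧
      ∀ s ∈ Ioc (t n) (t (n + 1)), uh s = ((c₀ + s • c₁ : VSub hΩ) : VL2 Ω) := by
  obtain ⟨c₀', hc₀, c₁', hc₁, huh⟩ := (hsol.poly_u n hn).exists_affine
  have hmass := hsol.mass n hn
  have hcont := hsol.cont n hn
  set a := t n with ha
  set b := t (n + 1) with hb
  have hba : 0 < b - a := sub_pos.2 hab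
  obtain ⟨c₀, rfl⟩ : ∃ c₀ : VSub hΩ, c₀' = c₀ := ⟨⟨c₀', hV _ hc₀⟩, rfl⟩
  obtain ⟨c₁, rfl⟩ : ∃ c₁ : VSub hΩ, c₁' = c₁ := ⟨⟨c₁', hV _ hc₁⟩, rfl⟩
  have huV : ∀ s ∈ Ioc a b, uh s = ((c₀ + s • c₁ : VSub hΩ) : VL2 Ω) := huh
  have hxa : x = c₀ + a • c₁ := by
    rw [hx] at hcont
    exact Subtype.ext (tendsto_nhds_unique hcont
      (tendsto_right_of_eqOn (F' := fun s => (c₀ : VL2 Ω) + s • (c₁ : VL2 Ω)) hab (by fun_prop)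
        fun s hs => huh s ⟨hs.1, hs.2.le⟩))
  refine ⟨c₀, c₁, hxa, ⟨hc₁, fun q hq => ?_⟩, huV⟩
  have h1 := hmass q hq
  rw [intervalIntegral_affine (α := -inner ℝ (divL hΩ c₀) q) (β := -inner ℝ (divL hΩ c₁) q)
    hab.le (fun s hs => by
      rw [huV s ⟨hs.1, hs.2.le⟩, bForm_eq, map_add, map_smul, inner_add_left,
        real_inner_smul_left]
      ring)] at h1
  have h2 := hxX.2 q hq
  rw [hxa, map_add, map_smul, inner_add_left, real_inner_smul_left] at h2
  -- The mass equation says that the midpoint value is discretely divergence-free. So is the left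
  -- value, hence the slope.
  have h3 := (mul_eq_zero.1 h1).resolve_left hba.ne'
  have h4 : (b - a) * inner ℝ (divL hΩ c₁) q = 0 := by linarith
  exact (mul_eq_zero.1 h4).resolve_left hba.ne'

/-- The post-processed solution on one time interval. -/
theorem exists_collocation_on_interval (hΩ : IsOpen Ω) (hV : ∀ v ∈ Vh, v ∈ VSp Ω)
    (hsol : IsDiscreteSolution Ω Vh Qh N t f u0h uh ph)
    (hpp : IsPostProcessed Ω Vh Qh N t f uh ph ut pt) {n : ℕ} (hn : n < N) (hab : t n < t (n + 1))
    {x : VSub hΩ} (hx : uh (t n) = x) (hxX : x ∈ discDiv (divL hΩ) (VhSub hΩ Vh) Qh) :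
    ∃ y ∈ discDiv (divL hΩ) (VhSub hΩ Vh) Qh, uh (t (n + 1)) = y ∧
    ∃ gl ∈ discDiv (divL hΩ) (VhSub hΩ Vh) Qh, ∃ gr ∈ discDiv (divL hΩ) (VhSub hΩ Vh) Qh,
    ∃ ql ∈ Qh, ∃ qr ∈ Qh,
      Collocates hΩ Vh (f (t n)) x gl ql ∧ Collocates hΩ Vh (f (t (n + 1))) y gr qr ∧
      y - x = ((t (n + 1) - t n) / 2) • (gl + gr) ∧
      (∀ s ∈ Ioc (t n) (t (n + 1)), pt s = ql + ((s - t n) / (t (n + 1) - t n)) • (qr - ql)) ∧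
      Tendsto (deriv ut) (𝓝[>] (t n)) (𝓝 gl) := by
  obtain ⟨c₀, c₁, hxa, hc₁X, huV⟩ := exists_affine_velocity hΩ hV hsol hn hab hx hxX
  obtain ⟨p₀, hp₀, p₁, hp₁, hph⟩ := (hsol.poly_p n hn).exists_affine
  obtain ⟨c', e, hc, he, hut, hpt, a', w', q, hTa, hTw, hTq, hcol, -⟩ := hpp n hn
  have hmom := hsol.momentum n hn
  set a := t n with ha
  set b := t (n + 1) with hb
  have hba : 0 < b - a := sub_pos.2 hab
  obtain ⟨c, rfl⟩ : ∃ c : VSub hΩ, c' = c := ⟨⟨c', hV _ hc.1⟩, rfl⟩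
  have hcX : c ∈ discDiv (divL hΩ) (VhSub hΩ Vh) Qh := (isDiscDivFree_iff hΩ c).2 hc
  have hyx : c₀ + b • c₁ = x + (b - a) • c₁ := by rw [hxa]; module
  have huh : ∀ s ∈ Ioc a b, uh s = (c₀ : VL2 Ω) + s • (c₁ : VL2 Ω) := huV
  have hba' : -(1 / (b - a)) * (2 * a - a - b) = 1 := by field_simp; ring
  have hTut : Tendsto (deriv ut) (𝓝[>] a) (𝓝 ((c₁ + c : VSub hΩ) : VL2 Ω)) := by
    have h1 := tendsto_right_of_eqOn (F := deriv ut) hab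
      (F' := fun s => (c₁ : VL2 Ω) + (-(1 / (b - a)) * (2 * s - a - b)) • (c : VL2 Ω))
      (by fun_prop) (fun s hs => by
        refine HasDerivAt.deriv (((hasDerivAt_of_affine huh hs).add
          ((hasDerivAt_bubble a b s).smul_const (c : VL2 Ω))).congr_of_eventuallyEq ?_)
        filter_upwards [Ioo_mem_nhds hs.1 hs.2] with r hr
        exact hut r ⟨hr.1, hr.2.le⟩)
    rwa [hba', one_smul] at h1
  have hw' : w' = x := by
    have h1 := tendsto_right_of_eqOn (F := ut) hab
      (F' := fun s => (c₀ : VL2 Ω) + s • (c₁ : VL2 Ω) + bubble a b s • (c : VL2 Ω))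
      (by unfold bubble; fun_prop) (fun s hs => by
        rw [hut s ⟨hs.1, hs.2.le⟩, huh s ⟨hs.1, hs.2.le⟩])
    rw [tendsto_nhds_unique hTw h1, hxa]
    simp [bubble]
  have hpts : ∀ s ∈ Ioc a b,
      pt s = p₀ + s • p₁ + (-(1 / (b - a)) * (2 * s - a - b)) • e := by
    intro s hs
    rw [hpt s hs, hph s hs, (hasDerivAt_bubble a b s).deriv]
  have hq : q = p₀ + a • p₁ + e := by
    have h1 := tendsto_right_of_eqOn hab (by fun_prop) fun s hs => hpts s ⟨hs.1, hs.2.le⟩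
    rw [hba', one_smul] at h1
    exact tendsto_nhds_unique hTq h1
  have hL : Collocates hΩ Vh (f a) x (c₁ + c) (p₀ + a • p₁ + e) := by
    intro v hv
    have h1 := hcol v hv
    rw [tendsto_nhds_unique hTa hTut, hw', hq, bForm_eq, ← inner_gradL, ← sub_eq_add_neg] at h1
    exact h1
  -- The one-sided derivatives are `c₁ + c` and `c₁ - c`, with mean `c₁`; the bubble vanishes at
  -- both nodes and leaves the nodal velocities unchanged.
  refine ⟨c₀ + b • c₁, ?_, huV b ⟨hab, le_rfl⟩, c₁ + c, Submodule.add_mem _ hc₁X hcX, c₁ - c,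
    Submodule.sub_mem _ hc₁X hcX, p₀ + a • p₁ + e,
    Qh.add_mem (Qh.add_mem hp₀ (Qh.smul_mem _ hp₁)) he, p₀ + b • p₁ - e,
    Qh.sub_mem (Qh.add_mem hp₀ (Qh.smul_mem _ hp₁)) he, hL, ?_, ?_, ?_, hTut⟩
  · rw [hyx]
    exact Submodule.add_mem _ hxX (Submodule.smul_mem _ _ hc₁X)
  · intro v hv
    have h1 := hL v hv
    have h2 := hmom v hv
    rw [intervalIntegral_affine
      (α := inner ℝ (c₁ : VL2 Ω) (v : VL2 Ω) + inner ℝ (gradL hΩ c₀) (gradL hΩ v)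
        - inner ℝ (divL hΩ v) p₀)
      (β := inner ℝ (gradL hΩ c₁) (gradL hΩ v) - inner ℝ (divL hΩ v) p₁) hab.le (fun s hs => by
        rw [(hasDerivAt_of_affine huh hs).deriv, huV s ⟨hs.1, hs.2.le⟩, hph s ⟨hs.1, hs.2.le⟩,
          bForm_eq, ← inner_gradL, map_add, map_smul, inner_add_left, real_inner_smul_left,
          inner_add_right, real_inner_smul_right]
        ring)] at h2
    rw [hxa] at h1
    exact collocation_right h1 (mul_left_cancel₀ hba.ne' (h2.trans (div_mul_eq_mul_div _ _ _
      |>.trans (mul_div_assoc _ _ _))))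
  · rw [hyx]
    module
  · exact fun s hs => (hpts s hs).trans (affine_add_deriv_bubble hab)

/-- The post-processed solution: nodal values `x`, `q` of the velocity and the pressure and nodal
values `g` of the time derivative of the velocity. -/
theorem exists_collocation {P M β : ℝ} (hΩ : IsOpen Ω) (hV : ∀ v ∈ Vh, v ∈ VSp Ω)
    (S : StableForms (VSub hΩ).subtype (gradL hΩ) (divL hΩ) (VhSub hΩ Vh) Qh P M β)
    (hN : 0 < N) (ht : ∀ n < N, t n < t (n + 1)) (ht0 : t 0 = 0)
    (hu0 : IsDiscDivFree Ω Vh Qh u0h)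
    (hsol : IsDiscreteSolution Ω Vh Qh N t f u0h uh ph)
    (hpp : IsPostProcessed Ω Vh Qh N t f uh ph ut pt) :
    ∃ (x g : ℕ → VSub hΩ) (q : ℕ → L2 Ω),
      (∀ n ≤ N, uh (t n) = x n) ∧
      (∀ n ≤ N, g n ∈ discDiv (divL hΩ) (VhSub hΩ Vh) Qh) ∧ (∀ n ≤ N, q n ∈ Qh) ∧
      (∀ n ≤ N, Collocates hΩ Vh (f (t n)) (x n) (g n) (q n)) ∧
      (∀ n < N, x (n + 1) - x n = ((t (n + 1) - t n) / 2) • (g n + g (n + 1))) ∧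
      (∀ n < N, ∀ s ∈ Ioc (t n) (t (n + 1)),
        pt s = q n + ((s - t n) / (t (n + 1) - t n)) • (q (n + 1) - q n)) ∧
      Tendsto (deriv ut) (𝓝[>] 0) (𝓝 (g 0)) := by
  have hx : ∀ n, ∃ x : VSub hΩ, n ≤ N →
      uh (t n) = x ∧ x ∈ discDiv (divL hΩ) (VhSub hΩ Vh) Qh := by
    intro n
    induction n with
    | zero =>
      refine ⟨⟨u0h, hV _ hu0.1⟩, fun _ => ⟨by rw [ht0, hsol.initial], ?_⟩⟩
      exact (isDiscDivFree_iff hΩ ⟨u0h, hV _ hu0.1⟩).2 hu0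
    | succ n ih =>
      by_cases hn : n < N
      · obtain ⟨x, hx⟩ := ih
        obtain ⟨y, hy, hyu, -⟩ := exists_collocation_on_interval hΩ hV hsol hpp hn (ht n hn)
          (hx hn.le).1 (hx hn.le).2
        exact ⟨y, fun _ => ⟨hyu, hy⟩⟩
      · exact ⟨0, fun h => absurd h hn⟩
  choose x hx using hx
  have hg : ∀ n, ∃ (gl gr : VSub hΩ) (ql qr : L2 Ω), n < N →
      gl ∈ discDiv (divL hΩ) (VhSub hΩ Vh) Qh ∧ gr ∈ discDiv (divL hΩ) (VhSub hΩ Vh) Qh ∧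
      ql ∈ Qh ∧ qr ∈ Qh ∧ Collocates hΩ Vh (f (t n)) (x n) gl ql ∧
      Collocates hΩ Vh (f (t (n + 1))) (x (n + 1)) gr qr ∧
      x (n + 1) - x n = ((t (n + 1) - t n) / 2) • (gl + gr) ∧
      (∀ s ∈ Ioc (t n) (t (n + 1)), pt s = ql + ((s - t n) / (t (n + 1) - t n)) • (qr - ql)) ∧
      Tendsto (deriv ut) (𝓝[>] (t n)) (𝓝 gl) := by
    intro n
    by_cases hn : n < N
    · obtain ⟨y, hy, hyu, gl, hgl, gr, hgr, ql, hql, qr, hqr, h1, h2, h3, h4, h5⟩ :=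
        exists_collocation_on_interval hΩ hV hsol hpp hn (ht n hn) (hx n hn.le).1 (hx n hn.le).2
      obtain rfl : y = x (n + 1) := Subtype.ext (hyu.symm.trans (hx (n + 1) hn).1)
      exact ⟨gl, gr, ql, qr, fun _ => ⟨hgl, hgr, hql, hqr, h1, h2, h3, h4, h5⟩⟩
    · exact ⟨0, 0, 0, 0, fun h => absurd h hn⟩
  choose gl gr ql qr hg using hg
  -- Each node takes its values from the interval on its right, the last node from the interval on
  -- its left.
  let g : ℕ → VSub hΩ := fun n => if n < N then gl n else gr (n - 1)
  let q : ℕ → L2 Ω := fun n => if n < N then ql n else qr (n - 1)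
  have hgl : ∀ n < N, g n = gl n ∧ q n = ql n := fun n hn => ⟨if_pos hn, if_pos hn⟩
  have hgr : ∀ n < N, g (n + 1) = gr n ∧ q (n + 1) = qr n := by
    intro n hn
    by_cases hn1 : n + 1 < N
    · rw [(hgl _ hn1).1, (hgl _ hn1).2]
      obtain ⟨a1, -, a2, -, a3, -⟩ := hg (n + 1) hn1
      obtain ⟨-, b1, -, b2, -, b3, -⟩ := hg n hn
      -- At an interior node both sides solve the collocation equations with the same velocity and
      -- load, so the one-sided values coincide.
      refine S.collocation_unique a1 b1 a2 b2
        (l := fun v => inner ℝ (f (t (n + 1))) ((VSub hΩ).subtype v)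
          - inner ℝ (gradL hΩ (x (n + 1))) (gradL hΩ v)) (fun v hv => ?_) (fun v hv => ?_)
      · linarith [a3 v hv]
      · linarith [b3 v hv]
    · exact ⟨if_neg hn1, if_neg hn1⟩
  have hcase : ∀ n ≤ N, n < N ∨ ∃ k < N, n = k + 1 := by
    intro n hn
    rcases hn.lt_or_eq with h | rfl
    · exact Or.inl h
    · exact Or.inr ⟨n - 1, by omega, by omega⟩
  refine ⟨x, g, q, fun n hn => (hx n hn).1, fun n hn => ?_, fun n hn => ?_, fun n hn => ?_,
    fun n hn => ?_, fun n hn => ?_, ?_⟩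
  · rcases hcase n hn with h | ⟨k, hk, rfl⟩
    · rw [(hgl n h).1]; exact (hg n h).1
    · rw [(hgr k hk).1]; exact (hg k hk).2.1
  · rcases hcase n hn with h | ⟨k, hk, rfl⟩
    · rw [(hgl n h).2]; exact (hg n h).2.2.1
    · rw [(hgr k hk).2]; exact (hg k hk).2.2.2.1
  · rcases hcase n hn with h | ⟨k, hk, rfl⟩
    · rw [(hgl n h).1, (hgl n h).2]; exact (hg n h).2.2.2.2.1
    · rw [(hgr k hk).1, (hgr k hk).2]; exact (hg k hk).2.2.2.2.2.1
  · rw [(hgl n hn).1, (hgr n hn).1]; exact (hg n hn).2.2.2.2.2.2.1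
  · rw [(hgl n hn).2, (hgr n hn).2]; exact (hg n hn).2.2.2.2.2.2.2.1
  · rw [(hgl 0 hN).1, ← ht0]; exact (hg 0 hN).2.2.2.2.2.2.2.2

end Scheme

section Solution

variable {d : ℕ} {Ω : Set (EuclideanSpace ℝ (Fin d))} {T : ℝ} {r : ℕ}
  {f : ℝ → VL2 Ω} {u₀ : VL2 Ω} {u : ℝ → VL2 Ω} {p : ℝ → L2 Ω}

/-! ### Bounds for the exact solution -/

/-- The properties of the exact solution that enter the error analysis: the weak form of the
equations, and bounds in space and time with the constant `Λ`. -/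
structure SolutionBounds (hΩ : IsOpen Ω) (T : ℝ) (r : ℕ) (f : ℝ → VL2 Ω) (U U' : ℝ → VSub hΩ)
    (p p' : ℝ → L2 Ω) (Λ : ℝ) : Prop where
  weak : ∀ s ∈ Icc 0 T, ∀ v, inner ℝ ((VSub hΩ).subtype (U' s)) ((VSub hΩ).subtype v)
    + inner ℝ (gradL hΩ (U s)) (gradL hΩ v) - inner ℝ (divL hΩ v) (p s)
      = inner ℝ (f s) ((VSub hΩ).subtype v)
  div : ∀ s ∈ Icc 0 T, divL hΩ (U s) = 0
  div' : ∀ s ∈ Icc 0 T, divL hΩ (U' s) = 0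
  memU : ∀ s ∈ Icc 0 T, (U s : VL2 Ω) ∈ VHm Ω (r + 1)
  memU' : ∀ s ∈ Icc 0 T, (U' s : VL2 Ω) ∈ VHm Ω (r + 1)
  memp : ∀ s ∈ Icc 0 T, p s ∈ L20 Ω ∩ Hm Ω r
  memp' : ∀ s ∈ Icc 0 T, p' s ∈ L20 Ω ∩ Hm Ω r
  U_le : ∀ s ∈ Icc 0 T, vsobNorm Ω (r + 1) (U s) ≤ Λ
  U'_le : ∀ s ∈ Icc 0 T, vsobNorm Ω (r + 1) (U' s) ≤ Λ
  p_le : ∀ s ∈ Icc 0 T, sobNorm Ω r (p s) ≤ Λ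
  p'_le : ∀ s ∈ Icc 0 T, sobNorm Ω r (p' s) ≤ Λ
  incr : ∀ s ∈ Icc 0 T, ∀ t ∈ Icc 0 T, s ≤ t →
    vsobNorm Ω (r + 1) (U' t - U' s : VSub hΩ) ≤ Λ * (t - s)
  incr_p : ∀ s ∈ Icc 0 T, ∀ t ∈ Icc 0 T, s ≤ t → sobNorm Ω r (p' t - p' s) ≤ Λ * (t - s)
  trap : ∀ s ∈ Icc 0 T, ∀ t ∈ Icc 0 T, s ≤ t →
    ‖gradL hΩ (U t - U s - ((t - s) / 2) • (U' s + U' t))‖ ≤ Λ * (t - s) ^ 3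
  trap_p : ∀ s ∈ Icc 0 T, ∀ t ∈ Icc 0 T, s ≤ t →
    ‖p t - p s - ((t - s) / 2) • (p' s + p' t)‖ ≤ Λ * (t - s) ^ 3
  interp : ∀ s ∈ Icc 0 T, ∀ t ∈ Icc 0 T, s < t → ∀ x ∈ Icc s t,
    ‖p x - p s - ((x - s) / (t - s)) • (p t - p s)‖ ≤ Λ * (t - s) ^ 2

theorem derivWithin_apply (hT : 0 < T) (hu : ContDiffOn ℝ 4 u (Icc 0 T)) {s : ℝ}
    (hs : s ∈ Icc 0 T) (i : Fin d) :
    derivWithin u (Icc 0 T) s i = derivWithin (fun t => u t i) (Icc 0 T) s := by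
  have h1 := hasDerivWithinAt_of_contDiffOn (k := 4) (by norm_num) hu hs
  have h2 := (PiLp.proj (𝕜 := ℝ) 2 (fun _ : Fin d => L2 Ω) i).hasFDerivAt.comp_hasDerivWithinAt s h1
  exact (h2.derivWithin (uniqueDiffOn_Icc hT s hs)).symm

/-- Collects everything the error analysis needs to know about the exact solution. Boundary values,
divergence and mean value constraints are linear and closed, so they are inherited by the time
derivatives. -/
theorem exists_solutionBounds (hΩ : IsOpen Ω) [IsFiniteMeasure (volume.restrict Ω)] (hT : 0 < T)
    (hr : 1 ≤ r) (hsol : IsRegularStokesSolution Ω T r f u₀ u p) :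
    ∃ (Λ : ℝ) (U U' : ℝ → VSub hΩ), (∀ s ∈ Icc 0 T, (U s : VL2 Ω) = u s) ∧
      (∀ s ∈ Icc 0 T, (U' s : VL2 Ω) = derivWithin u (Icc 0 T) s) ∧
      SolutionBounds hΩ T r f U U' p (derivWithin p (Icc 0 T)) Λ := by
  have hd' : ∀ s ∈ Icc 0 T, derivWithin u (Icc 0 T) s ∈ VSp Ω := fun s hs i => by
    rw [derivWithin_apply hT hsol.reg_u hs]
    exact (hsol.reg_ux i).derivWithin_mem_H10 hΩ hT (by omega) (fun t ht => hsol.boundary t ht i) hs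
  have hex : ∀ s, ∃ U U' : VSub hΩ, s ∈ Icc 0 T → (U : VL2 Ω) = u s ∧
      (U' : VL2 Ω) = derivWithin u (Icc 0 T) s := by
    intro s
    by_cases hs : s ∈ Icc 0 T
    · exact ⟨⟨u s, hsol.boundary s hs⟩, ⟨_, hd' s hs⟩, fun _ => ⟨rfl, rfl⟩⟩
    · exact ⟨0, 0, fun h => absurd h hs⟩
  choose U U' hUU using hex
  have hU : ∀ s ∈ Icc 0 T, (U s : VL2 Ω) = u s := fun s hs => (hUU s hs).1
  have hU' : ∀ s ∈ Icc 0 T, (U' s : VL2 Ω) = derivWithin u (Icc 0 T) s := fun s hs => (hUU s hs).2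
  have hUi : ∀ s ∈ Icc 0 T, ∀ i, (U s : VL2 Ω) i = u s i := fun s hs i => by rw [hU s hs]
  have hUi' : ∀ s ∈ Icc 0 T, ∀ i, (U' s : VL2 Ω) i = derivWithin (fun t => u t i) (Icc 0 T) s :=
    fun s hs i => by rw [hU' s hs, derivWithin_apply hT hsol.reg_u hs]
  choose cu hcu0 hcu using fun i => (hsol.reg_ux i).exists_bounds hΩ hT
  obtain ⟨cp, hcp0, hcp⟩ := hsol.reg_p.exists_bounds hΩ hT
  set c := ∑ i, cu i + cp with hc
  have hc0 : 0 ≤ c := add_nonneg (Finset.sum_nonneg fun i _ => hcu0 i) hcp0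
  have hbu : ∀ i (I : List (Fin d)), I.length ≤ r + 1 → TimeBounds T (fun t => wD Ω I (u t i))
      (fun t => wD Ω I (derivWithin (fun t => u t i) (Icc 0 T) t)) c := fun i I hI =>
    (hcu i I hI).mono (by
      have := Finset.single_le_sum (f := cu) (fun i _ => hcu0 i) (Finset.mem_univ i)
      linarith)
  have hbp : ∀ I : List (Fin d), I.length ≤ r → TimeBounds T (fun t => wD Ω I (p t))
      (fun t => wD Ω I (derivWithin p (Icc 0 T) t)) c := fun I hI =>
    (hcp I hI).mono (by
      have := Finset.sum_nonneg (f := cu) (s := Finset.univ) fun i _ => hcu0 i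
      linarith)
  have hbp0 : TimeBounds T p (derivWithin p (Icc 0 T)) c := by
    have := hbp [] (by simp)
    simpa only [wD_nil hΩ] using this
  have mU : ∀ s ∈ Icc 0 T, (U s : VL2 Ω) ∈ VHm Ω (r + 1) := fun s hs i => by
    rw [hUi s hs]; exact (hsol.reg_ux i).1 s hs
  have mU' : ∀ s ∈ Icc 0 T, (U' s : VL2 Ω) ∈ VHm Ω (r + 1) := fun s hs i => by
    rw [hUi' s hs]; exact (hsol.reg_ux i).derivWithin_mem_Hm hΩ hT hs
  have mp' : ∀ s ∈ Icc 0 T, derivWithin p (Icc 0 T) s ∈ Hm Ω r := fun s hs =>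
    hsol.reg_p.derivWithin_mem_Hm hΩ hT hs
  set k₁ := Real.sqrt (sobCard d (r + 1))
  set k₂ := Real.sqrt (sobCard d r)
  set k₃ := Real.sqrt (sobCard d 1)
  set kd := Real.sqrt d
  -- The square roots count multi-indices and components, and pass from bounds for single
  -- derivatives to Sobolev norms.
  set Λ := (1 + kd * k₁ + k₂ + kd * k₃) * c with hΛ
  have l₁ : kd * (k₁ * c) ≤ Λ := by
    have : 0 ≤ (1 + k₂ + kd * k₃) * c := by positivity
    linarith
  have l₂ : k₂ * c ≤ Λ := by
    have : 0 ≤ (1 + kd * k₁ + kd * k₃) * c := by positivity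
    linarith
  have l₃ : kd * (k₃ * c) ≤ Λ := by
    have : 0 ≤ (1 + kd * k₁ + k₂) * c := by positivity
    linarith
  have l₄ : c ≤ Λ := by
    have : 0 ≤ (kd * k₁ + k₂ + kd * k₃) * c := by positivity
    linarith
  refine ⟨Λ, U, U', hU, hU', ?_⟩
  constructor
  · intro s hs v
    have h1 := congrArg (fun w => inner ℝ w (v : VL2 Ω)) (hsol.momentum s hs)
    simp only [inner_add_left, inner_sub_left] at h1
    have h2 : u s ∈ VHm Ω 2 := fun i => Hm_mono (by omega) ((hsol.reg_ux i).1 s hs)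
    rw [← bForm_eq_inner_grad hΩ (Hm_mono hr (hsol.reg_p.1 s hs)) v.2, bForm_eq, ← hU' s hs] at h1
    have h3 := aForm_eq_neg_inner_lapl hΩ h2 v.2
    rw [← hU s hs, ← inner_gradL hΩ, hU s hs] at h3
    rw [h3]
    simp only [Submodule.subtype_apply]
    linarith
  · intro s hs
    change dvg Ω (U s) = 0
    rw [hU s hs]; exact hsol.divFree s hs
  · intro s hs
    have h1 : HasDerivWithinAt (fun t => ∑ i, wD Ω [i] (u t i))
        (∑ i, derivWithin (fun t => wD Ω [i] (u t i)) (Icc 0 T) s) (Icc 0 T) s :=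
      HasDerivWithinAt.fun_sum fun i _ => hasDerivWithinAt_of_contDiffOn (k := 3) (by norm_num)
        ((hsol.reg_ux i).2 [i] (by simp)) hs
    have h2 : HasDerivWithinAt (fun t => ∑ i, wD Ω [i] (u t i)) 0 (Icc 0 T) s :=
      (hasDerivWithinAt_const s (Icc 0 T) (0 : L2 Ω)).congr (fun t ht => hsol.divFree t ht)
        (hsol.divFree s hs)
    rw [← (uniqueDiffOn_Icc hT s hs).eq_deriv _ h1 h2]
    change ∑ i, wD Ω [i] ((U' s : VL2 Ω) i) = _
    refine Finset.sum_congr rfl fun i _ => ?_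
    rw [hUi' s hs, (hsol.reg_ux i).wD_derivWithin hΩ hT (by simp) hs]
  · exact mU
  · exact mU'
  · exact fun s hs => ⟨hsol.meanZero s hs, hsol.reg_p.1 s hs⟩
  · refine fun s hs => ⟨?_, mp' s hs⟩
    have h1 := (hasDerivWithinAt_const s (Icc 0 T) (oneLp Ω)).inner ℝ
      (hasDerivWithinAt_of_contDiffOn (k := 3) (by norm_num) (hsol.reg_p.contDiffOn hΩ) hs)
    have h2 : HasDerivWithinAt (fun t => inner ℝ (oneLp Ω) (p t)) (0 : ℝ) (Icc 0 T) s :=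
      (hasDerivWithinAt_const s (Icc 0 T) (0 : ℝ)).congr
        (fun t ht => (inner_oneLp _).trans (hsol.meanZero t ht))
        ((inner_oneLp _).trans (hsol.meanZero s hs))
    have h3 := (uniqueDiffOn_Icc hT s hs).eq_deriv _ h1 h2
    rw [inner_zero_left, add_zero, inner_oneLp] at h3
    exact h3
  · refine fun s hs => (vsobNorm_le (fun i => sobNorm_le fun I hI => ?_) (by positivity)).trans l₁
    rw [hUi s hs]
    exact (hbu i I hI).val s hs
  · refine fun s hs => (vsobNorm_le (fun i => sobNorm_le fun I hI => ?_) (by positivity)).trans l₁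
    rw [hUi' s hs]
    exact (hbu i I hI).der s hs
  · exact fun s hs => (sobNorm_le fun I hI => (hbp I hI).val s hs).trans l₂
  · exact fun s hs => (sobNorm_le fun I hI => (hbp I hI).der s hs).trans l₂
  · intro s hs t ht hst
    have ht0 := sub_nonneg.2 hst
    refine (vsobNorm_le (A := k₁ * (c * (t - s))) (fun i => sobNorm_le fun I hI => ?_)
      (by positivity)).trans ?_
    · have e := wD_sub hΩ (mU' t ht i) (mU' s hs i) hI
      rw [Submodule.coe_sub, PiLp.sub_apply, e, hUi' s hs, hUi' t ht]
      exact (hbu i I hI).incr s hs t ht hst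
    · have := mul_le_mul_of_nonneg_right l₁ ht0
      linarith
  · intro s hs t ht hst
    have ht0 := sub_nonneg.2 hst
    refine (sobNorm_le (A := c * (t - s)) fun I hI => ?_).trans ?_
    · rw [wD_sub hΩ (mp' t ht) (mp' s hs) hI]
      exact (hbp I hI).incr s hs t ht hst
    · have := mul_le_mul_of_nonneg_right l₂ ht0
      linarith
  · intro s hs t ht hst
    have ht0 := sub_nonneg.2 hst
    refine (vsobNorm_one_ge hΩ _).trans ((vsobNorm_le (A := k₃ * (c * (t - s) ^ 3))
      (fun i => sobNorm_le fun I hI => ?_) (by positivity)).trans ?_)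
    · have hI' : I.length ≤ r + 1 := by omega
      have e1 := wD_add hΩ (mU' s hs i) (mU' t ht i) hI'
      have e2 := wD_smul hΩ ((HmSub Ω _).add_mem (mU' s hs i) (mU' t ht i)) hI' ((t - s) / 2)
      have e3 := wD_sub hΩ (mU t ht i) (mU s hs i) hI'
      have e4 := wD_sub hΩ ((HmSub Ω _).sub_mem (mU t ht i) (mU s hs i))
        ((HmSub Ω _).smul_mem ((t - s) / 2) ((HmSub Ω _).add_mem (mU' s hs i) (mU' t ht i))) hI'
      rw [Submodule.coe_sub, Submodule.coe_sub, Submodule.coe_smul, Submodule.coe_add,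
        PiLp.sub_apply, PiLp.sub_apply, PiLp.smul_apply, PiLp.add_apply, e4, e3, e2, e1,
        hUi' s hs, hUi' t ht, hUi s hs, hUi t ht]
      exact (hbu i I hI').trap s hs t ht hst
    · have := mul_le_mul_of_nonneg_right l₃ (pow_nonneg ht0 3)
      linarith
  · intro s hs t ht hst
    exact (hbp0.trap s hs t ht hst).trans
      (mul_le_mul_of_nonneg_right l₄ (pow_nonneg (sub_nonneg.2 hst) 3))
  · intro s hs t ht hst x hx
    exact (hbp0.interp s hs t ht hst x hx).trans (mul_le_mul_of_nonneg_right l₄ (sq_nonneg _))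

theorem SolutionBounds.mono {hΩ : IsOpen Ω} {U U' : ℝ → VSub hΩ} {p' : ℝ → L2 Ω} {Λ Λ' : ℝ}
    (h : SolutionBounds hΩ T r f U U' p p' Λ) (hΛ : Λ ≤ Λ') :
    SolutionBounds hΩ T r f U U' p p' Λ' where
  weak := h.weak
  div := h.div
  div' := h.div'
  memU := h.memU
  memU' := h.memU'
  memp := h.memp
  memp' := h.memp'
  U_le s hs := (h.U_le s hs).trans hΛ
  U'_le s hs := (h.U'_le s hs).trans hΛ
  p_le s hs := (h.p_le s hs).trans hΛ
  p'_le s hs := (h.p'_le s hs).trans hΛ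
  incr s hs t ht hst := (h.incr s hs t ht hst).trans
    (mul_le_mul_of_nonneg_right hΛ (sub_nonneg.2 hst))
  incr_p s hs t ht hst := (h.incr_p s hs t ht hst).trans
    (mul_le_mul_of_nonneg_right hΛ (sub_nonneg.2 hst))
  trap s hs t ht hst := (h.trap s hs t ht hst).trans
    (mul_le_mul_of_nonneg_right hΛ (pow_nonneg (sub_nonneg.2 hst) 3))
  trap_p s hs t ht hst := (h.trap_p s hs t ht hst).trans
    (mul_le_mul_of_nonneg_right hΛ (pow_nonneg (sub_nonneg.2 hst) 3))
  interp s hs t ht hst x hx := (h.interp s hs t ht hst x hx).trans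
    (mul_le_mul_of_nonneg_right hΛ (sq_nonneg _))

/-! ### The discrete initial values -/

/-- The auxiliary initial velocity is a Stokes projection of `(∂_t u(0), s)`, with a regular
pressure `s`. -/
theorem exists_initial_pressure (hΩ : IsOpen Ω) [IsFiniteMeasure (volume.restrict Ω)] (hT : 0 < T)
    (hr : 1 ≤ r) (hsol : IsRegularStokesSolution Ω T r f u₀ u p) {U' : VSub hΩ}
    (hU' : (U' : VL2 Ω) = derivWithin u (Icc 0 T) 0) :
    ∃ s ∈ L20 Ω ∩ Hm Ω r, ∀ v : VSub hΩ, aForm Ω (f 0 + lapl Ω u₀) v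
      = inner ℝ (gradL hΩ U') (gradL hΩ v) - inner ℝ (divL hΩ v) s := by
  have z : (0 : ℝ) ∈ Icc 0 T := ⟨le_rfl, hT.le⟩
  -- `m` is the mean value of `Δp(0)`; when the constant function vanishes in `L²(Ω)` any `m`
  -- serves.
  obtain ⟨m, hm⟩ : ∃ m : ℝ, inner ℝ (oneLp Ω) (m • oneLp Ω) = inner ℝ (oneLp Ω) (lap Ω (p 0)) := by
    by_cases h0 : oneLp Ω = 0
    · exact ⟨0, by rw [h0]; simp⟩
    · have h1 : inner ℝ (oneLp Ω) (oneLp Ω) ≠ 0 := by simpa using h0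
      refine ⟨inner ℝ (oneLp Ω) (lap Ω (p 0)) / inner ℝ (oneLp Ω) (oneLp Ω), ?_⟩
      rw [real_inner_smul_right, div_mul_cancel₀ _ h1]
  have hlap : lap Ω (p 0) ∈ Hm Ω r := lap_mem_Hm hsol.reg_p0
  refine ⟨m • oneLp Ω - lap Ω (p 0), ⟨?_, (HmSub Ω r).sub_mem
    ((HmSub Ω r).smul_mem m (oneLp_mem_Hm r)) hlap⟩, fun v => ?_⟩
  · change ∫ x in Ω, (m • oneLp Ω - lap Ω (p 0) : L2 Ω) x = 0
    rw [← inner_oneLp, inner_sub_right, hm, sub_self]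
  · have e : f 0 + lapl Ω u₀ = (U' : VL2 Ω) + grad Ω (p 0) := by
      rw [hU', ← hsol.momentum 0 z, hsol.initial]; abel
    have hg : grad Ω (p 0) ∈ VHm Ω 1 := fun i =>
      wD_mem_Hm (J := [i]) (Hm_mono (by omega : 2 ≤ r + 2) hsol.reg_p0) (by simp)
    rw [e, aForm_add_left hΩ (fun i => VSp_Hm_one U'.2 i) hg,
      aForm_grad hΩ (Hm_mono (by omega) hsol.reg_p0) v.2, bForm_eq, ← inner_gradL, inner_sub_right,
      real_inner_smul_right]
    have : inner ℝ (divL hΩ v) (oneLp Ω) = 0 := inner_oneLp_dvg hΩ v.2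
    rw [this]
    ring

/-- The second auxiliary problem is the collocation equation at time zero with derivative `a`,
whence `g = a`. Comparison with the exact equation leaves only `U' - a` as load for `x - y`. The
functions `a` and `y` project the same velocity with different pressures, so their difference sees
only `s - p'` modulo `Q_h`. -/
theorem StableForms.initial_error {V H K L : Type*} [AddCommGroup V] [Module ℝ V]
    [NormedAddCommGroup H] [InnerProductSpace ℝ H] [NormedAddCommGroup K] [InnerProductSpace ℝ K]
    [NormedAddCommGroup L] [InnerProductSpace ℝ L] {ι : V →ₗ[ℝ] H} {G : V →ₗ[ℝ] K}
    {B : V →ₗ[ℝ] L} {Vh : Submodule ℝ V} {Qh : Submodule ℝ L} {P M β : ℝ}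
    (S : StableForms ι G B Vh Qh P M β) {x g a U U' : V} {p p' s : L} {F : H}
    (hx : x ∈ discDiv B Vh Qh) (hg : g ∈ discDiv B Vh Qh)
    (ha : IsProj G B (discDiv B Vh Qh) U' s a)
    (hxa : ∀ v ∈ discDiv B Vh Qh, inner ℝ (G x) (G v) = inner ℝ (F - ι a) (ι v))
    (hcol : ∀ v ∈ discDiv B Vh Qh,
      inner ℝ (ι g) (ι v) + inner ℝ (G x) (G v) = inner ℝ F (ι v))
    (hexact : ∀ v, inner ℝ (ι U') (ι v) + inner ℝ (G U) (G v) - inner ℝ (B v) p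
      = inner ℝ F (ι v)) :
    g = a ∧ (∀ y, IsProj G B (discDiv B Vh Qh) U p y → ‖G (x - y)‖ ≤ P * ‖ι (U' - a)‖) ∧
      ∀ y, IsProj G B (discDiv B Vh Qh) U' p' y → ∀ q ∈ Qh, ‖G (a - y)‖ ≤ M * ‖s - p' - q‖ := by
  refine ⟨?_, fun y hy => ?_, fun y hy q hq => ?_⟩
  · have hd : g - a ∈ discDiv B Vh Qh := Submodule.sub_mem _ hg ha.1
    have h1 := hcol _ hd
    rw [hxa _ hd, inner_sub_left] at h1
    rw [← sub_eq_zero]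
    refine S.inj _ ?_
    rw [← norm_eq_zero, ← sq_eq_zero_iff, ← real_inner_self_eq_norm_sq]
    nth_rewrite 1 [map_sub]
    rw [inner_sub_left]
    linarith
  · have hd : x - y ∈ discDiv B Vh Qh := Submodule.sub_mem _ hx hy.1
    have e : ‖G (x - y)‖ ^ 2 = inner ℝ (ι (U' - a)) (ι (x - y)) := by
      have h1 := hxa _ hd
      have h2 := hy.2 _ hd
      have h3 := hexact (x - y)
      rw [← real_inner_self_eq_norm_sq]
      nth_rewrite 1 [map_sub]
      rw [inner_sub_left, h1, h2, map_sub ι U' a, inner_sub_left, inner_sub_left]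
      linarith
    have h1 := (real_inner_le_norm _ _).trans (mul_le_mul_of_nonneg_left (S.poincare (x - y))
      (norm_nonneg (ι (U' - a))))
    rw [← e] at h1
    have hP := S.P_nonneg
    by_cases h0 : ‖G (x - y)‖ = 0
    · rw [h0]; positivity
    · have hp : 0 < ‖G (x - y)‖ := lt_of_le_of_ne (norm_nonneg _) (Ne.symm h0)
      refine le_of_mul_le_mul_left ?_ hp
      linarith
  · have h1 := S.isProj_norm_le ((ha.sub hy).sub_left hq (Submodule.zero_mem _))
    rwa [sub_self, sub_zero, sub_zero, map_zero, norm_zero, zero_add] at h1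

end Solution

/-! ### Time meshes -/

section Mesh

variable {T : ℝ} {N : ℕ} {t : ℕ → ℝ}

theorem IsTimeMesh.mono (ht : IsTimeMesh T N t) {i j : ℕ} (hij : i ≤ j) (hj : j ≤ N) :
    t i ≤ t j := by
  induction j, hij using Nat.le_induction with
  | base => exact le_rfl
  | succ j hij ih => exact (ih (by omega)).trans (ht.lt j (by omega)).le

theorem IsTimeMesh.mem_Icc (ht : IsTimeMesh T N t) {n : ℕ} (hn : n ≤ N) : t n ∈ Icc 0 T :=
  ⟨ht.first ▸ ht.mono (Nat.zero_le n) hn, ht.last ▸ ht.mono hn le_rfl⟩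

theorem IsTimeMesh.pos (ht : IsTimeMesh T N t) (hT : 0 < T) : 0 < N := by
  rcases Nat.eq_zero_or_pos N with h | h
  · subst h
    have h1 := ht.first
    have h2 := ht.last
    linarith
  · exact h

theorem le_meshSize {n : ℕ} (hn : n < N) : t (n + 1) - t n ≤ meshSize N t :=
  le_ciSup (f := fun n : Fin N => t (n + 1) - t n) (Finite.bddAbove_range _) ⟨n, hn⟩

theorem IsTimeMesh.exists_mem_Ioc (ht : IsTimeMesh T N t) {s : ℝ} (hs : s ∈ Ioc 0 T) :
    ∃ n < N, s ∈ Ioc (t n) (t (n + 1)) := by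
  have key : ∀ m ≤ N, s ≤ t m → ∃ n < m, s ∈ Ioc (t n) (t (n + 1)) := by
    intro m
    induction m with
    | zero => intro _ h; rw [ht.first] at h; exact absurd hs.1 (not_lt.2 h)
    | succ m ih =>
      intro hm h
      by_cases h1 : s ≤ t m
      · obtain ⟨n, hn, h2⟩ := ih (by omega) h1
        exact ⟨n, by omega, h2⟩
      · exact ⟨m, by omega, not_le.1 h1, h⟩
  exact key N le_rfl (ht.last ▸ hs.2)

theorem IsTimeMesh.Ioc_eq_iUnion (ht : IsTimeMesh T N t) :
    Ioc 0 T = ⋃ n : Fin N, Ioc (t n) (t (n + 1)) := by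
  ext s
  rw [mem_iUnion]
  constructor
  · intro hs
    obtain ⟨n, hn, h⟩ := ht.exists_mem_Ioc hs
    exact ⟨⟨n, hn⟩, h⟩
  · rintro ⟨n, h⟩
    exact ⟨(ht.mem_Icc n.2.le).1.trans_lt h.1, h.2.trans (ht.mem_Icc (n := n + 1) n.2).2⟩

variable {E : Type*} [NormedAddCommGroup E]

theorem IsTimeMesh.aestronglyMeasurable (ht : IsTimeMesh T N t) {F : ℝ → E}
    (hF : ∀ n < N, ContinuousOn F (Ioc (t n) (t (n + 1)))) :
    AEStronglyMeasurable F (volume.restrict (Ioc 0 T)) := by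
  rw [ht.Ioc_eq_iUnion, aestronglyMeasurable_iUnion_iff]
  exact fun n => (hF n n.2).aestronglyMeasurable measurableSet_Ioc

theorem memLp_and_sqrt_integral_le (hT : 0 < T) {F : ℝ → E} {A : ℝ} (hA : 0 ≤ A)
    (hm : AEStronglyMeasurable F (volume.restrict (Ioc 0 T))) (hF : ∀ s ∈ Ioc 0 T, ‖F s‖ ≤ A) :
    MemLp F 2 (volume.restrict (Ioc 0 T)) ∧
      Real.sqrt (∫ s in (0 : ℝ)..T, ‖F s‖ ^ 2) ≤ Real.sqrt T * A := by
  refine ⟨MemLp.of_bound hm A ((ae_restrict_iff' measurableSet_Ioc).2 (.of_forall hF)), ?_⟩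
  have h1 : ‖∫ s in (0 : ℝ)..T, ‖F s‖ ^ 2‖ ≤ A ^ 2 * |T - 0| := by
    refine intervalIntegral.norm_integral_le_of_norm_le_const fun s hs => ?_
    rw [uIoc_of_le hT.le] at hs
    rw [norm_pow, norm_norm]
    exact pow_le_pow_left₀ (norm_nonneg _) (hF s hs) 2
  rw [sub_zero, abs_of_pos hT] at h1
  calc Real.sqrt (∫ s in (0 : ℝ)..T, ‖F s‖ ^ 2) ≤ Real.sqrt (T * A ^ 2) :=
        Real.sqrt_le_sqrt (((Real.le_norm_self _).trans h1).trans_eq (mul_comm _ _))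
    _ = Real.sqrt T * A := by rw [Real.sqrt_mul hT.le, Real.sqrt_sq hA]

/-- Error of a piecewise linear function from its nodal errors. -/
theorem norm_sub_interp_le [NormedSpace ℝ E] {p : ℝ → E} {q₀ q₁ : E} {a b s δ A : ℝ} (hab : a < b)
    (hs : s ∈ Ioc a b) (hp : ‖p s - p a - ((s - a) / (b - a)) • (p b - p a)‖ ≤ δ)
    (h₀ : ‖p a - q₀‖ ≤ A) (h₁ : ‖p b - q₁‖ ≤ A) :
    ‖p s - (q₀ + ((s - a) / (b - a)) • (q₁ - q₀))‖ ≤ δ + A := by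
  set θ := (s - a) / (b - a) with hθ
  have q0 : 0 ≤ θ := div_nonneg (by linarith [hs.1]) (by linarith)
  have q1 : θ ≤ 1 := (div_le_one (by linarith)).2 (by linarith [hs.2])
  have e : p s - (q₀ + θ • (q₁ - q₀)) = (p s - p a - θ • (p b - p a))
      + ((1 - θ) • (p a - q₀) + θ • (p b - q₁)) := by module
  rw [e]
  refine (norm_add_le _ _).trans (add_le_add hp ((norm_add_le _ _).trans ?_))
  rw [norm_smul, norm_smul, Real.norm_of_nonneg q0, Real.norm_of_nonneg (sub_nonneg.2 q1)]
  nlinarith [mul_le_mul_of_nonneg_left h₀ (sub_nonneg.2 q1), mul_le_mul_of_nonneg_left h₁ q0]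

end Mesh

/-! ### Nodal pressure errors and the `L²` error of the Stokes projection. -/

section Main

variable {d : ℕ} {Ω : Set (EuclideanSpace ℝ (Fin d))} {T : ℝ} {r : ℕ}
  {f : ℝ → VL2 Ω} {u₀ : VL2 Ω} {u : ℝ → VL2 Ω} {p p' : ℝ → L2 Ω} {Vh : Submodule ℝ (VL2 Ω)}
  {Qh : Submodule ℝ (L2 Ω)} {N : ℕ} {t : ℕ → ℝ} {P M β c h Λ : ℝ}

theorem sub_mem_L20 [IsFiniteMeasure (volume.restrict Ω)] {q q' : L2 Ω} (hq : q ∈ L20 Ω)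
    (hq' : q' ∈ L20 Ω) : q - q' ∈ L20 Ω := by
  change ∫ x in Ω, q x = 0 at hq
  change ∫ x in Ω, q' x = 0 at hq'
  change ∫ x in Ω, (q - q' : L2 Ω) x = 0
  rw [← inner_oneLp] at hq hq' ⊢
  rw [inner_sub_right, hq, hq', sub_zero]

/-- The nodal errors of the pressure. -/
theorem nodal_pressure_error [IsFiniteMeasure (volume.restrict Ω)] {hΩ : IsOpen Ω} {U U' : ℝ → VSub hΩ} (hT : 0 < T)
    (hb : SolutionBounds hΩ T r f U U' p p' Λ) (hΛ : 0 < Λ)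
    (S : StableForms (VSub hΩ).subtype (gradL hΩ) (divL hΩ) (VhSub hΩ Vh) Qh P M β)
    (hV : ∀ v ∈ Vh, v ∈ VSp Ω) (ha : HasApproxOrder Ω r c h Vh Qh) (hc : 0 < c) (hh : 0 < h)
    (ht : IsTimeMesh T N t) {K₀ : ℝ} (hK : 0 ≤ K₀) {x g : ℕ → VSub hΩ} {q : ℕ → L2 Ω}
    (hg : ∀ n ≤ N, g n ∈ discDiv (divL hΩ) (VhSub hΩ Vh) Qh) (hq : ∀ n ≤ N, q n ∈ Qh)
    (hcol : ∀ n ≤ N, Collocates hΩ Vh (f (t n)) (x n) (g n) (q n))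
    (hstep : ∀ n < N, x (n + 1) - x n = ((t (n + 1) - t n) / 2) • (g n + g (n + 1)))
    (hinit : ∀ y, IsProj (gradL hΩ) (divL hΩ) (discDiv (divL hΩ) (VhSub hΩ Vh) Qh) (U 0) (p 0) y →
      ‖gradL hΩ (x 0 - y)‖ ≤ K₀ * (c * h ^ r * Λ))
    (hinit' : ∀ y, IsProj (gradL hΩ) (divL hΩ) (discDiv (divL hΩ) (VhSub hΩ Vh) Qh) (U' 0) (p' 0) y →
      ‖gradL hΩ (g 0 - y)‖ ≤ K₀ * (c * h ^ r * Λ))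
    {n : ℕ} (hn : n ≤ N) :
    ‖p (t n) - q n‖ ≤ presConst P M β T K₀ * (c * h ^ r * Λ + Λ * meshSize N t ^ 2) := by
  set ε := c * h ^ r * Λ with hε
  set δ := Λ * meshSize N t ^ 2 with hδ
  have hε0 : 0 < ε := by positivity
  have hδ0 : 0 ≤ δ := by positivity
  have hI : ∀ {n}, n ≤ N → t n ∈ Icc 0 T := fun hn => ht.mem_Icc hn
  have hL20 : ∀ {q q' : L2 Ω}, q ∈ L20 Ω ∩ Hm Ω r → q' ∈ L20 Ω ∩ Hm Ω r →
      q - q' ∈ L20 Ω ∩ Hm Ω r := by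
    rintro q q' ⟨h1, h2⟩ ⟨h3, h4⟩
    exact ⟨sub_mem_L20 h1 h3, (HmSub Ω r).sub_mem h2 h4⟩
  -- One factor `τ_n` is kept for the summation over the steps, the other two become `τ²`.
  have htrap : ∀ n < N, Λ * (t (n + 1) - t n) ^ 3 ≤ (t (n + 1) - t n) * δ := by
    intro n hn
    have h0 : 0 ≤ t (n + 1) - t n := sub_nonneg.2 (ht.lt n hn).le
    have h1 : (t (n + 1) - t n) ^ 2 ≤ meshSize N t ^ 2 := pow_le_pow_left₀ h0 (le_meshSize hn) 2
    have h2 := mul_le_mul_of_nonneg_left h1 (mul_nonneg hΛ.le h0)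
    rw [hδ]
    linarith
  have hv := S.velocity_error (N := N) (t := t) ht.lt (T := T) (K₀ := K₀) (ε := ε) (δ := δ) hT.le
    (fun n hn => by rw [ht.first, sub_zero]; exact (hI hn).2) hK hε0 hδ0
    (x := x) (g := g) (U := fun n => U (t n)) (U' := fun n => U' (t n))
    (p := fun n => p (t n)) (p' := fun n => p' (t n)) (f := fun n => f (t n)) hg
    (fun n hn v hv => by
      have := hcol n hn v hv.1
      rw [hv.2 (q n) (hq n hn), sub_zero] at this
      exact this)
    (fun n hn v => hb.weak _ (hI hn) v) hstep
    (fun n hn q _ => by rw [hb.div _ (hI hn), inner_zero_left])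
    (fun n hn q _ => by rw [hb.div' _ (hI hn), inner_zero_left])
    (fun n hn => ha.exists_approx hΩ hc hh hV (hb.memU _ (hI hn)) (hb.memp _ (hI hn))
      (hb.U_le _ (hI hn)) (hb.p_le _ (hI hn)))
    (fun n hn => ha.exists_approx hΩ hc hh hV (hb.memU' _ (hI hn)) (hb.memp' _ (hI hn))
      (hb.U'_le _ (hI hn)) (hb.p'_le _ (hI hn)))
    (fun n hn => by
      have h1 := hb.incr _ (hI hn.le) _ (hI (n := n + 1) hn) (ht.lt n hn).le
      have h2 := hb.incr_p _ (hI hn.le) _ (hI (n := n + 1) hn) (ht.lt n hn).le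
      have := ha.exists_approx hΩ hc hh hV (w := U' (t (n + 1)) - U' (t n))
        (fun i => (HmSub Ω (r + 1)).sub_mem (hb.memU' _ (hI (n := n + 1) hn) i)
          (hb.memU' _ (hI hn.le) i))
        (hL20 (hb.memp' _ (hI (n := n + 1) hn)) (hb.memp' _ (hI hn.le))) h1 h2
      rwa [show c * h ^ r * (Λ * (t (n + 1) - t n)) = (t (n + 1) - t n) * ε by
        rw [hε]; ring] at this)
    (fun n hn => (hb.trap _ (hI hn.le) _ (hI (n := n + 1) hn) (ht.lt n hn).le).trans (htrap n hn))
    (fun n hn => (hb.trap_p _ (hI hn.le) _ (hI (n := n + 1) hn) (ht.lt n hn).le).trans (htrap n hn))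
    (by rw [ht.first]; exact hinit) (by rw [ht.first]; exact hinit') hn
  have hβ := S.β_pos
  have hM := S.M_nonneg
  have hap := ha.exists_approx hΩ hc hh hV (hb.memU _ (hI hn)) (hb.memp _ (hI hn))
    (hb.U_le _ (hI hn)) (hb.p_le _ (hI hn))
  obtain ⟨-, -, q', hq', -, hle⟩ := hap
  have h1 := S.pressure_error (hq n hn) (hcol n hn) (hb.weak _ (hI hn)) ⟨q', hq', hle⟩ hv.1 hv.2
  refine h1.trans ?_
  rw [presConst, add_mul, one_mul, div_mul_eq_mul_div]
  have h2 : velConst P M β T K₀ * (ε + δ) * (P + 1) + M * ε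
      ≤ (velConst P M β T K₀ * (P + 1) + M) * (ε + δ) := by
    have : 0 ≤ M * δ := by positivity
    linarith
  have h3 := div_le_div_of_nonneg_right h2 hβ.le
  linarith

/-- The constant in the `L²` error estimate for the Stokes projection. -/
def dualConst (M β : ℝ) : ℝ :=
  (1 + M / β) * (2 * (1 + M / β) + M + M) + M * (2 * (1 + M / β) + M)

/-- The `L²` error of the Stokes projection. -/
theorem norm_isProj_error_le {hΩ : IsOpen Ω}
    (S : StableForms (VSub hΩ).subtype (gradL hΩ) (divL hΩ) (VhSub hΩ Vh) Qh P M β)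
    (hV : ∀ v ∈ Vh, v ∈ VSp Ω) (hQ : ∀ q ∈ Qh, q ∈ L20 Ω) {C : ℝ} (hC0 : 0 ≤ C)
    (hC : ∀ g : VL2 Ω, ∃ v ∈ VSp Ω, ∃ q ∈ L20 Ω,
      (∀ w ∈ VSp Ω, aForm Ω v w + bForm Ω w q = inner ℝ g w) ∧
      (∀ s ∈ L20 Ω, bForm Ω v s = 0) ∧
      v ∈ VHm Ω 2 ∧ q ∈ Hm Ω 1 ∧ vsobNorm Ω 2 v + sobNorm Ω 1 q ≤ C * ‖g‖)
    (ha : HasApproxOrder Ω 1 c h Vh Qh) (hc : 0 < c) (hh : 0 < h) {w x : VSub hΩ} {s : L2 Ω}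
    (hx : IsProj (gradL hΩ) (divL hΩ) (discDiv (divL hΩ) (VhSub hΩ Vh) Qh) w s x)
    (hw : divL hΩ w = 0) (hs : s ∈ L20 Ω) {ε : ℝ}
    (hε : ∃ v ∈ VhSub hΩ Vh, ∃ q ∈ Qh, ‖gradL hΩ (w - v)‖ ≤ ε ∧ ‖s - q‖ ≤ ε) :
    ‖(VSub hΩ).subtype (w - x)‖ ≤ c * h * C * dualConst M β * ε := by
  have hβ := S.β_pos
  have hM := S.M_nonneg
  have hw' : ∀ q ∈ Qh, inner ℝ (divL hΩ w) q = 0 := fun q _ => by rw [hw, inner_zero_left]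
  have h1 := S.isProj_error' hx hw' hε
  obtain ⟨-, -, s', hs', -, h2⟩ := hε
  set z := ‖(VSub hΩ).subtype (w - x)‖ with hz
  -- The dual problem has the `L²` error itself as load. Its solution is `H² × H¹`-regular, and
  -- approximation of order one gains the factor `h`.
  obtain ⟨v, hv, q, hq, hdual, hdiv, hv2, hq1, hle⟩ := hC ((VSub hΩ).subtype (w - x))
  obtain ⟨v, rfl⟩ : ∃ v' : VSub hΩ, v = v' := ⟨⟨v, hv⟩, rfl⟩
  have n1 := vsobNorm_nonneg (Ω := Ω) 2 v
  have n2 := sobNorm_nonneg (Ω := Ω) 1 q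
  obtain ⟨v', hv', q', hq', h3, h4⟩ := ha.exists_approx hΩ hc hh hV (w := v) (q := q)
    (A := C * z) (A' := C * z) hv2 ⟨hq, hq1⟩ (by linarith) (by linarith)
  have hdiv' : ∀ s ∈ L20 Ω, inner ℝ (divL hΩ v) s = 0 := fun s hs => by
    have := hdiv s hs
    rwa [bForm_eq, neg_eq_zero] at this
  have key := S.isProj_duality (v := v) (v' := v') (q := q) (q' := q') (s' := s') hx hw'
    (fun y => by
      have := hdual y y.2
      rw [bForm_eq, ← inner_gradL] at this
      exact this)
    (fun q hq => hdiv' q (hQ q hq)) (hdiv' s hs) hv' hq' hs'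
  rw [← hz, pow_one] at *
  set a := 2 * (1 + M / β) + M with ha'
  have hCz : 0 ≤ C * z := by linarith
  have hε0 : 0 ≤ ε := (norm_nonneg _).trans h2
  have hκ : 0 ≤ 1 + M / β := by positivity
  have b1 : (1 + M / β) * ‖gradL hΩ (v - v')‖ * (‖gradL hΩ (w - x)‖ + M * ‖s - s'‖)
      ≤ (1 + M / β) * (c * h * (C * z)) * (a * ε + M * ε) := by gcongr
  have b2 : M * ‖q - q'‖ * ‖gradL hΩ (w - x)‖ ≤ M * (c * h * (C * z)) * (a * ε) := by gcongr
  have b3 : z ^ 2 ≤ z * (c * h * C * dualConst M β * ε) := by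
    rw [dualConst, ← ha']
    linarith
  by_cases h0 : z = 0
  · have hCnn : 0 ≤ c * h * C * dualConst M β * ε := by
      rw [dualConst]; positivity
    rw [h0]; exact hCnn
  · have hp : 0 < z := lt_of_le_of_ne (norm_nonneg _) (Ne.symm h0)
    exact le_of_mul_le_mul_left (by linarith [sq z]) hp

end Main

end StokesFEM

end

/-! ### Assembly of the initial error estimates and the pressure estimate. -/

theorem mainTheorem5
    (d : ℕ) (hd : d = 2 ∨ d = 3)
    (Ω : Set (EuclideanSpace ℝ (Fin d)))
    (hΩo : IsOpen Ω) (hΩb : Bornology.IsBounded Ω) (hΩc : IsConnected Ω)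
    (hreg : StokesH2Regular Ω)
    (T : ℝ) (hT : 0 < T) (r : ℕ) (hr : 1 ≤ r)
    (f : ℝ → VL2 Ω) (u₀ : VL2 Ω) (u : ℝ → VL2 Ω) (p : ℝ → L2 Ω)
    (hsol : IsRegularStokesSolution Ω T r f u₀ u p)
    (β c h₀ : ℝ) (hβ : 0 < β) (hc : 0 < c) (hh₀ : 0 < h₀) :
    ∃ C : ℝ, 0 < C ∧
      ∀ (h : ℝ) (Vh : Submodule ℝ (VL2 Ω)) (Qh : Submodule ℝ (L2 Ω)),
        0 < h → h ≤ h₀ → IsStablePair Ω r β c h Vh Qh →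
      ∀ (N : ℕ) (t : ℕ → ℝ), IsTimeMesh T N t →
      ∀ (u0h : VL2 Ω) (uh : ℝ → VL2 Ω) (ph : ℝ → L2 Ω) (ut : ℝ → VL2 Ω) (pt : ℝ → L2 Ω),
        IsDiscInitVal Ω Vh Qh (f 0) u₀ u0h →
        IsDiscreteSolution Ω Vh Qh N t f u0h uh ph →
        IsPostProcessed Ω Vh Qh N t f uh ph ut pt →
        (HasApproxOrder Ω 1 c h Vh Qh →
          ∀ (wh : VL2 Ω) (qh : L2 Ω), IsStokesProj Ω Vh Qh (u 0) (p 0) wh qh →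
            gradNorm Ω (wh - uh 0) ≤ C * h ^ (r + 1)) ∧
        (∀ (wh : VL2 Ω) (qh : L2 Ω) (ah : VL2 Ω),
          IsStokesProj Ω Vh Qh (derivWithin u (Icc 0 T) 0) (derivWithin p (Icc 0 T) 0) wh qh →
          Tendsto (deriv ut) (𝓝[>] 0) (𝓝 ah) →
            gradNorm Ω (wh - ah) ≤ C * h ^ r) ∧
        MemLp (fun s => p s - pt s) 2 (volume.restrict (Ioc 0 T)) ∧
        Real.sqrt (∫ s in (0 : ℝ)..T, ‖p s - pt s‖ ^ 2) ≤ C * (meshSize N t ^ 2 + h ^ r) := by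
  have hd0 : 0 < d := by omega
  have hfin : IsFiniteMeasure (volume.restrict Ω) := ⟨by simpa using hΩb.measure_lt_top⟩
  obtain ⟨R', hR'⟩ := hΩb.exists_norm_le
  obtain ⟨R, hR0, hR⟩ : ∃ R : ℝ, 0 ≤ R ∧ ∀ x ∈ Ω, ‖x‖ ≤ R :=
    ⟨max R' 0, le_max_right _ _, fun x hx => (hR' x hx).trans (le_max_left _ _)⟩
  obtain ⟨A, hA0, hA⟩ : ∃ A : ℝ, 0 ≤ A ∧ ∀ g : VL2 Ω, ∃ v ∈ VSp Ω, ∃ q ∈ L20 Ω,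
      (∀ w ∈ VSp Ω, aForm Ω v w + bForm Ω w q = inner ℝ g w) ∧
      (∀ s ∈ L20 Ω, bForm Ω v s = 0) ∧
      v ∈ VHm Ω 2 ∧ q ∈ Hm Ω 1 ∧ vsobNorm Ω 2 v + sobNorm Ω 1 q ≤ A * ‖g‖ := by
    obtain ⟨A, hA⟩ := hreg
    refine ⟨max A 0, le_max_right _ _, fun g => ?_⟩
    obtain ⟨v, hv, q, hq, h1, h2, h3, h4, h5⟩ := hA g
    exact ⟨v, hv, q, hq, h1, h2, h3, h4,
      h5.trans (mul_le_mul_of_nonneg_right (le_max_left _ _) (norm_nonneg _))⟩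
  have z : (0 : ℝ) ∈ Icc 0 T := ⟨le_rfl, hT.le⟩
  obtain ⟨Λ', U, U', hU, hU', hb'⟩ := exists_solutionBounds hΩo hT hr hsol
  obtain ⟨s, hs, hsA⟩ := exists_initial_pressure hΩo hT hr hsol (hU' 0 z)
  have hsp : s - derivWithin p (Icc 0 T) 0 ∈ L20 Ω ∩ Hm Ω r :=
    ⟨sub_mem_L20 hs.1 (hb'.memp' 0 z).1, (HmSub Ω r).sub_mem hs.2 (hb'.memp' 0 z).2⟩
  -- One constant for the exact solution and the two auxiliary pressures; the summand `1` makes it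
  -- strictly positive, as the energy argument divides by `D > 0`.
  obtain ⟨Λ, hΛ, hΛ1, hΛ2, hΛ3⟩ : ∃ Λ : ℝ, 0 < Λ ∧ Λ' ≤ Λ ∧ sobNorm Ω r s ≤ Λ ∧
      sobNorm Ω r (s - derivWithin p (Icc 0 T) 0) ≤ Λ := by
    have h1 := sobNorm_nonneg r s
    have h2 := sobNorm_nonneg r (s - derivWithin p (Icc 0 T) 0)
    exact ⟨1 + |Λ'| + sobNorm Ω r s + sobNorm Ω r (s - derivWithin p (Icc 0 T) 0),
      by positivity, by linarith [le_abs_self Λ'], by linarith [abs_nonneg Λ'],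
      by linarith [abs_nonneg Λ']⟩
  have hb := hb'.mono hΛ1
  set P : ℝ := 2 * R with hP
  have hP0 : 0 ≤ P := by positivity
  set M : ℝ := ((d : ℕ) : ℝ) with hM
  have hM0 : 0 ≤ M := by positivity
  set a : ℝ := 2 * (1 + M / β) + M with ha
  have ha0 : 0 ≤ a := by positivity
  -- For the pressure estimate order `r` of the initial errors suffices. The first summand bounds
  -- the initial velocity through two uses of Poincaré's inequality, without duality, so
  -- approximation of order one is not required; `M` accounts for the initial derivative.
  set K₀ : ℝ := P * (P * a) + M with hK
  have hK0 : 0 ≤ K₀ := by positivity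
  set κ : ℝ := presConst P M β T K₀ with hκ
  have hκ0 : 0 ≤ κ := by rw [hκ, presConst, velConst, energyConst]; positivity
  -- `C₁` comes from the duality estimate for the initial velocity, `C₂` from the pressure
  -- approximation for the initial derivative, and `C₃` from the nodal and interpolation errors of
  -- the pressure.
  set C₁ : ℝ := P * (c * A * dualConst M β * (c * Λ)) with hC₁
  have hC₁0 : 0 ≤ C₁ := by rw [hC₁, dualConst]; positivity
  set C₂ : ℝ := M * (c * Λ) with hC₂
  have hC₂0 : 0 ≤ C₂ := by positivity
  set C₃ : ℝ := Real.sqrt T * (Λ + κ * (c * Λ + Λ)) with hC₃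
  have hC₃0 : 0 ≤ C₃ := by positivity
  refine ⟨1 + C₁ + C₂ + C₃, by positivity, ?_⟩
  intro h Vh Qh hh _ hpair N t ht u0h uh ph ut pt hinit hdisc hpost
  have S := stableForms hΩo hd0 hR hR0 hβ hpair
  have hN := ht.pos hT
  obtain ⟨a0', sh, p0h, ⟨ha0d, hsh, ha0eq⟩, hu0d, hp0h, hu0eq⟩ := hinit
  obtain ⟨a0, rfl⟩ : ∃ a0 : VSub hΩo, a0' = a0 := ⟨⟨a0', hpair.subV _ ha0d.1⟩, rfl⟩
  obtain ⟨x, g, q, hx, hg, hq, hcol, hstep, hpt, hlim⟩ :=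
    exists_collocation hΩo hpair.subV S hN ht.lt ht.first hu0d hdisc hpost
  have hx0 : uh 0 = x 0 := by rw [← hx 0 (Nat.zero_le _), ht.first]
  have hxu : u0h = x 0 := by rw [← hx0, hdisc.initial]
  have hxX : x 0 ∈ discDiv (divL hΩo) (VhSub hΩo Vh) Qh :=
    (isDiscDivFree_iff hΩo _).2 (hxu ▸ hu0d)
  have haproj : IsProj (gradL hΩo) (divL hΩo) (discDiv (divL hΩo) (VhSub hΩo Vh) Qh)
      (U' 0) s a0 := by
    refine ⟨(isDiscDivFree_iff hΩo a0).2 ha0d, fun v hv => ?_⟩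
    have h1 := ha0eq v hv.1
    rw [hsA v, bForm_eq, hv.2 sh hsh, ← inner_gradL, neg_zero, add_zero] at h1
    exact h1
  obtain ⟨hg0, hE0, hF0⟩ := S.initial_error (F := f 0) (p := p 0)
    (p' := derivWithin p (Icc 0 T) 0) hxX (hg 0 (Nat.zero_le _)) haproj
    (fun v hv => by
      have h1 := hu0eq v hv.1
      rw [hxu, bForm_eq, hv.2 p0h hp0h, ← inner_gradL, neg_zero, add_zero] at h1
      exact h1)
    (fun v hv => by
      have h1 := hcol 0 (Nat.zero_le _) v hv.1
      rw [hv.2 _ (hq 0 (Nat.zero_le _)), sub_zero, ht.first] at h1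
      exact h1)
    (hb.weak 0 z)
  have hapx : ∃ v ∈ VhSub hΩo Vh, ∃ q ∈ Qh, ‖gradL hΩo (U' 0 - v)‖ ≤ c * h ^ r * Λ ∧
      ‖s - q‖ ≤ c * h ^ r * Λ :=
    hpair.approx.exists_approx hΩo hc hh hpair.subV (hb.memU' 0 z) hs (hb.U'_le 0 z) hΛ2
  obtain ⟨-, -, q', hq', -, hq'le⟩ := hpair.approx.exists_approx hΩo hc hh hpair.subV
    (hb.memU' 0 z) hsp (hb.U'_le 0 z) hΛ3
  have hF : ∀ y, IsProj (gradL hΩo) (divL hΩo) (discDiv (divL hΩo) (VhSub hΩo Vh) Qh)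
      (U' 0) (derivWithin p (Icc 0 T) 0) y → ‖gradL hΩo (g 0 - y)‖ ≤ M * (c * h ^ r * Λ) :=
    fun y hy => by
      rw [hg0]
      exact (hF0 y hy q' hq').trans (mul_le_mul_of_nonneg_left hq'le hM0)
  have hhr : 0 < h ^ r := pow_pos hh r
  refine ⟨fun ha1 wh qh hw => ?_, fun wh qh ah hw hah => ?_, ?_⟩
  · obtain ⟨w, rfl⟩ : ∃ w : VSub hΩo, wh = w := ⟨⟨wh, hpair.subV _ hw.div.1⟩, rfl⟩
    rw [← hU 0 z] at hw
    rw [hx0, ← Submodule.coe_sub, ← norm_gradL, map_sub, norm_sub_rev, ← map_sub]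
    refine (hE0 w (hw.isProj hΩo)).trans ?_
    have h1 := norm_isProj_error_le S hpair.subV hpair.subQ hA0 hA ha1 hc hh haproj (hb.div' 0 z)
      hs.1 hapx
    refine (mul_le_mul_of_nonneg_left h1 hP0).trans ?_
    calc P * (c * h * A * dualConst M β * (c * h ^ r * Λ)) = C₁ * h ^ (r + 1) := by rw [hC₁]; ring
      _ ≤ (1 + C₁ + C₂ + C₃) * h ^ (r + 1) :=
        mul_le_mul_of_nonneg_right (by linarith) (by positivity)
  · obtain ⟨w, rfl⟩ : ∃ w : VSub hΩo, wh = w := ⟨⟨wh, hpair.subV _ hw.div.1⟩, rfl⟩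
    rw [← hU' 0 z] at hw
    have hag : ah = (g 0 : VL2 Ω) := tendsto_nhds_unique hah hlim
    rw [hag, ← Submodule.coe_sub, ← norm_gradL, map_sub, norm_sub_rev,
      ← map_sub]
    refine (hF w (hw.isProj hΩo)).trans ?_
    calc M * (c * h ^ r * Λ) = C₂ * h ^ r := by rw [hC₂]; ring
      _ ≤ (1 + C₁ + C₂ + C₃) * h ^ r := mul_le_mul_of_nonneg_right (by linarith) hhr.le
  · have hε0 : 0 ≤ c * h ^ r * Λ := by positivity
    have hzE : ‖(VSub hΩo).subtype (U' 0 - a0)‖ ≤ P * (a * (c * h ^ r * Λ)) :=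
      (S.poincare _).trans (mul_le_mul_of_nonneg_left (S.isProj_error' haproj
        (fun q _ => by rw [hb.div' 0 z, inner_zero_left]) hapx) hP0)
    have hnode : ∀ n ≤ N, ‖p (t n) - q n‖ ≤ κ * (c * h ^ r * Λ + Λ * meshSize N t ^ 2) :=
      fun n hn => nodal_pressure_error hT hb hΛ S hpair.subV hpair.approx hc hh ht hK0 hg hq hcol
        hstep
        (fun y hy => (hE0 y hy).trans (by
          have h1 := mul_le_mul_of_nonneg_left hzE hP0
          have h2 : 0 ≤ M * (c * h ^ r * Λ) := by positivity
          rw [hK]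
          linarith))
        (fun y hy => (hF y hy).trans (by
          have h2 : 0 ≤ P * (P * a) * (c * h ^ r * Λ) := by positivity
          rw [hK]
          linarith)) hn
    set E : ℝ := Λ * meshSize N t ^ 2 + κ * (c * h ^ r * Λ + Λ * meshSize N t ^ 2) with hE
    have hE' : E ≤ (Λ + κ * (c * Λ + Λ)) * (meshSize N t ^ 2 + h ^ r) := by
      have h1 : 0 ≤ Λ * h ^ r := by positivity
      have h2 : 0 ≤ κ * (c * Λ) * meshSize N t ^ 2 := by positivity
      have h3 : 0 ≤ κ * Λ * h ^ r := by positivity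
      rw [hE]
      linarith
    -- The bound is uniform in time: interpolation error of `p` plus a convex combination of two
    -- nodal errors.
    have hbound : ∀ s ∈ Ioc 0 T, ‖p s - pt s‖ ≤ E := by
      intro s hs
      obtain ⟨n, hn, hsn⟩ := ht.exists_mem_Ioc hs
      have hlt := ht.lt n hn
      rw [hpt n hn s hsn]
      have h1 := hb.interp _ (ht.mem_Icc hn.le) _ (ht.mem_Icc (n := n + 1) hn) hlt s
        ⟨hsn.1.le, hsn.2⟩
      refine norm_sub_interp_le hlt hsn (h1.trans ?_) (hnode n hn.le) (hnode (n + 1) hn)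
      exact mul_le_mul_of_nonneg_left
        (pow_le_pow_left₀ (sub_nonneg.2 hlt.le) (le_meshSize hn) 2) hΛ.le
    have hmeas : AEStronglyMeasurable (fun s => p s - pt s) (volume.restrict (Ioc 0 T)) := by
      refine ht.aestronglyMeasurable fun n hn => ContinuousOn.sub ?_ ?_
      · refine (hsol.reg_p.contDiffOn hΩo).continuousOn.mono fun s hs => ?_
        exact ⟨(ht.mem_Icc hn.le).1.trans hs.1.le, hs.2.trans (ht.mem_Icc (n := n + 1) hn).2⟩
      · exact ContinuousOn.congr (by fun_prop) (hpt n hn)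
    have hE0' : 0 ≤ E := by positivity
    obtain ⟨h1, h2⟩ := memLp_and_sqrt_integral_le hT hE0' hmeas hbound
    refine ⟨h1, h2.trans ?_⟩
    have h3 : 0 ≤ meshSize N t ^ 2 + h ^ r := by positivity
    calc Real.sqrt T * E ≤ C₃ * (meshSize N t ^ 2 + h ^ r) := by
          rw [hC₃, mul_assoc]
          exact mul_le_mul_of_nonneg_left hE' (Real.sqrt_nonneg T)
      _ ≤ (1 + C₁ + C₂ + C₃) * (meshSize N t ^ 2 + h ^ r) :=
        mul_le_mul_of_nonneg_right (by linarith) h3
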